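/- Let $r\ge 2$ and let $n,m\ge 1$ be coprime integers, with $n>m$ if $r=2$ and $n\ge m$ if $r\ge 3$. An $r$-uniform hypergraph $A$ is a set together with a set $R[A]$ of $r$-element subsets of it; substructures are induced ones. For a finite $r$-uniform hypergraph $X$ put $\delta(X)=n|X|-m|R[X]|$. For a hypergraph $A$, all of whose finite substructures have non-negative $\delta$, and a finite $X\subseteq A$, put $d_A(X)=\min\{\delta(Y): X\subseteq Y\subseteq A,\ Y \text{ finite}\}$; for $Z\subseteq A$ put $d_A(X/Z)=\min\{d_A(X\cup Y)-d_A(Y): Y\subseteq Z \text{ finite}\}$ and ${\rm cl}^d_A(Z)=\{a\in A: d_A(\{a\}/Z)=0\}$. Write $Z\le_d A$ if ${\rm cl}^d_A(Z)=Z$. Let $f:\mathbb{R}^{\ge0}\to\mathbb{R}^{\ge0}$ be continuous and strictly increasing with $f(x)\to\infty$ as $x\to\infty$, $f(0)=0$ and $f(1)=n$. Let $\mathcal{C}_f$ be the class of finite $r$-uniform hypergraphs $A$ such that $\delta(X)\ge 0$ and $\delta(X)\ge f(|X|)$ for all $X\subseteq A$. Suppose that $f$ is good, that is, $(\mathcal{C}_f,\le_d)$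 has the free amalgamation property: if $A_0\le_d A_1$ and $A_0\le_d A_2$ with $A_1,A_2\in\mathcal{C}_f$, then the free amalgam $F=A_1\coprod_{A_0}A_2$ (the disjoint union over $A_0$, with only the relations of $A_1$ and of $A_2$) is in $\mathcal{C}_f$ and $A_1,A_2\le_d F$. Suppose also that some structure in $\mathcal{C}_f$ has a hyperedge (equivalently $f(r)\le nr-m$). Let $M_f$ be the generic structure of $(\mathcal{C}_f,\le_d)$: the countable hypergraph, unique up to isomorphism, all of whose finite substructures are in $\mathcal{C}_f$, which is the union of a chain of finite $d$-closed subsets, and which has the property that whenever $X\le_d M_f$ is finite and $X\le_d B\in\mathcal{C}_f$, there is an embedding $\alpha:B\to M_f$ which is the identity on $X$ and satisfies $\alpha(B)\le_d M_f$. Write $G={\rm Aut}(M_f)$, $d=d_{M_f}$, ${\rm cl}^d={\rm cl}^d_{M_f}$ and $\mathcal{X}=\{{\rm cl}^d(X): X\subseteq M_f\text{ finite}\}$. For $A\in\mathcal{X}$, an element $b\in M_f$ is basic over $A$ if $b\notin A$ and, whenever $A\subseteq C\in\mathcal{X}$ and $d(b/C)<d(b/A)$, then $b\in C$. Suppose that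 $M_f$ is monodimensional: for every $A\in\mathcal{X}$ and every $b$ basic over $A$, with $D$ the orbit of $b$ under the pointwise stabiliser of $A$ in $G$, there is $B\in\mathcal{X}$ with $A\subseteq B$ and $M_f={\rm cl}^d(B\cup D)$. Then for every $1\ne g\in G$, every element of $G$ is a product of $192$ conjugates of $g^{\pm1}$ (each factor being a conjugate of $g$ or of $g^{-1}$). In particular, $G$ is a simple group. -/

import Mathlib

open scoped NNReal

/-- An `r`-uniform hypergraph on `V`: the structures in a signature with one `r`-ary relation
symbol `R` that is symmetric and holds only of tuples with distinct entries, given by the set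
`R[V]` of the `r`-subsets on which `R` holds. -/
@[ext]
structure UHypergraph (r : ℕ) (V : Type*) where
  edges : Set (Finset V)
  card_eq : ∀ e ∈ edges, e.card = r

namespace UHypergraph

variable {r : ℕ} {V W : Type*}

/-- The induced substructure on a subset. -/
def induce (H : UHypergraph r V) (S : Set V) : UHypergraph r S where
  edges := {e | e.map (Function.Embedding.subtype (· ∈ S)) ∈ H.edges}
  card_eq e he := by
    have h := H.card_eq _ he
    rwa [Finset.card_map] at h

/-- `φ` is an embedding of structures (an isomorphism onto the induced substructure on its
range). -/
def IsEmb (H : UHypergraph r V) (K : UHypergraph r W) (φ : V ↪ W) : Prop :=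
  ∀ e : Finset V, e ∈ H.edges ↔ e.map φ ∈ K.edges

/-- The automorphism group, as a subgroup of the group of all permutations. -/
def Aut (H : UHypergraph r V) : Subgroup (Equiv.Perm V) where
  carrier := {σ | H.IsEmb H σ.toEmbedding}
  one_mem' := by
    intro e
    have : e.map (Equiv.toEmbedding (1 : Equiv.Perm V)) = e :=
      Finset.map_refl
    rw [this]
  mul_mem' := by
    intro σ τ hσ hτ e
    rw [hτ e, hσ (e.map τ.toEmbedding), Finset.map_map]
    rfl
  inv_mem' := by
    intro σ hσ e
    rw [hσ (e.map (σ⁻¹).toEmbedding), Finset.map_map]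
    have : e.map ((σ⁻¹).toEmbedding.trans σ.toEmbedding) = e := by
      ext x; simp
    rw [this]

open Classical in
/-- The predimension `δ(X) = n |X| - m |R[X]|` of (the substructure on) a finite set `X`. -/
noncomputable def predim (n m : ℕ) (H : UHypergraph r V) (X : Finset V) : ℤ :=
  n * (X.card : ℤ) - m * ((X.powerset.filter (· ∈ H.edges)).card : ℤ)

/-- The dimension `d(X)` of a finite set `X` in `H`: the least predimension of a finite set
containing `X`. -/
noncomputable def dim (n m : ℕ) (H : UHypergraph r V) (X : Finset V) : ℤ :=
  sInf {k | ∃ Y : Finset V, X ⊆ Y ∧ k = predim n m H Y}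

open Classical in
/-- `d(X/Z) = min {d(X ∪ Y) - d(Y) : Y ⊆ Z finite}` for an arbitrary set `Z`. -/
noncomputable def relDim (n m : ℕ) (H : UHypergraph r V) (X : Finset V) (Z : Set V) : ℤ :=
  sInf {k | ∃ Y : Finset V, (Y : Set V) ⊆ Z ∧ k = dim n m H (X ∪ Y) - dim n m H Y}

/-- The `d`-closure `cl^d(Z) = {a : d(a/Z) = 0}`, computed in `H`. -/
def dcl (n m : ℕ) (H : UHypergraph r V) (Z : Set V) : Set V :=
  {a | relDim n m H {a} Z = 0}

/-- `Z ≤_d H`: the set `Z` is `d`-closed in `H`. -/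
def DClosed (n m : ℕ) (H : UHypergraph r V) (Z : Set V) : Prop :=
  dcl n m H Z = Z

/-- The class `C_0` of finite structures in which every subset has non-negative predimension. -/
def InC0 (n m : ℕ) (H : UHypergraph r V) : Prop :=
  Finite V ∧ ∀ X : Finset V, 0 ≤ predim n m H X

/-- The class `C_f`: the structures in `C_0` with `δ(X) ≥ f(|X|)` for every subset `X`. -/
def InCf (n m : ℕ) (f : ℝ≥0 → ℝ≥0) (H : UHypergraph r V) : Prop :=
  InC0 n m H ∧ ∀ X : Finset V, (f (X.card : ℝ≥0) : ℝ) ≤ (predim n m H X : ℝ)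

/-- `F` is the free amalgam of its substructures on `A₁` and `A₂` over their common part
`A₁ ∩ A₂`: its points are those of `A₁` and `A₂`, and its only relations are those on `A₁`
and those on `A₂`. -/
def IsFreeAmalgam (F : UHypergraph r V) (A₁ A₂ : Set V) : Prop :=
  A₁ ∪ A₂ = Set.univ ∧ ∀ e ∈ F.edges, (e : Set V) ⊆ A₁ ∨ (e : Set V) ⊆ A₂

/-- The free `≤_d`-amalgamation property of `C_f`: if `A₀ ≤_d A₁, A₂` are in `C_f` then the free
amalgam `F` of `A₁` and `A₂` over `A₀` is in `C_f` and `A₁, A₂ ≤_d F`.  Every amalgamation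
problem is, up to isomorphism, of the form `A₀ = A₁ ∩ A₂ ⊆ A₁, A₂ ⊆ F` used here. -/
def HasFreeAmalgamation (r n m : ℕ) (f : ℝ≥0 → ℝ≥0) : Prop :=
  ∀ (V : Type) (F : UHypergraph r V) (A₁ A₂ : Set V), F.IsFreeAmalgam A₁ A₂ →
    InCf n m f (F.induce A₁) → InCf n m f (F.induce A₂) →
    DClosed n m (F.induce A₁) (Subtype.val ⁻¹' (A₁ ∩ A₂)) →
    DClosed n m (F.induce A₂) (Subtype.val ⁻¹' (A₁ ∩ A₂)) →
    InCf n m f F ∧ DClosed n m F A₁ ∧ DClosed n m F A₂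

/-- `f` is a good control function: continuous, (strictly) increasing, tending to infinity, and
such that `C_f` has the free `≤_d`-amalgamation property. -/
structure IsGood (r n m : ℕ) (f : ℝ≥0 → ℝ≥0) : Prop where
  continuous : Continuous f
  strictMono : StrictMono f
  tendsto : Filter.Tendsto f Filter.atTop Filter.atTop
  amalgamation : HasFreeAmalgamation r n m f

/-- `H` is the generic structure `M_f` of `(C_f, ≤_d)`: it is countable, its finite substructures
are in `C_f`, it is the union of a chain of finite `d`-closed sets, and whenever `X ≤_d H` is
finite and `X ≤_d K ∈ C_f`, there is an embedding of `K` into `H` over `X` whose image is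
`d`-closed in `H`.  These properties determine `H` up to isomorphism. -/
structure IsGeneric (n m : ℕ) (f : ℝ≥0 → ℝ≥0) (H : UHypergraph r V) : Prop where
  countable : Countable V
  age : ∀ S : Set V, S.Finite → InCf n m f (H.induce S)
  chain : ∃ S : ℕ → Set V, Monotone S ∧ (∀ i, (S i).Finite ∧ DClosed n m H (S i)) ∧
    ⋃ i, S i = Set.univ
  extension : ∀ X : Set V, X.Finite → DClosed n m H X →
    ∀ (B : Type) (K : UHypergraph r B), InCf n m f K →
    ∀ ι : X ↪ B, (H.induce X).IsEmb K ι → DClosed n m K (Set.range ι) →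
    ∃ φ : B ↪ V, K.IsEmb H φ ∧ DClosed n m H (Set.range φ) ∧ ∀ x : X, φ (ι x) = x

/-- The family `𝒳` of the `d`-closures of finite sets. -/
def closedFam (n m : ℕ) (H : UHypergraph r V) : Set (Set V) :=
  {A | ∃ X : Finset V, A = dcl n m H X}

/-- `b` is basic over `A`. -/
def IsBasic (n m : ℕ) (H : UHypergraph r V) (b : V) (A : Set V) : Prop :=
  b ∉ A ∧ ∀ C ∈ closedFam n m H, A ⊆ C → relDim n m H {b} C < relDim n m H {b} A → b ∈ C

/-- `orb(b/A)`: the orbit of `b` under the pointwise stabiliser of `A` in the automorphism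
group. -/
def orb (H : UHypergraph r V) (b : V) (A : Set V) : Set V :=
  {c | ∃ σ ∈ H.Aut, (∀ a ∈ A, σ a = a) ∧ σ b = c}

/-- `H` is monodimensional: for every `A ∈ 𝒳` and every basic orbit `D` over `A` there is
`B ∈ 𝒳` containing `A` such that `cl^d(B, D)` is everything. -/
def Monodimensional (n m : ℕ) (H : UHypergraph r V) : Prop :=
  ∀ A ∈ closedFam n m H, ∀ b : V, IsBasic n m H b A →
    ∃ B ∈ closedFam n m H, A ⊆ B ∧ dcl n m H (B ∪ H.orb b A) = Set.univ

end UHypergraph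

/-! Call `A` and `C` independent over `B` when the closures of `A ∪ B` and `C ∪ B` meet in the
closure of `B`, no edge crosses between them, and their union is again d-closed. Free amalgamation
makes this a stationary independence relation on the generic structure: independent copies exist
(`IsGeneric.exists_freeOver`) and automorphisms agreeing on the closed base can be glued
(`FreeOver.exists_glue`). It refines the weak independence given by additivity of `d`. The bridge
between the two is `FreeOver.of_dim`: sets weakly independent from `C` over `B` and free from each
other over `B ∪ C` are already free over `B`. `IndepGeometry` collects these facts; beyond them the
group-theoretic argument uses only countability, faithfulness of the action, monodimensionality and
the triviality of bounded elements.

Let `g ≠ 1`. If `g` kept every point inside its closure over one finite closed set, hyperedges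
attached freely at each point would force `g = 1` (`IsGeneric.eq_one_of_bounded`). Under
monodimensionality, some realisation of every basic type is therefore moved out of its own closure.
Since every finite set lies in the closure of finitely many parameters and such realisations, every
type has a realisation weakly independent from its image (`Mono.exists_rel_le`, `Mono.wMoves`).

A commutator of `g` with a generic element turns weak independence into free independence
(`WMoves.commMoves_dense`), so a product `k` of two conjugates of `g` and its inverse moves every
type maximally. On finite sets, products of four conjugates of such a `k` can then be extended in
any prescribed way: the two outer factors are fixed first, and the two inner ones meet in the middle
(`exists_conj_prod_eq`). Given `h`, a back-and-forth builds two quadruples of conjugators whose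
products satisfy `β.prod = h * α.prod`. Hence `h` is a product of eight conjugates of `k` and its
inverse, so of sixteen of `g` and its inverse; trivial pairs pad the number to 192. A nontrivial
normal subgroup thus contains everything. -/

open scoped Pointwise

/-! ### Abstract geometry: closure, dimension, weak and free independence. -/

/-- A group `G` acting on a set `V` with an invariant closure operator on finite sets, an integer
valued submodular dimension `d` defining it, and a stationary independence relation `Ind A B C`
(`A` is independent from `C` over `B`) refining independence in the sense of `d`. -/
structure IndepGeometry (G V : Type*) [Group G] [MulAction G V] [DecidableEq V] where
  cl : Finset V → Finset V
  d : Finset V → ℤ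
  Ind : Finset V → Finset V → Finset V → Prop
  subset_cl : ∀ X, X ⊆ cl X
  cl_subset_cl : ∀ {X Y}, X ⊆ cl Y → cl X ⊆ cl Y
  cl_empty : cl ∅ = ∅
  smul_cl : ∀ (σ : G) X, σ • cl X = cl (σ • X)
  d_mono : ∀ {X Y}, X ⊆ Y → d X ≤ d Y
  d_submod : ∀ X Y, d (X ∪ Y) + d (X ∩ Y) ≤ d X + d Y
  d_cl : ∀ X, d (cl X) = d X
  d_smul : ∀ (σ : G) X, d (σ • X) = d X
  mem_cl_of_d_le : ∀ {x X}, d (insert x X) ≤ d X → x ∈ cl X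
  ind_smul : ∀ (σ : G) {A B C}, Ind A B C → Ind (σ • A) (σ • B) (σ • C)
  ind_symm : ∀ {A B C}, Ind A B C → Ind C B A
  ind_mono : ∀ {A B C A' C'}, Ind A B C → A' ⊆ cl (A ∪ B) → C' ⊆ cl (C ∪ B) → Ind A' B C'
  ind_trans : ∀ {A B C B₁ D}, Ind A B C → Ind A B₁ D → cl B₁ = cl (B ∪ C) → Ind A B (C ∪ D)
  ind_exists : ∀ A B C, ∃ σ : G, (∀ x ∈ cl B, σ • x = x) ∧ Ind (σ • A) B C
  ind_stationary : ∀ {A B C} (α β : G), Ind A B C → Ind (α • A) (α • B) (β • C) →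
    (∀ x ∈ cl B, α • x = β • x) →
    ∃ γ : G, (∀ x ∈ cl (A ∪ B), γ • x = α • x) ∧ ∀ x ∈ cl (C ∪ B), γ • x = β • x
  ind_d : ∀ {A B C}, Ind A B C → d (A ∪ B ∪ C) + d B = d (A ∪ B) + d (B ∪ C)
  ind_of_d : ∀ {A B C D}, d (A ∪ B ∪ C) + d B = d (A ∪ B) + d (B ∪ C) →
    d (D ∪ B ∪ C) + d B = d (D ∪ B) + d (B ∪ C) → Ind A (B ∪ C) D → Ind A B D
  exists_limit : ∀ (u : ℕ → G) (F : ℕ → Finset V), Monotone F →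
    (∀ k, ∀ x ∈ F k, u (k + 1) • x = u k • x) → (∀ x, ∃ k, x ∈ F k) →
    (∀ x, ∃ k, x ∈ u k • F k) → ∃ v : G, ∀ k, ∀ x ∈ F k, v • x = u k • x

theorem Finset.smul_eq_of_fixes {G V : Type*} [Group G] [MulAction G V] [DecidableEq V] {σ : G}
    {X : Finset V} (h : ∀ x ∈ X, σ • x = x) : σ • X = X := by
  ext y
  rw [Finset.mem_smul_finset]
  exact ⟨fun ⟨x, hx, e⟩ => by rw [← e, h x hx]; exact hx, fun hy => ⟨y, hy, h y hy⟩⟩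

theorem Finset.smul_eq_of_agree {G V : Type*} [Group G] [MulAction G V] [DecidableEq V] {σ τ : G}
    {X : Finset V} (h : ∀ x ∈ X, σ • x = τ • x) : σ • X = τ • X := by
  ext y
  simp only [Finset.mem_smul_finset]
  exact ⟨fun ⟨x, hx, e⟩ => ⟨x, hx, by rw [← e, h x hx]⟩,
    fun ⟨x, hx, e⟩ => ⟨x, hx, by rw [← e, h x hx]⟩⟩

theorem inv_smul_eq_of_fixes {G V : Type*} [Group G] [MulAction G V] {σ : G} {x : V}
    (h : σ • x = x) : σ⁻¹ • x = x := by
  rw [inv_smul_eq_iff, h]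

namespace IndepGeometry

variable {G V : Type*} [Group G] [MulAction G V] [DecidableEq V] (S : IndepGeometry G V)

theorem cl_mono {X Y : Finset V} (h : X ⊆ Y) : S.cl X ⊆ S.cl Y :=
  S.cl_subset_cl (h.trans (S.subset_cl Y))

theorem cl_cl (X : Finset V) : S.cl (S.cl X) = S.cl X :=
  (S.cl_subset_cl subset_rfl).antisymm (S.subset_cl _)

theorem cl_smul_eq {X : Finset V} (h : S.cl X = X) (σ : G) : S.cl (σ • X) = σ • X := by
  rw [← S.smul_cl, h]

theorem d_eq {X Y : Finset V} (h : X ⊆ Y) (h' : Y ⊆ S.cl X) : S.d Y = S.d X :=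
  le_antisymm (S.d_cl X ▸ S.d_mono h') (S.d_mono h)

theorem cl_union_subset {X Y Z : Finset V} (h : X ⊆ S.cl Z) (h' : Y ⊆ S.cl Z) :
    X ∪ Y ⊆ S.cl Z := Finset.union_subset h h'

/-- The relative dimension `d(A/B)`. -/
def rel (A B : Finset V) : ℤ := S.d (A ∪ B) - S.d B

theorem rel_nonneg (A B : Finset V) : 0 ≤ S.rel A B :=
  sub_nonneg.2 (S.d_mono Finset.subset_union_right)

theorem rel_anti (A : Finset V) {B B' : Finset V} (h : B ⊆ B') : S.rel A B' ≤ S.rel A B := by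
  have h1 := S.d_submod (A ∪ B) B'
  have h2 : A ∪ B ∪ B' = A ∪ B' := by rw [Finset.union_assoc, Finset.union_eq_right.2 h]
  have h3 : S.d B ≤ S.d ((A ∪ B) ∩ B') :=
    S.d_mono (Finset.subset_inter Finset.subset_union_right h)
  rw [h2] at h1
  unfold rel
  linarith

theorem rel_mono {A A' : Finset V} (B : Finset V) (h : A ⊆ A') : S.rel A B ≤ S.rel A' B :=
  sub_le_sub_right (S.d_mono (Finset.union_subset_union_left h)) _

theorem rel_union (A A' B : Finset V) :
    S.rel (A ∪ A') B = S.rel A' B + S.rel A (A' ∪ B) := by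
  unfold rel
  rw [Finset.union_assoc]
  ring

theorem rel_congr_right (A : Finset V) {B B' : Finset V} (h : B ⊆ B') (h' : B' ⊆ S.cl B) :
    S.rel A B' = S.rel A B := by
  unfold rel
  rw [S.d_eq h h', S.d_eq (Finset.union_subset_union_right (s := A) h)]
  exact S.cl_union_subset (Finset.subset_union_left.trans (S.subset_cl _))
    (h'.trans (S.cl_mono Finset.subset_union_right))

theorem rel_cl_right (A B : Finset V) : S.rel A (S.cl B) = S.rel A B :=
  S.rel_congr_right A (S.subset_cl B) subset_rfl

theorem rel_smul (σ : G) (A B : Finset V) : S.rel (σ • A) (σ • B) = S.rel A B := by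
  unfold rel
  rw [← Finset.smul_finset_union, S.d_smul, S.d_smul]

theorem rel_eq_zero_of_subset {A B : Finset V} (h : A ⊆ S.cl B) : S.rel A B = 0 := by
  unfold rel
  rw [S.d_eq Finset.subset_union_right (S.cl_union_subset h (S.subset_cl B)), sub_self]

theorem mem_cl_of_rel_le {x : V} {B : Finset V} (h : S.rel {x} B ≤ 0) : x ∈ S.cl B := by
  apply S.mem_cl_of_d_le
  unfold rel at h
  rw [← Finset.insert_eq] at h
  linarith

/-- Independence in the sense of the dimension. -/
def WInd (A B C : Finset V) : Prop := S.rel A (B ∪ C) = S.rel A B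

variable {S}

theorem wInd_iff {A B C : Finset V} :
    S.WInd A B C ↔ S.d (A ∪ B ∪ C) + S.d B = S.d (A ∪ B) + S.d (B ∪ C) := by
  unfold WInd rel
  rw [← Finset.union_assoc]
  constructor <;> intro h <;> linarith

theorem wInd_of_le {A B C : Finset V} (h : S.rel A B ≤ S.rel A (B ∪ C)) : S.WInd A B C :=
  le_antisymm (S.rel_anti A Finset.subset_union_left) h

theorem Ind_wInd {A B C : Finset V} (h : S.Ind A B C) : S.WInd A B C := wInd_iff.2 (S.ind_d h)

theorem WInd.symm {A B C : Finset V} (h : S.WInd A B C) : S.WInd C B A := by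
  rw [wInd_iff] at *
  rw [show C ∪ B ∪ A = A ∪ B ∪ C by ac_rfl, Finset.union_comm C B, Finset.union_comm B A]
  linarith

theorem WInd.smul (σ : G) {A B C : Finset V} (h : S.WInd A B C) :
    S.WInd (σ • A) (σ • B) (σ • C) := by
  unfold WInd at *
  rw [← Finset.smul_finset_union, S.rel_smul, S.rel_smul, h]

theorem WInd.mono_right {A B C C' : Finset V} (h : S.WInd A B C) (hC : C' ⊆ S.cl (C ∪ B)) :
    S.WInd A B C' := by
  apply wInd_of_le
  rw [← h, ← S.rel_cl_right A (B ∪ C)]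
  refine S.rel_anti A (S.cl_union_subset (Finset.subset_union_left.trans (S.subset_cl _)) ?_)
  rwa [Finset.union_comm B C]

theorem WInd.mono {A B C A' C' : Finset V} (h : S.WInd A B C) (hA : A' ⊆ S.cl (A ∪ B))
    (hC : C' ⊆ S.cl (C ∪ B)) : S.WInd A' B C' :=
  ((h.mono_right hC).symm.mono_right hA).symm

theorem WInd.trans {A B C D : Finset V} (h : S.WInd A B C) (h' : S.WInd A (B ∪ C) D) :
    S.WInd A B (C ∪ D) := by
  unfold WInd at *
  rw [← Finset.union_assoc, h', h]

/-- The relative dimension of `A` decreases along `B`, `B'`, `B''`, `B'' ∪ C`; the two hypotheses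
make its first and last values equal, so it is constant, and over `B' ∪ C` it is squeezed to the
same value. -/
theorem WInd.between {A B B' B'' C : Finset V} (h : S.WInd A B B'') (h' : S.WInd A B'' C)
    (h1 : B ⊆ B') (h2 : B' ⊆ S.cl B'') : S.WInd A B' C := by
  apply wInd_of_le
  have e1 : S.rel A B' ≤ S.rel A B := S.rel_anti A h1
  have e2 : S.rel A (B'' ∪ C) ≤ S.rel A (B' ∪ C) := by
    rw [← S.rel_cl_right A (B'' ∪ C)]
    exact S.rel_anti A (S.cl_union_subset (h2.trans (S.cl_mono Finset.subset_union_left))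
      (Finset.subset_union_right.trans (S.subset_cl _)))
  have e3 : S.rel A B ≤ S.rel A B'' := by
    rw [← h]
    exact S.rel_anti A Finset.subset_union_right
  unfold WInd at h'
  linarith

/-- A point of both closures is weakly independent from itself over `B`, hence has relative
dimension zero. -/
theorem WInd.mem_cl {A B C : Finset V} (h : S.WInd A B C) {x : V} (hA : x ∈ S.cl (A ∪ B))
    (hC : x ∈ S.cl (C ∪ B)) : x ∈ S.cl B := by
  have h1 : S.WInd {x} B {x} :=
    h.mono (Finset.singleton_subset_iff.2 hA) (Finset.singleton_subset_iff.2 hC)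
  apply S.mem_cl_of_rel_le
  rw [← h1, S.rel_eq_zero_of_subset (Finset.subset_union_right.trans (S.subset_cl _))]

theorem Ind_trans_right {A B C D B₁ : Finset V} (h : S.Ind A B C) (h' : S.Ind A B₁ D)
    (e : S.cl B₁ = S.cl (B ∪ C)) : S.Ind A B D :=
  S.ind_mono (S.ind_trans h h' e) (Finset.subset_union_left.trans (S.subset_cl _))
    ((Finset.subset_union_right.trans Finset.subset_union_left).trans (S.subset_cl _))

/-- Every requirement in a countable family that is met on an open dense set of group elements is
met simultaneously by some group element. -/
theorem exists_forall_of_dense [Countable V] {ι : Type*} [Countable ι] (P : ι → G → Prop)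
    (hP : ∀ (i : ι) (h : G) (D : Finset V), ∃ (h' : G) (D' : Finset V), D ⊆ D' ∧
      (∀ x ∈ D, h' • x = h • x) ∧ ∀ h'' : G, (∀ x ∈ D', h'' • x = h' • x) → P i h'')
    (S : IndepGeometry G V) : ∃ h : G, ∀ i, P i h := by
  classical
  rcases isEmpty_or_nonempty ι with hι | hι
  · exact ⟨1, fun i => hι.elim i⟩
  rcases isEmpty_or_nonempty V with hV | hV
  · refine ⟨1, fun i => ?_⟩
    obtain ⟨h', D', -, -, h⟩ := hP i 1 ∅
    exact h 1 fun x => hV.elim x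
  obtain ⟨a, ha⟩ := exists_surjective_nat ι
  obtain ⟨y, hy⟩ := exists_surjective_nat V
  choose nh nD h1 h2 h3 using hP
  -- A Baire category argument by hand. Both `y k` and its preimage enter the finite set, so that
  -- the limit is defined everywhere and onto.
  let grow : ℕ → G × Finset V → Finset V := fun k s => s.2 ∪ {y k, s.1⁻¹ • y k}
  let step : ℕ → G × Finset V → G × Finset V := fun k s =>
    (nh (a k) s.1 (grow k s), nD (a k) s.1 (grow k s))
  let st : ℕ → G × Finset V := fun k => Nat.rec (1, ∅) step k
  have st_succ : ∀ k, st (k + 1) = step k (st k) := fun k => rfl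
  have sub : ∀ k, grow k (st k) ⊆ (st (k + 1)).2 := fun k => h1 _ _ _
  have agree : ∀ k, ∀ x ∈ grow k (st k), (st (k + 1)).1 • x = (st k).1 • x := fun k => h2 _ _ _
  obtain ⟨v, hv⟩ := S.exists_limit (fun k => (st k).1) (fun k => (st k).2)
    (monotone_nat_of_le_succ fun k => Finset.subset_union_left.trans (sub k))
    (fun k x hx => agree k x (Finset.mem_union_left _ hx))
    (fun x => by
      obtain ⟨k, rfl⟩ := hy x
      exact ⟨k + 1, sub k (by simp [grow])⟩)
    (fun x => by
      obtain ⟨k, rfl⟩ := hy x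
      have hm : (st k).1⁻¹ • y k ∈ grow k (st k) := by simp [grow]
      refine ⟨k + 1, Finset.mem_smul_finset.2 ⟨_, sub k hm, ?_⟩⟩
      simp only [agree k _ hm, smul_inv_smul])
  refine ⟨v, fun i => ?_⟩
  obtain ⟨k, rfl⟩ := ha i
  exact h3 (a k) (st k).1 (grow k (st k)) v (hv (k + 1))

end IndepGeometry

/-! ### Maximally moving elements and their conjugates. -/

namespace IndepGeometry

variable {G V : Type*} [Group G] [MulAction G V] [DecidableEq V] {S : IndepGeometry G V}

variable (S) in
/-- `g` moves maximally: over every closed `X`, every type has a realisation `A` such that `A` is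
independent from `g A` over `X`, and `g A` is independent from `A` over `g X`. -/
def MovesMax (g : G) : Prop :=
  ∀ X T : Finset V, S.cl X = X → ∃ σ : G, (∀ x ∈ X, σ • x = x) ∧
    S.Ind (σ • T) X (g • σ • T) ∧ S.Ind (g • σ • T) (g • X) (σ • T)

/-- Passing from a realisation to its image interchanges the two independence clauses of `MovesMax`;
the definition carries both for this reason. -/
theorem MovesMax.inv {g : G} (hg : S.MovesMax g) : S.MovesMax g⁻¹ := by
  intro X T hX
  obtain ⟨σ, h1, h2, h3⟩ := hg (g⁻¹ • X) (g⁻¹ • T) (S.cl_smul_eq hX _)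
  have e : (g * σ * g⁻¹) • T = g • σ • g⁻¹ • T := by simp only [mul_smul]
  refine ⟨g * σ * g⁻¹, fun x hx => ?_, ?_, ?_⟩
  · rw [mul_smul, mul_smul, h1 _ (Finset.smul_mem_smul_finset hx), smul_inv_smul]
  · rw [e, inv_smul_smul]
    rwa [smul_inv_smul] at h3
  · rwa [e, inv_smul_smul]

theorem MovesMax.conj {g : G} (hg : S.MovesMax g) (u : G) : S.MovesMax (u * g * u⁻¹) := by
  intro X T hX
  obtain ⟨σ, h1, h2, h3⟩ := hg (u⁻¹ • X) (u⁻¹ • T) (S.cl_smul_eq hX _)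
  have e : (u * σ * u⁻¹) • T = u • σ • u⁻¹ • T := by simp only [mul_smul]
  have e' : (u * g * u⁻¹) • u • σ • u⁻¹ • T = u • g • σ • u⁻¹ • T := by
    simp only [mul_smul, inv_smul_smul]
  refine ⟨u * σ * u⁻¹, fun x hx => ?_, ?_, ?_⟩
  · rw [mul_smul, mul_smul, h1 _ (Finset.smul_mem_smul_finset hx), smul_inv_smul]
  · rw [e, e']
    have := S.ind_smul u h2
    rwa [smul_inv_smul] at this
  · rw [e, e']
    have := S.ind_smul u h3
    rwa [show (u * g * u⁻¹) • X = u • g • u⁻¹ • X by simp only [mul_smul]]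

/-- If `g` moves maximally, a prescribed extension `θ` of `g` restricted to `X` which is as free as
possible is realised on `T` by a conjugate of `g`. -/
theorem MovesMax.exists_conj_eq {g : G} (hg : S.MovesMax g) {X T : Finset V} (hX : S.cl X = X)
    (hXT : X ⊆ T) {θ : G} (hθ : ∀ x ∈ X, θ • x = g • x) (h1 : S.Ind T X (g • X))
    (h2 : S.Ind (θ • T) (g • X) T) :
    ∃ e : G, (∀ x ∈ X ∪ g • X, e • x = x) ∧ ∀ x ∈ T, (e * g * e⁻¹) • x = θ • x := by
  -- Taking the type over a set that also contains `g • X` lets `σ` fix both sides of the partial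
  -- map, and makes `g • Z` the closure of `g • X ∪ g • g • X`, where transitivity can be applied.
  set Z := S.cl (X ∪ g • X) with hZ
  obtain ⟨σ, s1, -, s3⟩ := hg Z T (S.cl_cl _)
  have fX : ∀ x ∈ X, σ • x = x := fun x hx => s1 x (S.subset_cl _ (Finset.mem_union_left _ hx))
  have fgX : ∀ x ∈ g • X, σ • x = x :=
    fun x hx => s1 x (S.subset_cl _ (Finset.mem_union_right _ hx))
  have i1 := S.ind_smul g (S.ind_smul σ h1)
  rw [Finset.smul_eq_of_fixes fX, Finset.smul_eq_of_fixes fgX] at i1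
  have i2 : S.Ind (g • σ • T) (g • X) (σ • T) := by
    refine Ind_trans_right i1 s3 ?_
    rw [hZ, S.smul_cl, S.cl_cl, Finset.smul_finset_union]
  have cX : S.cl (g • X) = g • X := S.cl_smul_eq hX g
  have onX : ∀ x ∈ g • X, (θ * σ⁻¹ * g⁻¹) • x = x := by
    intro x hx
    obtain ⟨y, hy, rfl⟩ := Finset.mem_smul_finset.1 hx
    rw [mul_smul, mul_smul, inv_smul_smul, inv_smul_eq_of_fixes (fX y hy), hθ y hy]
  -- Stationarity over `g • X`: one group element carries `σ • T` back to `T` and, at the same time,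
  -- `g • σ • T` to `θ • T`. Conjugating `g` by it gives `θ` on `T`.
  obtain ⟨e, e1, e2⟩ := S.ind_stationary (θ * σ⁻¹ * g⁻¹) σ⁻¹ i2 (by
      rw [Finset.smul_eq_of_fixes onX]
      simpa only [mul_smul, inv_smul_smul] using h2) (by
      rw [cX]
      intro x hx
      rw [onX x hx, inv_smul_eq_of_fixes (fgX x hx)])
  have e2' : ∀ x ∈ σ • T ∪ g • X, e • x = σ⁻¹ • x := fun x hx => e2 x (S.subset_cl _ hx)
  refine ⟨e, fun x hx => ?_, fun x hx => ?_⟩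
  · rcases Finset.mem_union.1 hx with hx | hx
    · have : x ∈ σ • T := by
        rw [← fX x hx]
        exact Finset.smul_mem_smul_finset (hXT hx)
      rw [e2' x (Finset.mem_union_left _ this), inv_smul_eq_of_fixes (fX x hx)]
    · rw [e2' x (Finset.mem_union_right _ hx), inv_smul_eq_of_fixes (fgX x hx)]
  · have hσx : σ • x ∈ σ • T := Finset.smul_mem_smul_finset hx
    have : e⁻¹ • x = σ • x := by
      rw [inv_smul_eq_iff, e2' _ (Finset.mem_union_left _ hσx), inv_smul_smul]
    rw [mul_smul, mul_smul, this,
      e1 _ (S.subset_cl _ (Finset.mem_union_left _ (Finset.smul_mem_smul_finset hσx)))]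
    simp only [mul_smul, inv_smul_smul]

/-- A generic conjugate of `g` moves a set `T` over `X` to a set independent from `X' ∪ g X`,
provided that `X'` was already moved generically. -/
theorem MovesMax.exists_conj_ind {g : G} (hg : S.MovesMax g) {X X' : Finset V}
    (hX' : S.Ind (g • X ∪ X') (g • X) (g • (g • X ∪ X'))) (T : Finset V) :
    ∃ e : G, (∀ x ∈ X ∪ g • X, e • x = x) ∧
      S.Ind ((e * g * e⁻¹) • T) (g • X) X' := by
  set Z := S.cl (X ∪ (g • X ∪ X')) with hZ
  -- With `Z` included in the moved set, `X'` (inside `Z` and fixed by `σ`) is itself part of that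
  -- set, so the independence of images applies to `X'`.
  obtain ⟨σ, s1, -, s3⟩ := hg Z (Z ∪ T) (S.cl_cl _)
  have fix : ∀ x ∈ X ∪ (g • X ∪ X'), σ • x = x := fun x hx => s1 x (S.subset_cl _ hx)
  have fX : ∀ x ∈ X, σ • x = x := fun x hx => fix x (by simp [hx])
  have fgX : ∀ x ∈ g • X, σ • x = x := fun x hx => fix x (by simp [hx])
  have fX' : ∀ x ∈ X', σ • x = x := fun x hx => fix x (by simp [hx])
  have sub : X' ⊆ σ • (Z ∪ T) := by
    rw [← Finset.smul_eq_of_fixes fX']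
    refine Finset.smul_finset_subset_smul_finset (subset_trans ?_ Finset.subset_union_left)
    exact (Finset.subset_union_right.trans Finset.subset_union_right).trans (S.subset_cl _)
  have i1 : S.Ind X' (g • Z) (g • σ • T) := by
    refine S.ind_mono (S.ind_symm s3)
      (sub.trans (Finset.subset_union_left.trans (S.subset_cl _))) ?_
    refine subset_trans ?_ (Finset.subset_union_left.trans (S.subset_cl _))
    exact Finset.smul_finset_subset_smul_finset
      (Finset.smul_finset_subset_smul_finset Finset.subset_union_right)
  have i2 : S.Ind X' (g • X) (g • (g • X ∪ X')) :=
    S.ind_mono hX' (Finset.subset_union_right.trans (Finset.subset_union_left.trans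
      (S.subset_cl _))) (Finset.subset_union_left.trans (S.subset_cl _))
  have i3 : S.Ind X' (g • X) (g • σ • T) := by
    refine Ind_trans_right i2 i1 ?_
    rw [hZ, S.smul_cl, S.cl_cl, Finset.smul_finset_union]
  refine ⟨σ⁻¹, fun x hx => inv_smul_eq_of_fixes ?_, ?_⟩
  · rcases Finset.mem_union.1 hx with hx | hx
    exacts [fX x hx, fgX x hx]
  · have := S.ind_symm (S.ind_smul σ⁻¹ i3)
    rw [Finset.smul_eq_of_fixes fun x hx => inv_smul_eq_of_fixes (fX' x hx),
      Finset.smul_eq_of_fixes fun x hx => inv_smul_eq_of_fixes (fgX x hx)] at this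
    simpa only [mul_smul, inv_inv] using this

/-- Arranging the hypothesis of `MovesMax.exists_conj_ind`. -/
theorem MovesMax.exists_conj_prepared {g : G} (hg : S.MovesMax g) {Y : Finset V}
    (hY : S.cl Y = Y) (X' : Finset V) :
    ∃ e : G, (∀ x ∈ Y, e • x = x) ∧
      S.Ind (Y ∪ X') Y ((e * g * e⁻¹) • (Y ∪ X')) := by
  obtain ⟨σ, s1, s2, -⟩ := hg Y (Y ∪ X') hY
  refine ⟨σ⁻¹, fun x hx => inv_smul_eq_of_fixes (s1 x hx), ?_⟩
  have := S.ind_smul σ⁻¹ s2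
  rw [Finset.smul_eq_of_fixes fun x hx => inv_smul_eq_of_fixes (s1 x hx), inv_smul_smul] at this
  simpa only [mul_smul, inv_inv] using this

end IndepGeometry

theorem conj_smul_of_fixes {G V : Type*} [Group G] [MulAction G V] {e g : G} {x : V}
    (h1 : e • x = x) (h2 : e • g • x = g • x) :
    (e * g * e⁻¹) • x = g • x := by
  rw [mul_smul, mul_smul, inv_smul_eq_of_fixes h1, h2]

theorem conj_inv_eq {G : Type*} [Group G] (e g : G) : (e * g * e⁻¹)⁻¹ = e * g⁻¹ * e⁻¹ := by
  simp only [mul_inv_rev, inv_inv, mul_assoc]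

theorem conj_eq_of_mul_inv {G : Type*} [Group G] (k w e : G) :
    (w * e⁻¹)⁻¹ * k * (w * e⁻¹) = e * (w⁻¹ * k * w) * e⁻¹ := by
  simp only [mul_inv_rev, inv_inv, mul_assoc]

/-! ### Products of four conjugates and chains of finite sets. -/

namespace IndepGeometry

variable {G V : Type*} [Group G] [MulAction G V] [DecidableEq V] {S : IndepGeometry G V}

/-- Given a chain `X → g₁ X → g₂ g₁ X → ⋯` whose first and last maps are in generic position, any
extension `θ` of `g₄ g₃ g₂ g₁` restricted to `X` is on a given `T ⊇ X` a product of
conjugates of the `gᵢ` by elements that fix the chain. -/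
theorem exists_conj_prod_eq {g₁ g₂ g₃ g₄ : G} (h₁ : S.MovesMax g₁) (h₂ : S.MovesMax g₂)
    (h₃ : S.MovesMax g₃) (h₄ : S.MovesMax g₄) {X X₁ X₂ X₃ X₄ : Finset V} (hX : S.cl X = X)
    (e₁ : g₁ • X = X₁) (e₂ : g₂ • X₁ = X₂) (e₃ : g₃ • X₂ = X₃) (e₄ : g₄ • X₃ = X₄)
    (p₁ : S.Ind (X₁ ∪ X₂) X₁ (g₁ • (X₁ ∪ X₂))) (p₄ : S.Ind (X₃ ∪ X₂) X₃ (g₄⁻¹ • (X₃ ∪ X₂)))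
    {T : Finset V} (hXT : X ⊆ T) {θ : G} (hθ : ∀ x ∈ X, θ • x = g₄ • g₃ • g₂ • g₁ • x) :
    ∃ a₁ a₂ a₃ a₄ : G, (∀ x ∈ X ∪ X₁, a₁ • x = x) ∧ (∀ x ∈ X₁ ∪ X₂, a₂ • x = x) ∧
      (∀ x ∈ X₂ ∪ X₃, a₃ • x = x) ∧ (∀ x ∈ X₃ ∪ X₄, a₄ • x = x) ∧
      ∀ x ∈ T, (a₄ * g₄ * a₄⁻¹) • (a₃ * g₃ * a₃⁻¹) • (a₂ * g₂ * a₂⁻¹) • (a₁ * g₁ * a₁⁻¹) • x =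
        θ • x := by
  have e₄' : g₄⁻¹ • X₄ = X₃ := by rw [← e₄, inv_smul_smul]
  have e₃' : g₃⁻¹ • X₃ = X₂ := by rw [← e₃, inv_smul_smul]
  have c₁ : S.cl X₁ = X₁ := e₁ ▸ S.cl_smul_eq hX g₁
  have c₂ : S.cl X₂ = X₂ := e₂ ▸ S.cl_smul_eq c₁ g₂
  have c₃ : S.cl X₃ = X₃ := e₃ ▸ S.cl_smul_eq c₂ g₃
  -- The outer conjugates come first: from the left `T` goes to `k₁ • T`, free from `X₂` over `X₁`;
  -- from the right `θ • T` is pulled back to `k₄⁻¹ • θ • T`, free from `X₂` over `X₃`.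
  obtain ⟨a₁, fa₁, i₁⟩ := h₁.exists_conj_ind (X := X) (X' := X₂) (by rwa [e₁]) T
  obtain ⟨a₄, fa₄, i₄⟩ := h₄.inv.exists_conj_ind (X := X₄) (X' := X₂) (by rwa [e₄']) (θ • T)
  rw [e₁] at fa₁ i₁
  rw [e₄'] at fa₄ i₄
  rw [← conj_inv_eq] at i₄
  set k₁ := a₁ * g₁ * a₁⁻¹ with hk₁
  set k₄ := a₄ * g₄ * a₄⁻¹ with hk₄
  have k₁X : ∀ x ∈ X, k₁ • x = g₁ • x := fun x hx =>
    conj_smul_of_fixes (fa₁ x (Finset.mem_union_left _ hx))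
      (fa₁ _ (Finset.mem_union_right _ (e₁ ▸ Finset.smul_mem_smul_finset hx)))
  have k₄X : ∀ x ∈ X₃, k₄ • x = g₄ • x := fun x hx =>
    conj_smul_of_fixes (fa₄ x (Finset.mem_union_right _ hx))
      (fa₄ _ (Finset.mem_union_left _ (e₄ ▸ Finset.smul_mem_smul_finset hx)))
  -- The meeting place: a copy over `X₂` free from both sets just obtained. The second conjugate
  -- maps `k₁ • T` onto it, and the inverse of the third maps `k₄⁻¹ • θ • T` onto it.
  obtain ⟨τ, fτ, iτ⟩ := S.ind_exists (g₂ • k₁ • T) X₂ (k₁ • T ∪ k₄⁻¹ • θ • T)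
  rw [c₂] at fτ
  have inX₂ : ∀ y ∈ X, g₂ • g₁ • y ∈ X₂ := fun y hy => by
    rw [← e₂, ← e₁]
    exact Finset.smul_mem_smul_finset (Finset.smul_mem_smul_finset hy)
  have ofX₃ : ∀ x ∈ X₃, ∃ y ∈ X, x = g₃ • g₂ • g₁ • y := by
    intro x hx
    rw [← e₃, ← e₂, ← e₁] at hx
    obtain ⟨x₂, hx₂, rfl⟩ := Finset.mem_smul_finset.1 hx
    obtain ⟨x₁, hx₁, rfl⟩ := Finset.mem_smul_finset.1 hx₂
    obtain ⟨x₀, hx₀, rfl⟩ := Finset.mem_smul_finset.1 hx₁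
    exact ⟨x₀, hx₀, rfl⟩
  have sub₁ : X₁ ⊆ k₁ • T := by
    rw [← e₁, ← Finset.smul_eq_of_agree k₁X]
    exact Finset.smul_finset_subset_smul_finset hXT
  have θX₃ : ∀ y ∈ X, k₄ • g₃ • g₂ • g₁ • y = θ • y := by
    intro y hy
    rw [hθ y hy, k₄X]
    rw [← e₃]
    exact Finset.smul_mem_smul_finset (inX₂ y hy)
  have sub₃ : X₃ ⊆ k₄⁻¹ • θ • T := by
    intro x hx
    obtain ⟨y, hy, rfl⟩ := ofX₃ x hx
    rw [Finset.mem_inv_smul_finset_iff, θX₃ y hy]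
    exact Finset.smul_mem_smul_finset (hXT hy)
  obtain ⟨a₂, fa₂, r₂⟩ := h₂.exists_conj_eq (T := k₁ • T) (θ := τ * g₂) c₁ sub₁
    (fun x hx => by
      rw [mul_smul, fτ _ (e₂ ▸ Finset.smul_mem_smul_finset hx)])
    (by rwa [e₂])
    (by
      rw [e₂, mul_smul]
      exact S.ind_mono iτ (Finset.subset_union_left.trans (S.subset_cl _))
        (Finset.subset_union_left.trans (Finset.subset_union_left.trans (S.subset_cl _))))
  obtain ⟨a₃, fa₃, r₃⟩ := h₃.inv.exists_conj_eq (T := k₄⁻¹ • θ • T)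
    (θ := τ * g₂ * k₁ * θ⁻¹ * k₄) c₃ sub₃
    (fun x hx => by
      obtain ⟨y, hy, rfl⟩ := ofX₃ x hx
      rw [mul_smul, θX₃ y hy, mul_smul, inv_smul_smul, mul_smul, k₁X y hy, mul_smul,
        fτ _ (inX₂ y hy), inv_smul_smul])
    (by rwa [e₃'])
    (by
      rw [e₃']
      simp only [mul_smul, smul_inv_smul, inv_smul_smul]
      exact S.ind_mono iτ (Finset.subset_union_left.trans (S.subset_cl _))
        (Finset.subset_union_right.trans (Finset.subset_union_left.trans (S.subset_cl _))))
  rw [e₂] at fa₂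
  rw [e₃', Finset.union_comm] at fa₃
  refine ⟨a₁, a₂, a₃, a₄, fa₁, fa₂, fa₃, fun x hx => fa₄ x (by rwa [Finset.union_comm]), ?_⟩
  intro x hx
  rw [r₂ _ (Finset.smul_mem_smul_finset hx)]
  have := r₃ (k₄⁻¹ • θ • x)
    (Finset.smul_mem_smul_finset (Finset.smul_mem_smul_finset hx))
  rw [← conj_inv_eq, inv_smul_eq_iff] at this
  rw [show (τ * g₂ * k₁ * θ⁻¹ * k₄) • k₄⁻¹ • θ • x = (τ * g₂) • k₁ • x by
    simp only [mul_smul, smul_inv_smul, inv_smul_smul]] at this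
  rw [← this, smul_inv_smul]

/-- Four group elements `wᵢ`, used to conjugate a fixed element, and a finite set to which their
conjugates are applied successively. -/
structure Chain (G V : Type*) where
  w₁ : G
  w₂ : G
  w₃ : G
  w₄ : G
  X : Finset V

namespace Chain

variable (k : G) (c c' : Chain G V)

/-- The first conjugate. -/
def g₁ : G := c.w₁⁻¹ * k * c.w₁
/-- The second conjugate. -/
def g₂ : G := c.w₂⁻¹ * k * c.w₂
/-- The third conjugate. -/
def g₃ : G := c.w₃⁻¹ * k * c.w₃
/-- The fourth conjugate. -/
def g₄ : G := c.w₄⁻¹ * k * c.w₄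
/-- The image of `X` under the first conjugate. -/
def X₁ : Finset V := c.g₁ k • c.X
/-- The image of `X` under the first two conjugates. -/
def X₂ : Finset V := c.g₂ k • c.X₁ k
/-- The image of `X` under the first three conjugates. -/
def X₃ : Finset V := c.g₃ k • c.X₂ k
/-- The image of `X` under all four conjugates. -/
def X₄ : Finset V := c.g₄ k • c.X₃ k
/-- The product of the conjugates. -/
def prod : G := c.g₄ k * c.g₃ k * c.g₂ k * c.g₁ k

/-- The chain `c'` has the larger set, and agrees with `c` on the sets occurring in `c`. -/
structure Extends : Prop where
  sub : c.X ⊆ c'.X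
  eq₁ : ∀ x ∈ c.X ∪ c.X₁ k, c'.w₁ • x = c.w₁ • x
  eq₂ : ∀ x ∈ c.X₁ k ∪ c.X₂ k, c'.w₂ • x = c.w₂ • x
  eq₃ : ∀ x ∈ c.X₂ k ∪ c.X₃ k, c'.w₃ • x = c.w₃ • x
  eq₄ : ∀ x ∈ c.X₃ k ∪ c.X₄ k, c'.w₄ • x = c.w₄ • x

/-- The first and the last map of the chain are in generic position. -/
structure Prepared (S : IndepGeometry G V) : Prop where
  closed : S.cl c.X = c.X
  ind₁ : S.Ind (c.X₁ k ∪ c.X₂ k) (c.X₁ k) (c.g₁ k • (c.X₁ k ∪ c.X₂ k))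
  ind₄ : S.Ind (c.X₃ k ∪ c.X₂ k) (c.X₃ k) ((c.g₄ k)⁻¹ • (c.X₃ k ∪ c.X₂ k))

/-- The point `y` is in the domain and range of all the maps determined by the chain. -/
structure Covers (y : V) : Prop where
  mem : y ∈ c.X
  mem₁ : y ∈ c.X₁ k
  mem₂ : y ∈ c.X₂ k
  mem₃ : y ∈ c.X₃ k
  img₁ : y ∈ c.w₁ • c.X₁ k
  img₂ : y ∈ c.w₂ • c.X₂ k
  img₃ : y ∈ c.w₃ • c.X₂ k
  img₄ : y ∈ c.w₄ • c.X₃ k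

variable {k c c'}

/-- The equation `(w⁻¹ * k * w) • x = y` says `k • w • x = w • y`, so it depends on `w` only at `x`
and `y`. Hence `Extends` compares each conjugator on two consecutive sets. -/
theorem conj_smul_eq_of_agree {w w' : G} {X Y : Finset V} (hX : (w⁻¹ * k * w) • X = Y)
    (h : ∀ x ∈ X ∪ Y, w' • x = w • x) :
    ∀ x ∈ X, (w'⁻¹ * k * w') • x = (w⁻¹ * k * w) • x := by
  intro x hx
  rw [mul_smul, mul_smul, inv_smul_eq_iff, h x (Finset.mem_union_left _ hx),
    h _ (Finset.mem_union_right _ (hX ▸ Finset.smul_mem_smul_finset hx))]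
  simp only [mul_smul, smul_inv_smul]

theorem smul_subset_smul_of_agree {σ τ : G} {X Y : Finset V} (h : X ⊆ Y)
    (e : ∀ x ∈ X, τ • x = σ • x) : σ • X ⊆ τ • Y := by
  rw [← Finset.smul_eq_of_agree e]
  exact Finset.smul_finset_subset_smul_finset h

namespace Extends

theorem g₁_eq (h : Extends k c c') :
    ∀ x ∈ c.X, c'.g₁ k • x = c.g₁ k • x := conj_smul_eq_of_agree rfl h.eq₁
theorem g₂_eq (h : Extends k c c') :
    ∀ x ∈ c.X₁ k, c'.g₂ k • x = c.g₂ k • x := conj_smul_eq_of_agree rfl h.eq₂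
theorem g₃_eq (h : Extends k c c') :
    ∀ x ∈ c.X₂ k, c'.g₃ k • x = c.g₃ k • x := conj_smul_eq_of_agree rfl h.eq₃
theorem g₄_eq (h : Extends k c c') :
    ∀ x ∈ c.X₃ k, c'.g₄ k • x = c.g₄ k • x := conj_smul_eq_of_agree rfl h.eq₄

theorem sub₁ (h : Extends k c c') :
    c.X₁ k ⊆ c'.X₁ k := smul_subset_smul_of_agree h.sub h.g₁_eq
theorem sub₂ (h : Extends k c c') :
    c.X₂ k ⊆ c'.X₂ k := smul_subset_smul_of_agree h.sub₁ h.g₂_eq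
theorem sub₃ (h : Extends k c c') :
    c.X₃ k ⊆ c'.X₃ k := smul_subset_smul_of_agree h.sub₂ h.g₃_eq
theorem sub₄ (h : Extends k c c') :
    c.X₄ k ⊆ c'.X₄ k := smul_subset_smul_of_agree h.sub₃ h.g₄_eq

theorem prod_eq (h : Extends k c c') :
    ∀ x ∈ c.X, c'.prod k • x = c.prod k • x := by
  intro x hx
  have h1 : c.g₁ k • x ∈ c.X₁ k := Finset.smul_mem_smul_finset hx
  have h2 : c.g₂ k • c.g₁ k • x ∈ c.X₂ k := Finset.smul_mem_smul_finset h1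
  have h3 : c.g₃ k • c.g₂ k • c.g₁ k • x ∈ c.X₃ k := Finset.smul_mem_smul_finset h2
  simp only [prod, mul_smul]
  rw [h.g₁_eq x hx, h.g₂_eq _ h1, h.g₃_eq _ h2, h.g₄_eq _ h3]

theorem trans {c'' : Chain G V} (h : Extends k c c') (h' : Extends k c' c'') :
    Extends k c c'' where
  sub := h.sub.trans h'.sub
  eq₁ x hx := by rw [h'.eq₁ x (Finset.union_subset_union h.sub h.sub₁ hx), h.eq₁ x hx]
  eq₂ x hx := by rw [h'.eq₂ x (Finset.union_subset_union h.sub₁ h.sub₂ hx), h.eq₂ x hx]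
  eq₃ x hx := by rw [h'.eq₃ x (Finset.union_subset_union h.sub₂ h.sub₃ hx), h.eq₃ x hx]
  eq₄ x hx := by rw [h'.eq₄ x (Finset.union_subset_union h.sub₃ h.sub₄ hx), h.eq₄ x hx]

end Extends

theorem movesMax_conj {w : G} (hk : S.MovesMax k) : S.MovesMax (w⁻¹ * k * w) := by
  simpa using hk.conj w⁻¹

/-- A prepared chain extends to a larger set with any prescribed product. -/
theorem Prepared.exists_extends (hk : S.MovesMax k) (hc : c.Prepared k S) {T : Finset V}
    (hT : c.X ⊆ T) {θ : G} (hθ : ∀ x ∈ c.X, θ • x = c.prod k • x) :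
    ∃ c' : Chain G V, Extends k c c' ∧ c'.X = T ∧ ∀ x ∈ T, c'.prod k • x = θ • x := by
  obtain ⟨a₁, a₂, a₃, a₄, f₁, f₂, f₃, f₄, h⟩ :=
    exists_conj_prod_eq (S := S) (g₁ := c.g₁ k) (g₂ := c.g₂ k) (g₃ := c.g₃ k) (g₄ := c.g₄ k)
      (movesMax_conj hk) (movesMax_conj hk) (movesMax_conj hk) (movesMax_conj hk) hc.closed
      (X₁ := c.X₁ k) (X₂ := c.X₂ k) (X₃ := c.X₃ k) (X₄ := c.X₄ k) rfl rfl rfl rfl hc.ind₁ hc.ind₄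
      hT (by simpa only [prod, mul_smul] using hθ)
  refine ⟨⟨c.w₁ * a₁⁻¹, c.w₂ * a₂⁻¹, c.w₃ * a₃⁻¹, c.w₄ * a₄⁻¹, T⟩, ⟨hT, ?_, ?_, ?_, ?_⟩, rfl, ?_⟩
  · exact fun x hx => by rw [mul_smul, inv_smul_eq_of_fixes (f₁ x hx)]
  · exact fun x hx => by rw [mul_smul, inv_smul_eq_of_fixes (f₂ x hx)]
  · exact fun x hx => by rw [mul_smul, inv_smul_eq_of_fixes (f₃ x hx)]
  · exact fun x hx => by rw [mul_smul, inv_smul_eq_of_fixes (f₄ x hx)]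
  · intro x hx
    rw [← h x hx]
    simp only [prod, g₁, g₂, g₃, g₄, conj_eq_of_mul_inv]
    simp only [mul_smul]

/-- Every chain on a closed set extends to a prepared one that covers a given point. -/
theorem exists_prepared (hk : S.MovesMax k) (c : Chain G V) (y : V) :
    ∃ c' : Chain G V, Extends k c c' ∧ c'.Prepared k S ∧ c'.Covers k y := by
  -- The points needed for covering `y`: `c.g₁ k • y` puts `y` into the new first set, and the
  -- preimages under the conjugators put `y` into their ranges.
  set F : Finset V := {y, c.g₁ k • y, c.w₁⁻¹ • y, c.w₂⁻¹ • y, c.w₃⁻¹ • y, c.w₄⁻¹ • y} with hF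
  -- The middle set is enlarged first, enough for its pullback `Y₁` under `c.g₂ k` and its image
  -- `Y₃` under `c.g₃ k` to contain all old sets. The inner conjugators stay unchanged; the outer
  -- ones are then corrected by elements fixing `Y₁` and `Y₃`, which achieves generic position.
  set Y₂ := S.cl (c.X₂ k ∪ c.g₂ k • (c.X ∪ c.X₁ k ∪ F) ∪
    (c.g₃ k)⁻¹ • (c.X₃ k ∪ c.X₄ k ∪ F) ∪ F) with hY₂
  have sY := S.subset_cl (c.X₂ k ∪ c.g₂ k • (c.X ∪ c.X₁ k ∪ F) ∪
    (c.g₃ k)⁻¹ • (c.X₃ k ∪ c.X₄ k ∪ F) ∪ F)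
  rw [← hY₂] at sY
  have cY₂ : S.cl Y₂ = Y₂ := S.cl_cl _
  set Y₁ := (c.g₂ k)⁻¹ • Y₂ with hY₁
  set Y₃ := c.g₃ k • Y₂ with hY₃
  have in₁ : c.X ∪ c.X₁ k ∪ F ⊆ Y₁ := by
    intro x hx
    rw [hY₁, Finset.mem_inv_smul_finset_iff]
    exact sY (Finset.mem_union_left _ (Finset.mem_union_left _ (Finset.mem_union_right _
      (Finset.smul_mem_smul_finset hx))))
  have in₃ : c.X₃ k ∪ c.X₄ k ∪ F ⊆ Y₃ := by
    intro x hx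
    rw [hY₃, ← Finset.inv_smul_mem_iff]
    exact sY (Finset.mem_union_left _ (Finset.mem_union_right _
      (Finset.smul_mem_smul_finset hx)))
  have F₂ : F ⊆ Y₂ := Finset.subset_union_right.trans sY
  have F₁ : F ⊆ Y₁ := Finset.subset_union_right.trans in₁
  have F₃ : F ⊆ Y₃ := Finset.subset_union_right.trans in₃
  obtain ⟨e₁, f₁, i₁⟩ := (movesMax_conj (w := c.w₁) hk).exists_conj_prepared
    (S.cl_smul_eq cY₂ (c.g₂ k)⁻¹) Y₂
  obtain ⟨e₄, f₄, i₄⟩ := (movesMax_conj (w := c.w₄) hk).inv.exists_conj_prepared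
    (S.cl_smul_eq cY₂ (c.g₃ k)) Y₂
  rw [← conj_inv_eq] at i₄
  rw [← conj_eq_of_mul_inv] at i₁ i₄
  let c' : Chain G V := ⟨c.w₁ * e₁⁻¹, c.w₂, c.w₃, c.w₄ * e₄⁻¹,
    ((c.w₁ * e₁⁻¹)⁻¹ * k * (c.w₁ * e₁⁻¹))⁻¹ • Y₁⟩
  have x₁ : c'.X₁ k = Y₁ := by
    change c'.g₁ k • (c'.g₁ k)⁻¹ • Y₁ = Y₁
    rw [smul_inv_smul]
  have x₂ : c'.X₂ k = Y₂ := by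
    rw [X₂, x₁]
    change c.g₂ k • Y₁ = Y₂
    rw [hY₁, smul_inv_smul]
  have x₃ : c'.X₃ k = Y₃ := by
    rw [X₃, x₂]
    rfl
  have a₁ : ∀ x ∈ Y₁, c'.w₁ • x = c.w₁ • x := fun x hx => by
    change (c.w₁ * e₁⁻¹) • x = _
    rw [mul_smul, inv_smul_eq_of_fixes (f₁ x hx)]
  have a₄ : ∀ x ∈ Y₃, c'.w₄ • x = c.w₄ • x := fun x hx => by
    change (c.w₄ * e₄⁻¹) • x = _
    rw [mul_smul, inv_smul_eq_of_fixes (f₄ x hx)]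
  have memX : ∀ x ∈ Y₁, c.g₁ k • x ∈ Y₁ → x ∈ c'.X := by
    intro x hx hgx
    change x ∈ (c'.g₁ k)⁻¹ • Y₁
    rw [Finset.mem_inv_smul_finset_iff]
    have : c'.g₁ k • x = c.g₁ k • x :=
      conj_smul_eq_of_agree (X := {x}) (Y := {c.g₁ k • x}) (by simp [g₁])
        (fun z hz => a₁ z (by
          rcases Finset.mem_union.1 hz with hz | hz <;> rw [Finset.mem_singleton.1 hz] <;>
            assumption)) x (Finset.mem_singleton_self x)
    rwa [this]
  refine ⟨c', ⟨?_, ?_, ?_, ?_, ?_⟩, ⟨?_, ?_, ?_⟩, ⟨?_, ?_, ?_, ?_, ?_, ?_, ?_, ?_⟩⟩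
  · intro x hx
    refine memX x (in₁ (by simp [hx])) (in₁ ?_)
    have : c.g₁ k • x ∈ c.X₁ k := Finset.smul_mem_smul_finset hx
    simp [this]
  · exact fun x hx => a₁ x (in₁ (Finset.mem_union_left _ hx))
  · exact fun x hx => rfl
  · exact fun x hx => rfl
  · exact fun x hx => a₄ x (in₃ (Finset.mem_union_left _ hx))
  · exact S.cl_smul_eq (S.cl_smul_eq cY₂ _) _
  · rw [x₁, x₂]
    exact i₁
  · rw [x₂, x₃]
    exact i₄
  · exact memX y (F₁ (by simp [hF])) (F₁ (by simp [hF]))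
  · exact x₁ ▸ F₁ (by simp [hF])
  · exact x₂ ▸ F₂ (by simp [hF])
  · exact x₃ ▸ F₃ (by simp [hF])
  · have hm : c.w₁⁻¹ • y ∈ Y₁ := F₁ (by simp [hF])
    rw [x₁]
    exact Finset.mem_smul_finset.2 ⟨_, hm, by rw [a₁ _ hm, smul_inv_smul]⟩
  · rw [x₂]
    exact Finset.mem_smul_finset.2 ⟨c.w₂⁻¹ • y, F₂ (by simp [hF]), smul_inv_smul _ _⟩
  · rw [x₂]
    exact Finset.mem_smul_finset.2 ⟨c.w₃⁻¹ • y, F₂ (by simp [hF]), smul_inv_smul _ _⟩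
  · have hm : c.w₄⁻¹ • y ∈ Y₃ := F₃ (by simp [hF])
    rw [x₃]
    exact Finset.mem_smul_finset.2 ⟨_, hm, by rw [a₄ _ hm, smul_inv_smul]⟩

end Chain

end IndepGeometry

/-! ### Limits of chains and the back-and-forth on pairs of chains. -/

namespace IndepGeometry

variable {G V : Type*} [Group G] [MulAction G V] [DecidableEq V] {S : IndepGeometry G V}

namespace Chain

variable {k : G} {c c' : Chain G V}

theorem Covers.of_extends {y : V} (h : Extends k c c') (hc : c.Covers k y) : c'.Covers k y where
  mem := h.sub hc.mem
  mem₁ := h.sub₁ hc.mem₁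
  mem₂ := h.sub₂ hc.mem₂
  mem₃ := h.sub₃ hc.mem₃
  img₁ := smul_subset_smul_of_agree h.sub₁
    (fun x hx => h.eq₁ x (Finset.mem_union_right _ hx)) hc.img₁
  img₂ := smul_subset_smul_of_agree h.sub₂
    (fun x hx => h.eq₂ x (Finset.mem_union_right _ hx)) hc.img₂
  img₃ := smul_subset_smul_of_agree h.sub₂
    (fun x hx => h.eq₃ x (Finset.mem_union_left _ hx)) hc.img₃
  img₄ := smul_subset_smul_of_agree h.sub₃
    (fun x hx => h.eq₄ x (Finset.mem_union_left _ hx)) hc.img₄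

/-- An increasing sequence of chains that covers everything has a limit. -/
theorem exists_limit (S : IndepGeometry G V) (c : ℕ → Chain G V)
    (hext : ∀ j, Extends k (c j) (c (j + 1))) (hcov : ∀ y, ∃ j, (c j).Covers k y) :
    ∃ c' : Chain G V, ∀ j, ∀ x ∈ (c j).X, c'.prod k • x = (c j).prod k • x := by
  have mono : ∀ {F : ℕ → Finset V}, (∀ j, F j ⊆ F (j + 1)) → Monotone F :=
    fun h => monotone_nat_of_le_succ h
  obtain ⟨v₁, h₁⟩ := S.exists_limit (fun j => (c j).w₁) (fun j => (c j).X ∪ (c j).X₁ k)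
    (mono fun j => Finset.union_subset_union (hext j).sub (hext j).sub₁) (fun j => (hext j).eq₁)
    (fun y => (hcov y).imp fun j h => Finset.mem_union_right _ h.mem₁)
    (fun y => (hcov y).imp fun j h =>
      Finset.smul_finset_subset_smul_finset Finset.subset_union_right h.img₁)
  obtain ⟨v₂, h₂⟩ := S.exists_limit (fun j => (c j).w₂) (fun j => (c j).X₁ k ∪ (c j).X₂ k)
    (mono fun j => Finset.union_subset_union (hext j).sub₁ (hext j).sub₂) (fun j => (hext j).eq₂)
    (fun y => (hcov y).imp fun j h => Finset.mem_union_right _ h.mem₂)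
    (fun y => (hcov y).imp fun j h =>
      Finset.smul_finset_subset_smul_finset Finset.subset_union_right h.img₂)
  obtain ⟨v₃, h₃⟩ := S.exists_limit (fun j => (c j).w₃) (fun j => (c j).X₂ k ∪ (c j).X₃ k)
    (mono fun j => Finset.union_subset_union (hext j).sub₂ (hext j).sub₃) (fun j => (hext j).eq₃)
    (fun y => (hcov y).imp fun j h => Finset.mem_union_right _ h.mem₃)
    (fun y => (hcov y).imp fun j h =>
      Finset.smul_finset_subset_smul_finset Finset.subset_union_left h.img₃)
  obtain ⟨v₄, h₄⟩ := S.exists_limit (fun j => (c j).w₄) (fun j => (c j).X₃ k ∪ (c j).X₄ k)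
    (mono fun j => Finset.union_subset_union (hext j).sub₃ (hext j).sub₄) (fun j => (hext j).eq₄)
    (fun y => (hcov y).imp fun j h => Finset.mem_union_left _ h.mem₃)
    (fun y => (hcov y).imp fun j h =>
      Finset.smul_finset_subset_smul_finset Finset.subset_union_left h.img₄)
  refine ⟨⟨v₁, v₂, v₃, v₄, ∅⟩, fun j => ?_⟩
  exact Extends.prod_eq (c' := ⟨v₁, v₂, v₃, v₄, (c j).X⟩) ⟨subset_rfl, h₁ j, h₂ j, h₃ j, h₄ j⟩

/-- If the product along `α` is translated by `h` into the product along `β`, and `α` is prepared,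
then the pair extends to one with the same property, in which `β` is prepared. -/
theorem exists_extends_pair (hk : S.MovesMax k) {α β : Chain G V} {h : G}
    (hα : α.Prepared k S) (hX : α.X = β.X) (hm : ∀ x ∈ α.X, β.prod k • x = h • α.prod k • x)
    (y : V) :
    ∃ α' β' : Chain G V, Extends k α α' ∧ Extends k β β' ∧ β'.Prepared k S ∧ β'.Covers k y ∧
      β'.X = α'.X ∧ ∀ x ∈ β'.X, β'.prod k • x = h • α'.prod k • x := by
  obtain ⟨β', e, p, cov⟩ := exists_prepared hk β y
  -- The chain `β` has just been enlarged freely; `α`, being prepared, catches up with the product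
  -- that the relation with `h` dictates.
  obtain ⟨α', e', hX', h'⟩ := hα.exists_extends hk (T := β'.X) (θ := h⁻¹ * β'.prod k)
    (hX ▸ e.sub) (fun x hx => by
      rw [mul_smul, e.prod_eq x (hX ▸ hx), hm x hx, inv_smul_smul])
  exact ⟨α', β', e', e, p, cov, hX'.symm, fun x hx => by
    rw [h' x hx, mul_smul, smul_inv_smul]⟩

end Chain

/-- If `k` moves maximally, every group element is a product of four conjugates of `k` and four
conjugates of its inverse. -/
theorem MovesMax.exists_eq_prod [Countable V] [FaithfulSMul G V] {k : G} (hk : S.MovesMax k)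
    (h : G) : ∃ α β : Chain G V, h = β.prod k * (α.prod k)⁻¹ := by
  let St := {s : Chain G V × Chain G V // s.1.Prepared k S ∧ s.1.X = s.2.X ∧
    ∀ x ∈ s.1.X, s.2.prod k • x = h • s.1.prod k • x}
  have step : ∀ (s : St) (y : V), ∃ s' : St, Chain.Extends k s.1.1 s'.1.1 ∧
      Chain.Extends k s.1.2 s'.1.2 ∧ s'.1.1.Covers k y ∧ s'.1.2.Covers k y := by
    rintro ⟨⟨α, β⟩, hα, hX, hm⟩ y
    obtain ⟨α', β', a1, b1, p1, c1, x1, m1⟩ := Chain.exists_extends_pair hk hα hX hm y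
    -- The chain that caught up need not be prepared any more, so the roles are exchanged, with
    -- `h⁻¹` for `h`. This restores the invariant and covers `y` on both sides.
    obtain ⟨β'', α'', b2, a2, p2, c2, x2, m2⟩ := Chain.exists_extends_pair (h := h⁻¹) hk p1 x1
      (fun x hx => by rw [m1 x hx, inv_smul_smul]) y
    exact ⟨⟨⟨α'', β''⟩, p2, x2, fun x hx => by rw [m2 x hx, smul_inv_smul]⟩, a1.trans a2,
      b1.trans b2, c2, c1.of_extends b2⟩
  choose next n1 n2 n3 n4 using step
  have i0 : S.Ind ∅ ∅ ∅ := by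
    obtain ⟨σ, -, hσ⟩ := S.ind_exists ∅ ∅ ∅
    simpa using hσ
  let c₀ : Chain G V := ⟨1, 1, 1, 1, ∅⟩
  have e1 : c₀.X₁ k = ∅ := Finset.smul_finset_empty _
  have e2 : c₀.X₂ k = ∅ := by rw [Chain.X₂, e1, Finset.smul_finset_empty]
  have e3 : c₀.X₃ k = ∅ := by rw [Chain.X₃, e2, Finset.smul_finset_empty]
  let s₀ : St := ⟨(c₀, c₀), ⟨S.cl_empty, by simpa [e1, e2] using i0, by simpa [e2, e3] using i0⟩,
    rfl, fun x hx => absurd hx (Finset.notMem_empty x)⟩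
  rcases isEmpty_or_nonempty V with hV | hV
  · exact ⟨c₀, c₀, FaithfulSMul.eq_of_smul_eq_smul (α := V) fun x => hV.elim x⟩
  obtain ⟨y, hy⟩ := exists_surjective_nat V
  let st : ℕ → St := fun j => Nat.rec s₀ (fun i s => next s (y i)) j
  have cov : ∀ x, ∃ j, (st j).1.1.Covers k x ∧ (st j).1.2.Covers k x := by
    intro x
    obtain ⟨j, rfl⟩ := hy x
    exact ⟨j + 1, n3 _ _, n4 _ _⟩
  obtain ⟨α, hα⟩ := Chain.exists_limit S (fun j => (st j).1.1) (fun j => n1 _ _)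
    (fun x => (cov x).imp fun j h => h.1)
  obtain ⟨β, hβ⟩ := Chain.exists_limit S (fun j => (st j).1.2) (fun j => n2 _ _)
    (fun x => (cov x).imp fun j h => h.2)
  refine ⟨α, β, eq_mul_inv_of_mul_eq (FaithfulSMul.eq_of_smul_eq_smul (α := V) fun x => ?_)⟩
  obtain ⟨j, hj, -⟩ := cov x
  rw [mul_smul, hα j x hj.mem, hβ j x ((st j).2.2.1 ▸ hj.mem), (st j).2.2.2 x hj.mem]

/-! ### From weak to free independence by commutators. -/

variable (S) in
/-- `k` moves every type to one that is independent in the sense of the dimension. -/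
def WMoves (k : G) : Prop :=
  ∀ X T : Finset V, S.cl X = X → ∃ σ : G, (∀ x ∈ X, σ • x = x) ∧ S.WInd (σ • T) X (k • σ • T)

variable (S) in
/-- The requirement on `h` that the commutator `h⁻¹ k⁻¹ h k` moves the type of `T` over `X`
maximally. -/
def CommMoves (k h : G) (X T : Finset V) : Prop :=
  S.cl X = X → ∃ σ : G, (∀ x ∈ X, σ • x = x) ∧
    S.Ind (σ • T) X ((h⁻¹ * k⁻¹ * h * k) • σ • T) ∧
    S.Ind ((h⁻¹ * k⁻¹ * h * k) • σ • T) ((h⁻¹ * k⁻¹ * h * k) • X) (σ • T)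

/-- A free copy over `Y` is taken first; the correction supplied by `WMoves` fixes `Y` and so
preserves that freeness. -/
theorem WMoves.exists_ind {k : G} (hk : S.WMoves k) {X Y : Finset V} (hXY : X ⊆ Y)
    (hY : S.cl Y = Y) (T : Finset V) : ∃ σ : G, (∀ x ∈ S.cl X, σ • x = x) ∧
      S.Ind (σ • T) X Y ∧ S.WInd (σ • T) Y (k • σ • T) := by
  obtain ⟨σ, s1, s2⟩ := S.ind_exists T X Y
  obtain ⟨τ, t1, t2⟩ := hk Y (σ • T) hY
  have hX : S.cl X ⊆ Y := hY ▸ S.cl_mono hXY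
  refine ⟨τ * σ, fun x hx => ?_, ?_, ?_⟩
  · rw [mul_smul, s1 x hx, t1 x (hX hx)]
  · have := S.ind_smul τ s2
    rwa [Finset.smul_eq_of_fixes t1, Finset.smul_eq_of_fixes fun x hx => t1 x (hXY hx),
      ← mul_smul] at this
  · rwa [mul_smul]

end IndepGeometry

namespace IndepGeometry

variable {G V : Type*} [Group G] [MulAction G V] [DecidableEq V] {S : IndepGeometry G V}

/-- The commutator is followed along `a → b → c → k⁻¹ • c → e`, the arrows being `k`, `h'`, `k⁻¹`,
`h'⁻¹`. The copies `a` and `c` are chosen weakly independent from their images under `k`. This makes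
`a` and `e` each weakly independent from `b` over `D₀`. The remaining freedom in `h'` makes them
free over `D₀ ∪ b`, and `ind_of_d` removes `b` from the base. Only finitely many values of `h'`
matter. -/
theorem WMoves.commMoves_dense {k : G} (hk : S.WMoves k) (X T : Finset V) (h : G)
    (D : Finset V) : ∃ (h' : G) (D' : Finset V), D ⊆ D' ∧ (∀ x ∈ D, h' • x = h • x) ∧
      ∀ h'' : G, (∀ x ∈ D', h'' • x = h' • x) → S.CommMoves k h'' X T := by
  by_cases hX : S.cl X = X
  swap
  · exact ⟨h, D, subset_rfl, fun _ _ => rfl, fun _ _ hX' => absurd hX' hX⟩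
  set Y := h⁻¹ • k⁻¹ • h • k • X with hY
  set D₀ := S.cl (D ∪ X ∪ k • X ∪ Y) with hD₀
  have cD₀ : S.cl D₀ = D₀ := S.cl_cl _
  have inD₀ : D ∪ X ∪ k • X ∪ Y ⊆ D₀ := S.subset_cl _
  have YD : Y ⊆ D₀ := Finset.subset_union_right.trans inD₀
  have kXD : k • X ⊆ D₀ :=
    (Finset.subset_union_right.trans Finset.subset_union_left).trans inD₀
  have XD : X ⊆ D₀ := (Finset.subset_union_right.trans
    (Finset.subset_union_left.trans Finset.subset_union_left)).trans inD₀
  have DD : D ⊆ D₀ := (Finset.subset_union_left.trans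
    (Finset.subset_union_left.trans Finset.subset_union_left)).trans inD₀
  set E := h • D₀ with hE
  have cE : S.cl E = E := S.cl_smul_eq cD₀ h
  -- Including `k⁻¹ • D₀` makes the image `b` of `a` free from `D₀` over `k • X`.
  set D₁ := S.cl (D₀ ∪ k⁻¹ • D₀) with hD₁
  have D₀₁ : D₀ ⊆ D₁ := Finset.subset_union_left.trans (S.subset_cl _)
  obtain ⟨σ, s1, s2, s3⟩ := hk.exists_ind (XD.trans D₀₁) (S.cl_cl _) T
  rw [hX] at s1
  set a := σ • T with ha
  set b := k • a with hb
  have ib : S.Ind b (k • X) D₀ := by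
    refine S.ind_mono (S.ind_smul k s2) (Finset.subset_union_left.trans (S.subset_cl _)) ?_
    refine subset_trans ?_ (Finset.subset_union_left.trans (S.subset_cl _))
    rw [← smul_inv_smul k D₀]
    exact Finset.smul_finset_subset_smul_finset
      (Finset.subset_union_right.trans (S.subset_cl _))
  set E₁ := S.cl (E ∪ k • E) with hE₁
  obtain ⟨τ, t1, t2, t3⟩ := hk.exists_ind (X := E) (Y := E₁)
    (Finset.subset_union_left.trans (S.subset_cl _)) (S.cl_cl _) (h • b)
  rw [cE] at t1
  set c := τ • h • b with hc
  have h'D : ∀ x ∈ D₀, (τ * h) • x = h • x := fun x hx => by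
    rw [mul_smul, t1 _ (Finset.smul_mem_smul_finset hx)]
  have hkXE : h • k • X ⊆ E := Finset.smul_finset_subset_smul_finset kXD
  have hkXkE : h • k • X ⊆ k • E := by
    rw [← smul_inv_smul k (h • k • X), ← smul_inv_smul h (k⁻¹ • h • k • X)]
    exact Finset.smul_finset_subset_smul_finset (Finset.smul_finset_subset_smul_finset YD)
  have kE₁ : k • E ⊆ E₁ := Finset.subset_union_right.trans (S.subset_cl _)
  have ic : S.Ind c (h • k • X) E₁ := by
    have := S.ind_smul (τ * h) ib
    rw [Finset.smul_eq_of_agree h'D,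
      Finset.smul_eq_of_agree fun x hx => h'D x (kXD hx), mul_smul] at this
    exact Ind_trans_right this t2 (by rw [Finset.union_eq_right.2 hkXE])
  -- Since `ρ` fixes `D₀ ∪ b`, replacing `τ * h` by `τ * h * ρ⁻¹` keeps `b ↦ c` and the prescribed
  -- values, and only relocates the preimage of `k⁻¹ • c`.
  obtain ⟨ρ, r1, r2⟩ := S.ind_exists ((τ * h)⁻¹ • k⁻¹ • c) (D₀ ∪ b) a
  have r1' : ∀ x ∈ D₀ ∪ b, ρ⁻¹ • x = x :=
    fun x hx => inv_smul_eq_of_fixes (r1 x (S.subset_cl _ hx))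
  set e := ρ • (τ * h)⁻¹ • k⁻¹ • c with he
  set h' := τ * h * ρ⁻¹ with hh'
  have h'D₀ : ∀ x ∈ D₀, h' • x = h • x := fun x hx => by
    rw [hh', mul_smul, r1' x (Finset.mem_union_left _ hx), h'D x hx]
  have h'b : h' • b = c := by
    rw [hh', mul_smul, Finset.smul_eq_of_fixes fun x hx => r1' x (Finset.mem_union_right _ hx),
      mul_smul]
  have h'e : h' • e = k⁻¹ • c := by
    rw [hh', mul_smul, he, inv_smul_smul, smul_inv_smul]
  have h'E : h' • D₀ = E := Finset.smul_eq_of_agree h'D₀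
  have h'Y : h' • Y = k⁻¹ • h • k • X := by
    rw [Finset.smul_eq_of_agree fun x hx => h'D₀ x (YD hx), hY, smul_inv_smul]
  have w1 : S.WInd a D₀ b := (Ind_wInd s2).between s3 XD (D₀₁.trans (S.subset_cl _))
  have w2 : S.WInd e D₀ b := by
    have := (((Ind_wInd ic).between t3 hkXkE (kE₁.trans (S.subset_cl _))).smul k⁻¹).smul h'⁻¹
    rwa [inv_smul_smul, ← h'e, inv_smul_smul, inv_smul_smul, ← h'E, inv_smul_smul, ← h'b,
      inv_smul_smul] at this
  have i1 : S.Ind a D₀ e := S.ind_of_d (wInd_iff.1 w1) (wInd_iff.1 w2) (S.ind_symm r2)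
  have i2 : S.Ind a X e := by
    refine Ind_trans_right (C := D₀) (S.ind_mono s2 (Finset.subset_union_left.trans
      (S.subset_cl _)) (D₀₁.trans (Finset.subset_union_left.trans (S.subset_cl _)))) i1 ?_
    rw [Finset.union_eq_right.2 XD]
  have i3 : S.Ind e Y D₀ := by
    have := S.ind_smul h'⁻¹ (S.ind_smul k⁻¹ (S.ind_mono ic (C' := k • E)
      (Finset.subset_union_left.trans (S.subset_cl _))
      (kE₁.trans (Finset.subset_union_left.trans (S.subset_cl _)))))
    rwa [inv_smul_smul, ← h'e, inv_smul_smul, ← h'Y, inv_smul_smul, ← h'E, inv_smul_smul] at this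
  have i4 : S.Ind e Y a :=
    Ind_trans_right i3 (S.ind_symm i1) (by rw [Finset.union_eq_right.2 YD])
  refine ⟨h', D₀ ∪ b ∪ e, DD.trans (Finset.subset_union_left.trans Finset.subset_union_left),
    fun x hx => h'D₀ x (DD hx), fun h₃ hh₃ _ => ⟨σ, s1, ?_⟩⟩
  have q1 : h₃ • b = c := by
    rw [← h'b]
    exact Finset.smul_eq_of_agree fun x hx => hh₃ x (by simp [hx])
  have q2 : h₃ • e = k⁻¹ • c := by
    rw [← h'e]
    exact Finset.smul_eq_of_agree fun x hx => hh₃ x (by simp [hx])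
  have q3 : h₃ • Y = k⁻¹ • h • k • X := by
    rw [← h'Y]
    exact Finset.smul_eq_of_agree fun x hx => hh₃ x (by simp [YD hx])
  have q4 : h₃ • k • X = h • k • X := by
    refine Finset.smul_eq_of_agree fun x hx => ?_
    rw [hh₃ x (by simp [kXD hx]), h'D₀ x (kXD hx)]
  have m1 : (h₃⁻¹ * k⁻¹ * h₃ * k) • a = e := by
    simp only [mul_smul]
    rw [← hb, q1, ← q2, inv_smul_smul]
  have m2 : (h₃⁻¹ * k⁻¹ * h₃ * k) • X = Y := by
    simp only [mul_smul]
    rw [q4, ← q3, inv_smul_smul]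
  rw [← ha, m1, m2]
  exact ⟨i2, i4⟩

/-- The pairs `(X, T)` are countably many, and each imposes a condition met on an open dense set. -/
theorem WMoves.exists_movesMax [Countable V] {k : G} (hk : S.WMoves k) :
    ∃ h : G, S.MovesMax (h⁻¹ * k⁻¹ * h * k) := by
  obtain ⟨h, hh⟩ := exists_forall_of_dense (ι := Finset V × Finset V)
    (fun i h => S.CommMoves k h i.1 i.2) (fun i h D => hk.commMoves_dense i.1 i.2 h D) S
  exact ⟨h, fun X T hX => hh (X, T) hX⟩

/-! ### Basic types, monodimensionality and weak movement. -/

variable (S) in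
/-- `b` is basic over the closed set `A`. -/
def Basic (b : V) (A : Finset V) : Prop :=
  b ∉ A ∧ ∀ C, S.cl C = C → A ⊆ C → S.rel {b} C < S.rel {b} A → b ∈ C

variable (S) in
/-- Over every closed set, every orbit of a basic element spans together with a finite set. -/
def Mono : Prop :=
  ∀ A b, S.cl A = A → S.Basic b A → ∃ B, S.cl B = B ∧ A ⊆ B ∧
    ∀ x, ∃ F : Finset V, (∀ y ∈ F, ∃ σ : G, (∀ a ∈ A, σ • a = a) ∧ σ • b = y) ∧ x ∈ S.cl (B ∪ F)

theorem mem_cl_smul {σ : G} {x : V} {X : Finset V} (h : x ∈ S.cl X) : σ • x ∈ S.cl (σ • X) := by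
  rw [← S.smul_cl]
  exact Finset.smul_mem_smul_finset h

/-- Enlarging the base can only lower the relative dimension, and for a basic element a strict drop
forces membership. -/
theorem Basic.rel_eq {b : V} {A C : Finset V} (hb : S.Basic b A) (hAC : A ⊆ S.cl C)
    (hC : b ∉ S.cl C) : S.rel {b} C = S.rel {b} A := by
  rw [← S.rel_cl_right]
  refine le_antisymm (S.rel_anti _ hAC) (not_lt.1 fun h => hC (hb.2 _ (S.cl_cl _) hAC h))

theorem Basic.smul {b : V} {A : Finset V} (hb : S.Basic b A) {σ : G} (hσ : ∀ a ∈ A, σ • a = a) :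
    S.Basic (σ • b) A := by
  have e : ∀ C, A ⊆ C → A ⊆ σ⁻¹ • C := fun C hC x hx => by
    rw [Finset.mem_inv_smul_finset_iff, hσ x hx]
    exact hC hx
  have r : ∀ C, S.rel {σ • b} C = S.rel {b} (σ⁻¹ • C) := fun C => by
    rw [← S.rel_smul σ {b}, smul_inv_smul, Finset.smul_finset_singleton]
  have eA : σ⁻¹ • A = A := Finset.smul_eq_of_fixes fun x hx => inv_smul_eq_of_fixes (hσ x hx)
  refine ⟨fun h => hb.1 ?_, fun C hC hAC hlt => ?_⟩
  · rwa [← eA, Finset.mem_inv_smul_finset_iff]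
  · rw [r, r, eA] at hlt
    rw [← Finset.mem_inv_smul_finset_iff]
    exact hb.2 _ (S.cl_smul_eq hC _) (e C hAC) hlt

theorem Basic.of_subset {b : V} {A Z : Finset V} (hb : S.Basic b A) (hAZ : A ⊆ Z)
    (hZ : b ∉ Z) : S.Basic b Z :=
  ⟨hZ, fun C hC hZC hlt =>
    hb.2 C hC (hAZ.trans hZC) (hlt.trans_le (S.rel_anti _ hAZ))⟩

variable (S) in
/-- Bounded elements are trivial. -/
def NoBounded : Prop :=
  ∀ (g : G) (B : Finset V), S.cl B = B → (∀ x, g • x ∈ S.cl (insert x B)) → g = 1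

/-- If a nontrivial element moved all realisations of a basic type within their closure, it would
be bounded. -/
theorem Mono.exists_notMem (hm : S.Mono) (hb : S.NoBounded) {g : G} (hg : g ≠ 1) {Z : Finset V}
    (hZ : S.cl Z = Z) {x : V} (hx : S.Basic x Z) :
    ∃ τ : G, (∀ z ∈ Z, τ • z = z) ∧ g • τ • x ∉ S.cl (insert (τ • x) Z) := by
  by_contra! H
  obtain ⟨B, -, hZB, hB⟩ := hm Z x hZ hx
  apply hg
  set B' := S.cl (B ∪ g • B) with hB'
  have BB : B ⊆ B' := Finset.subset_union_left.trans (S.subset_cl _)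
  have gBB : g • B ⊆ B' := Finset.subset_union_right.trans (S.subset_cl _)
  refine hb g B' (S.cl_cl _) fun y => ?_
  have key : ∀ F : Finset V, (∀ z ∈ F, ∃ σ : G, (∀ a ∈ Z, σ • a = a) ∧ σ • x = z) →
      y ∈ S.cl (B ∪ F) → g • y ∈ S.cl (B' ∪ F) := by
    intro F hF hy
    have h1 := mem_cl_smul (σ := g) hy
    refine S.cl_subset_cl ?_ h1
    rw [Finset.smul_finset_union]
    refine Finset.union_subset
      (gBB.trans (Finset.subset_union_left.trans (S.subset_cl _))) fun w hw => ?_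
    obtain ⟨z, hz, rfl⟩ := Finset.mem_smul_finset.1 hw
    obtain ⟨σ, hσ, rfl⟩ := hF z hz
    refine S.cl_mono ?_ (H σ hσ)
    exact Finset.insert_subset (Finset.mem_union_right _ hz)
      ((hZB.trans BB).trans Finset.subset_union_left)
  obtain ⟨F, hF, hy⟩ := hB y
  -- The spanning set `F` is eliminated by a second copy of it, free over `insert y B'`: `g • y`
  -- lies in the closure over either copy, hence in the closure of `insert y B'`.
  obtain ⟨σ, s1, s2⟩ := S.ind_exists F (insert y B') F
  have s1' : ∀ z ∈ insert y B', σ • z = z := fun z hz => s1 z (S.subset_cl _ hz)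
  have fB : ∀ z ∈ B, σ • z = z := fun z hz => s1' z (Finset.mem_insert_of_mem (BB hz))
  have k1 := key F hF hy
  have k2 : g • y ∈ S.cl (B' ∪ σ • F) := by
    refine key (σ • F) (fun z hz => ?_) ?_
    · obtain ⟨w, hw, rfl⟩ := Finset.mem_smul_finset.1 hz
      obtain ⟨ρ, hρ, rfl⟩ := hF w hw
      exact ⟨σ * ρ, fun a ha => by rw [mul_smul, hρ a ha, fB a (hZB ha)], mul_smul _ _ _⟩
    · have := mem_cl_smul (σ := σ) hy
      rwa [Finset.smul_finset_union, Finset.smul_eq_of_fixes fB,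
        s1' y (Finset.mem_insert_self _ _)] at this
  refine (Ind_wInd s2).mem_cl (S.cl_mono ?_ k2) (S.cl_mono ?_ k1)
  · rw [Finset.union_comm]
    exact Finset.union_subset_union_right (Finset.subset_insert _ _)
  · rw [Finset.union_comm]
    exact Finset.union_subset_union_right (Finset.subset_insert _ _)

/-- A nontrivial element moves a finite set of realisations of a basic type to one which is
independent, in the sense of the dimension. -/
theorem Mono.exists_rel_le (hm : S.Mono) (hnb : S.NoBounded) {k : G} (hk : k ≠ 1)
    {A C : Finset V} {b : V} (hb : S.Basic b A) (hAC : A ⊆ C) (F : Finset V)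
    (hF : ∀ y ∈ F, ∃ σ : G, (∀ a ∈ A, σ • a = a) ∧ σ • b = y) :
    ∃ σ : G, (∀ x ∈ C, σ • x = x) ∧
      2 * S.rel F C ≤ S.rel (σ • F ∪ k • σ • F) (C ∪ k • C) := by
  induction F using Finset.induction_on with
  | empty =>
    refine ⟨1, fun x _ => one_smul _ x, ?_⟩
    rw [S.rel_eq_zero_of_subset (Finset.empty_subset _)]
    simpa using S.rel_nonneg _ _
  | insert x F hxF ih =>
    obtain ⟨σ, s1, s2⟩ := ih fun y hy => hF y (Finset.mem_insert_of_mem hy)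
    by_cases hx : x ∈ S.cl (C ∪ F)
    · refine ⟨σ, s1, ?_⟩
      have e : S.rel (insert x F) C = S.rel F C := by
        have : S.rel {x} (F ∪ C) = 0 := S.rel_eq_zero_of_subset
          (by rwa [Finset.singleton_subset_iff, Finset.union_comm])
        rw [Finset.insert_eq, S.rel_union, this, add_zero]
      rw [e]
      refine s2.trans (S.rel_mono _ ?_)
      have : σ • F ⊆ σ • insert x F :=
        Finset.smul_finset_subset_smul_finset (Finset.subset_insert _ _)
      exact Finset.union_subset_union this (Finset.smul_finset_subset_smul_finset this)
    set W := σ • F ∪ k • σ • F ∪ (C ∪ k • C) with hW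
    set R := S.cl (C ∪ σ • F) with hR
    set Z := S.cl (W ∪ k⁻¹ • W) with hZ
    have WZ : W ⊆ Z := Finset.subset_union_left.trans (S.subset_cl _)
    have kWZ : k⁻¹ • W ⊆ Z := Finset.subset_union_right.trans (S.subset_cl _)
    have CW : C ⊆ W := Finset.subset_union_left.trans Finset.subset_union_right
    have FW : σ • F ⊆ W := Finset.subset_union_left.trans Finset.subset_union_left
    -- First the new point is moved off `Z` without disturbing the part already placed; then a
    -- further automorphism over `Z` makes its `k`-image leave its closure over `Z`. By basicness
    -- the point and its image each contribute the full `S.rel {b} A`.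
    obtain ⟨ρ, r1, r2⟩ := S.ind_exists {σ • x} R Z
    rw [Finset.smul_finset_singleton, S.cl_cl] at *
    have fC : ∀ z ∈ C, ρ • z = z :=
      fun z hz => r1 z (S.subset_cl _ (Finset.mem_union_left _ hz))
    have fF : ∀ z ∈ σ • F, ρ • z = z :=
      fun z hz => r1 z (S.subset_cl _ (Finset.mem_union_right _ hz))
    have hσx : σ • x ∉ R := fun h => hx (by
      have h1 := mem_cl_smul (σ := σ⁻¹) h
      rwa [inv_smul_smul, Finset.smul_finset_union, inv_smul_smul,
        Finset.smul_eq_of_fixes fun z hz => inv_smul_eq_of_fixes (s1 z hz)] at h1)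
    have hρx : ρ • σ • x ∉ Z := fun h => by
      have h1 : ρ • σ • x ∈ S.cl R := (Ind_wInd r2).mem_cl
        (S.subset_cl _ (by simp)) (S.subset_cl _ (Finset.mem_union_left _ h))
      rw [S.cl_cl] at h1
      have h2 := Finset.smul_mem_smul_finset (a := ρ⁻¹) h1
      rw [inv_smul_smul, Finset.smul_eq_of_fixes fun z hz => inv_smul_eq_of_fixes (r1 z hz)] at h2
      exact hσx h2
    have basic : ∀ θ : G, (∀ z ∈ C, θ • z = z) → S.Basic (θ • x) A ∧
        S.rel {θ • x} A = S.rel {b} A := by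
      intro θ hθ
      obtain ⟨μ, m1, m2⟩ := hF x (Finset.mem_insert_self _ _)
      have f : ∀ a ∈ A, (θ * μ) • a = a := fun a ha => by rw [mul_smul, m1 a ha, hθ a (hAC ha)]
      have e : (θ * μ) • b = θ • x := by rw [mul_smul, m2]
      refine ⟨e ▸ hb.smul f, ?_⟩
      rw [← S.rel_smul (θ * μ) {b}, Finset.smul_eq_of_fixes f, Finset.smul_finset_singleton, e]
    have bas1 := (basic (ρ * σ) fun z hz => by rw [mul_smul, s1 z hz, fC z hz]).1
    rw [mul_smul] at bas1
    obtain ⟨τ, t1, t2⟩ := hm.exists_notMem hnb hk (S.cl_cl _)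
      (bas1.of_subset (hAC.trans (CW.trans WZ)) hρx)
    have tC : ∀ z ∈ C, (τ * (ρ * σ)) • z = z := fun z hz => by
      rw [mul_smul, mul_smul, s1 z hz, fC z hz, t1 z (WZ (CW hz))]
    obtain ⟨bas, rb⟩ := basic (τ * (ρ * σ)) tC
    have eF : (τ * (ρ * σ)) • F = σ • F := by
      rw [mul_smul, mul_smul, Finset.smul_eq_of_fixes fF,
        Finset.smul_eq_of_fixes fun z hz => t1 z (WZ (FW hz))]
    have ex : τ • ρ • σ • x = (τ * (ρ * σ)) • x := by rw [mul_smul, mul_smul]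
    rw [ex] at t2
    have nZ : (τ * (ρ * σ)) • x ∉ Z := fun h => hρx (by
      have h2 := Finset.smul_mem_smul_finset (a := τ⁻¹) h
      rwa [← ex, inv_smul_smul,
        Finset.smul_eq_of_fixes fun z hz => inv_smul_eq_of_fixes (t1 z hz)] at h2)
    refine ⟨τ * (ρ * σ), tC, ?_⟩
    set θ := τ * (ρ * σ) with hθ
    have q1 : S.rel {θ • x} W = S.rel {b} A := by
      rw [bas.rel_eq ((hAC.trans CW).trans (S.subset_cl _)) fun h => nZ ?_, rb]
      exact S.cl_mono Finset.subset_union_left h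
    have q2 : S.rel {k • θ • x} (insert (θ • x) W) = S.rel {b} A := by
      rw [← S.rel_smul k⁻¹, Finset.smul_finset_singleton, inv_smul_smul,
        bas.rel_eq (subset_trans ?_ (S.subset_cl _)) fun h => t2 ?_, rb]
      · intro z hz
        rw [Finset.mem_inv_smul_finset_iff]
        refine Finset.mem_insert_of_mem (Finset.mem_union_right _ (Finset.mem_union_right _ ?_))
        exact Finset.smul_mem_smul_finset (hAC hz)
      · have := mem_cl_smul (σ := k) h
        rw [smul_inv_smul] at this
        exact S.cl_mono (Finset.insert_subset_insert _ WZ) this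
    have q3 : S.rel {x} (F ∪ C) = S.rel {b} A := by
      have := (basic 1 fun z _ => one_smul _ z)
      rw [one_smul] at this
      rw [this.1.rel_eq ((hAC.trans Finset.subset_union_right).trans (S.subset_cl _)), this.2]
      rwa [Finset.union_comm]
    have e1 : S.rel (insert x F) C = S.rel F C + S.rel {b} A := by
      rw [Finset.insert_eq, S.rel_union, q3]
    have e2 : θ • insert x F ∪ k • θ • insert x F =
        {k • θ • x} ∪ ({θ • x} ∪ (σ • F ∪ k • σ • F)) := by
      rw [Finset.smul_finset_insert, eF, Finset.smul_finset_insert, Finset.insert_eq,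
        Finset.insert_eq]
      ac_rfl
    rw [e1, e2, S.rel_union, S.rel_union, q1, Finset.union_assoc, ← Finset.insert_eq, q2]
    linarith

/-- A copy of `T` free from `C` over `X` lies in the closure of `C` and a finite set `F` of
realisations of one basic type. Weak independence is arranged for `F` by `exists_rel_le`, inherited
by the copy of `T`, and brought down from `C` to `X` by transitivity. -/
theorem Mono.wMoves (hm : S.Mono) (hnb : S.NoBounded) {k : G} (hk : k ≠ 1)
    {A : Finset V} {b : V} (hA : S.cl A = A) (hb : S.Basic b A) : S.WMoves k := by
  intro X T hX
  obtain ⟨B, hB, hAB, hspan⟩ := hm A b hA hb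
  choose Fs hFs hmem using hspan
  set C := S.cl (X ∪ B) with hC
  have XC : X ⊆ C := Finset.subset_union_left.trans (S.subset_cl _)
  have BC : B ⊆ C := Finset.subset_union_right.trans (S.subset_cl _)
  obtain ⟨ρ, r1, r2⟩ := S.ind_exists T X C
  rw [hX] at r1
  set F := (ρ • T).biUnion Fs with hF
  obtain ⟨σ, s1, s2⟩ := hm.exists_rel_le hnb hk hb (hAB.trans BC) F
    (fun y hy => by
      obtain ⟨z, -, hz⟩ := Finset.mem_biUnion.1 hy
      exact hFs z y hz)
  refine ⟨σ * ρ, fun x hx => by rw [mul_smul, r1 x hx, s1 x (XC hx)], ?_⟩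
  rw [mul_smul]
  have TF : ρ • T ⊆ S.cl (F ∪ C) := fun z hz => by
    refine S.cl_mono ?_ (hmem z)
    rw [Finset.union_comm]
    exact Finset.union_subset_union (Finset.subset_biUnion_of_mem Fs hz) BC
  have T'F : σ • ρ • T ⊆ S.cl (σ • F ∪ C) := by
    have := Finset.smul_finset_subset_smul_finset (a := σ) TF
    rwa [S.smul_cl, Finset.smul_finset_union, Finset.smul_eq_of_fixes s1] at this
  have kT'F : k • σ • ρ • T ⊆ S.cl (k • C ∪ k • σ • F ∪ C) := by
    have := Finset.smul_finset_subset_smul_finset (a := k) T'F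
    rw [S.smul_cl, Finset.smul_finset_union] at this
    refine this.trans (S.cl_mono ?_)
    rw [Finset.union_comm]
    exact Finset.subset_union_left
  -- The two sets `σ • F` and `k • σ • F` together attain twice `S.rel F C`, while each contributes
  -- at most that much; so neither loses dimension.
  have w : S.WInd (σ • F) C (k • C ∪ k • σ • F) := by
    apply wInd_of_le
    rw [S.rel_union] at s2
    have h1 : S.rel (k • σ • F) (C ∪ k • C) ≤ S.rel F C := by
      refine (S.rel_anti _ Finset.subset_union_right).trans ?_
      rw [S.rel_smul]
      nth_rewrite 1 [← Finset.smul_eq_of_fixes s1]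
      rw [S.rel_smul]
    have h2 : S.rel (σ • F) C = S.rel F C := by
      nth_rewrite 1 [← Finset.smul_eq_of_fixes s1]
      rw [S.rel_smul]
    rw [show C ∪ (k • C ∪ k • σ • F) = k • σ • F ∪ (C ∪ k • C) by ac_rfl]
    linarith
  have r3 := S.ind_smul σ r2
  rw [Finset.smul_eq_of_fixes s1, Finset.smul_eq_of_fixes fun x hx => s1 x (XC hx)] at r3
  have w2 : S.WInd (σ • ρ • T) C (k • σ • ρ • T) := w.mono T'F kT'F
  refine ((Ind_wInd r3).trans (D := k • σ • ρ • T) ?_).mono_right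
    (Finset.subset_union_right.trans (Finset.subset_union_left.trans (S.subset_cl _)))
  rwa [Finset.union_eq_right.2 XC]

end IndepGeometry

/-! ### Counting conjugates. -/

/-- `x` is a product of `N` conjugates of `g` and `g⁻¹`. -/
def IsConjProd {G : Type*} [Group G] (g : G) (N : ℕ) (x : G) : Prop :=
  ∃ l : List G, l.length = N ∧ (∀ y ∈ l, IsConj g y ∨ IsConj g⁻¹ y) ∧ l.prod = x

namespace IsConjProd

variable {G : Type*} [Group G] {g x y : G} {M N : ℕ}

theorem mul (hx : IsConjProd g M x) (hy : IsConjProd g N y) : IsConjProd g (M + N) (x * y) := by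
  obtain ⟨l, h1, h2, rfl⟩ := hx
  obtain ⟨l', h1', h2', rfl⟩ := hy
  refine ⟨l ++ l', by rw [List.length_append, h1, h1'], fun z hz => ?_, List.prod_append⟩
  rcases List.mem_append.1 hz with hz | hz
  exacts [h2 z hz, h2' z hz]

theorem self (g : G) : IsConjProd g 1 g :=
  ⟨[g], rfl, fun y hy => Or.inl (by rw [List.mem_singleton.1 hy]), by simp⟩

theorem conj (hx : IsConjProd g N x) (u : G) : IsConjProd g N (u * x * u⁻¹) := by
  obtain ⟨l, h1, h2, rfl⟩ := hx
  refine ⟨l.map (MulAut.conj u), by rw [List.length_map, h1], fun z hz => ?_, ?_⟩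
  · obtain ⟨y, hy, rfl⟩ := List.mem_map.1 hz
    have : IsConj y (MulAut.conj u y) := isConj_iff.2 ⟨u, rfl⟩
    exact (h2 y hy).imp (fun h => h.trans this) fun h => h.trans this
  · rw [← map_list_prod, MulAut.conj_apply]

theorem inv (hx : IsConjProd g N x) : IsConjProd g N x⁻¹ := by
  obtain ⟨l, h1, h2, rfl⟩ := hx
  have key : ∀ a b : G, IsConj a b → IsConj a⁻¹ b⁻¹ := fun a b h => by
    obtain ⟨c, rfl⟩ := isConj_iff.1 h
    exact isConj_iff.2 ⟨c, by group⟩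
  refine ⟨(l.map (·⁻¹)).reverse, by rw [List.length_reverse, List.length_map, h1],
    fun z hz => ?_, (List.prod_inv_reverse l).symm⟩
  obtain ⟨y, hy, rfl⟩ := List.mem_map.1 (List.mem_reverse.1 hz)
  rcases h2 y hy with h | h
  · exact Or.inr (key _ _ h)
  · exact Or.inl (by simpa using key _ _ h)

theorem one (g : G) (j : ℕ) : IsConjProd g (2 * j) 1 := by
  induction j with
  | zero => exact ⟨[], rfl, by simp, rfl⟩
  | succ j ih => simpa [mul_add] using ih.mul ((self g).mul (self g).inv)

end IsConjProd

namespace IndepGeometry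

theorem Chain.isConjProd_prod {G V : Type*} [Group G] {g k : G} (hk : IsConjProd g 2 k)
    (c : Chain G V) :
    IsConjProd g 8 (c.prod k) := by
  have h : ∀ w : G, IsConjProd g 2 (w⁻¹ * k * w) := fun w => by simpa using hk.conj w⁻¹
  exact (((h _).mul (h _)).mul (h _)).mul (h _)

variable {G V : Type*} [Group G] [MulAction G V] [DecidableEq V] {S : IndepGeometry G V}

-- A pair of least relative dimension among all closed sets and points outside them has no room for
-- a further drop.
variable (S) in
theorem exists_basic [Nonempty V] : ∃ A b, S.cl A = A ∧ S.Basic b A := by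
  let P : Finset V × V → Prop := fun p => S.cl p.1 = p.1 ∧ p.2 ∉ p.1
  obtain ⟨v⟩ := ‹Nonempty V›
  have hne : {p | P p}.Nonempty := ⟨(∅, v), S.cl_empty, Finset.notMem_empty v⟩
  let r : Finset V × V → ℕ := fun p => (S.rel {p.2} p.1).toNat
  obtain ⟨⟨A, b⟩, ⟨hA, hb⟩, hmin⟩ := WellFounded.has_min
    (InvImage.wf r Nat.lt_wfRel.wf) {p | P p} hne
  refine ⟨A, b, hA, hb, fun C hC _ hlt => ?_⟩
  by_contra hbC
  refine hmin (C, b) ⟨hC, hbC⟩ ?_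
  change (S.rel {b} C).toNat < (S.rel {b} A).toNat
  have := S.rel_nonneg {b} C
  omega

theorem Mono.isConjProd [Countable V] [FaithfulSMul G V] (hm : S.Mono) (hnb : S.NoBounded)
    {g : G} (hg : g ≠ 1) (h : G) : IsConjProd g 192 h := by
  have hV : Nonempty V := by
    by_contra hV
    rw [not_nonempty_iff] at hV
    exact hg (FaithfulSMul.eq_of_smul_eq_smul (α := V) fun x => hV.elim x)
  obtain ⟨A, b, hA, hb⟩ := S.exists_basic
  obtain ⟨u, hu⟩ := (hm.wMoves hnb hg hA hb).exists_movesMax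
  have hk : IsConjProd g 2 (u⁻¹ * g⁻¹ * u * g) := by
    have h1 : IsConjProd g 1 (u⁻¹ * g⁻¹ * u) := by
      simpa using (IsConjProd.self g).inv.conj u⁻¹
    exact h1.mul (IsConjProd.self g)
  obtain ⟨α, β, rfl⟩ := hu.exists_eq_prod h
  -- Each chain product costs 4 · 2 = 8 conjugates, and 8 + 8 + 2 · 88 = 192: sixteen factors do the
  -- work, and 88 pairs `g * g⁻¹` are padding.
  simpa using ((Chain.isConjProd_prod hk β).mul (Chain.isConjProd_prod hk α).inv).mul
    (IsConjProd.one g 88)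

end IndepGeometry

/-! ### Predimension, dimension and strong finite sets. -/

namespace UHypergraph

section Predimension

open Classical

variable {r n m : ℕ} {V W : Type*} {H : UHypergraph r V} {K : UHypergraph r W}

theorem powerset_inter_eq {V : Type*} (X Y : Finset V) :
    (X ∩ Y).powerset = X.powerset ∩ Y.powerset := by
  ext e
  simp only [Finset.mem_powerset, Finset.mem_inter, Finset.subset_inter_iff]

/-- Cardinality is modular, while a union may acquire edges lying in neither part. -/
theorem predim_submod (X Y : Finset V) :
    predim n m H (X ∪ Y) + predim n m H (X ∩ Y) ≤ predim n m H X + predim n m H Y := by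
  unfold predim
  have h1 : ((X ∪ Y).card : ℤ) + (X ∩ Y).card = X.card + Y.card := by
    exact_mod_cast Finset.card_union_add_card_inter X Y
  have h2 := Finset.card_union_add_card_inter (X.powerset.filter (· ∈ H.edges))
    (Y.powerset.filter (· ∈ H.edges))
  rw [← Finset.filter_inter_distrib, ← powerset_inter_eq, ← Finset.filter_union] at h2
  have h3 : (((X.powerset ∪ Y.powerset).filter (· ∈ H.edges)).card : ℤ) ≤
      ((X ∪ Y).powerset.filter (· ∈ H.edges)).card := by
    refine Int.ofNat_le.2 (Finset.card_le_card (Finset.filter_subset_filter _ ?_))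
    exact Finset.union_subset (Finset.powerset_mono.2 Finset.subset_union_left)
      (Finset.powerset_mono.2 Finset.subset_union_right)
  zify at h2
  have hm : (0 : ℤ) ≤ m := Int.natCast_nonneg m
  nlinarith [mul_le_mul_of_nonneg_left h3 hm]

theorem predim_free {X Y : Finset V}
    (h : ∀ e ∈ H.edges, e ⊆ X ∪ Y → e ⊆ X ∨ e ⊆ Y) :
    predim n m H (X ∪ Y) + predim n m H (X ∩ Y) = predim n m H X + predim n m H Y := by
  unfold predim
  have h1 : ((X ∪ Y).card : ℤ) + (X ∩ Y).card = X.card + Y.card := by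
    exact_mod_cast Finset.card_union_add_card_inter X Y
  have h2 := Finset.card_union_add_card_inter (X.powerset.filter (· ∈ H.edges))
    (Y.powerset.filter (· ∈ H.edges))
  rw [← Finset.filter_inter_distrib, ← powerset_inter_eq, ← Finset.filter_union] at h2
  have h3 : (X.powerset ∪ Y.powerset).filter (· ∈ H.edges) =
      (X ∪ Y).powerset.filter (· ∈ H.edges) := by
    ext e
    simp only [Finset.mem_filter, Finset.mem_union, Finset.mem_powerset]
    constructor
    · rintro ⟨h | h, he⟩
      exacts [⟨h.trans Finset.subset_union_left, he⟩, ⟨h.trans Finset.subset_union_right, he⟩]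
    · exact fun ⟨h', he⟩ => ⟨h e he h', he⟩
  rw [h3] at h2
  zify at h2
  linear_combination (n : ℤ) * h1 - (m : ℤ) * h2

/-- The map `φ` is an embedding of the substructure of `K` on `X` into `H`. -/
structure LocEmb (K : UHypergraph r W) (H : UHypergraph r V) (φ : W → V) (X : Finset W) : Prop where
  inj : Set.InjOn φ X
  iff : ∀ e ⊆ X, e ∈ K.edges ↔ e.image φ ∈ H.edges

theorem LocEmb.mono {φ : W → V} {X Y : Finset W} (h : LocEmb K H φ X) (hY : Y ⊆ X) :
    LocEmb K H φ Y :=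
  ⟨h.inj.mono hY, fun e he => h.iff e (he.trans hY)⟩

theorem image_filter_mem {φ : W → V} {X : Finset W} {e : Finset V} (he : e ⊆ X.image φ) :
    (X.filter (φ · ∈ e)).image φ = e := by
  ext y
  simp only [Finset.mem_image, Finset.mem_filter]
  constructor
  · rintro ⟨x, ⟨-, hx⟩, rfl⟩
    exact hx
  · intro hy
    obtain ⟨x, hx, rfl⟩ := Finset.mem_image.1 (he hy)
    exact ⟨x, ⟨hx, hy⟩, rfl⟩

theorem filter_mem_image {φ : W → V} {X e : Finset W} (hφ : Set.InjOn φ X) (he : e ⊆ X) :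
    X.filter (φ · ∈ e.image φ) = e := by
  ext y
  simp only [Finset.mem_filter, Finset.mem_image]
  constructor
  · rintro ⟨hy, x, hx, hxy⟩
    rwa [← hφ (he hx) hy hxy]
  · exact fun hy => ⟨he hy, y, hy, rfl⟩

theorem LocEmb.predim_image {φ : W → V} {X : Finset W} (h : LocEmb K H φ X) :
    predim n m H (X.image φ) = predim n m K X := by
  unfold predim
  rw [Finset.card_image_of_injOn h.inj]
  congr 3
  symm
  refine Finset.card_bij (fun e _ => e.image φ) ?_ ?_ ?_
  · intro e he
    simp only [Finset.mem_filter, Finset.mem_powerset] at he ⊢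
    exact ⟨Finset.image_subset_image he.1, (h.iff e he.1).1 he.2⟩
  · intro e he e' he' hee
    simp only [Finset.mem_filter, Finset.mem_powerset] at he he'
    rw [← filter_mem_image h.inj he.1, hee, filter_mem_image h.inj he'.1]
  · intro e he
    simp only [Finset.mem_filter, Finset.mem_powerset] at he
    refine ⟨X.filter (φ · ∈ e), ?_, image_filter_mem he.1⟩
    simp only [Finset.mem_filter, Finset.mem_powerset]
    refine ⟨Finset.filter_subset _ _, ?_⟩
    rw [h.iff _ (Finset.filter_subset _ _), image_filter_mem he.1]
    exact he.2

theorem predim_induce (S : Set V) (X : Finset S) :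
    predim n m (H.induce S) X = predim n m H (X.image Subtype.val) :=
  (LocEmb.predim_image (φ := Subtype.val) ⟨Subtype.val_injective.injOn, fun e _ => by
    change e.map (Function.Embedding.subtype (· ∈ S)) ∈ H.edges ↔ _
    rw [Finset.map_eq_image]
    rfl⟩).symm

theorem predim_eq_of_no_edge {X : Finset V} (h : X.card < r) : predim n m H X = n * X.card := by
  unfold predim
  rw [Finset.filter_eq_empty_iff.2]
  · simp
  · intro e he hee
    have := Finset.card_le_card (Finset.mem_powerset.1 he)
    rw [H.card_eq e hee] at this
    omega

/-- All finite substructures have non-negative predimension. -/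
def Nonneg (n m : ℕ) (H : UHypergraph r V) : Prop := ∀ X, 0 ≤ predim n m H X

/-- A finite set is strong if every proper finite superset has larger predimension. -/
def Strong (n m : ℕ) (H : UHypergraph r V) (Z : Finset V) : Prop :=
  ∀ Y, Z ⊂ Y → predim n m H Z < predim n m H Y

theorem Nonneg.bddBelow (hH : Nonneg n m H) (X : Finset V) :
    BddBelow {k | ∃ Y : Finset V, X ⊆ Y ∧ k = predim n m H Y} :=
  ⟨0, by rintro _ ⟨Y, -, rfl⟩; exact hH Y⟩

theorem Nonneg.dim_le (hH : Nonneg n m H) {X Y : Finset V} (h : X ⊆ Y) :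
    dim n m H X ≤ predim n m H Y := csInf_le (hH.bddBelow X) ⟨Y, h, rfl⟩

theorem Nonneg.exists_dim (hH : Nonneg n m H) (X : Finset V) :
    ∃ Y, X ⊆ Y ∧ predim n m H Y = dim n m H X := by
  obtain ⟨Y, h1, h2⟩ := Int.csInf_mem (s := {k | ∃ Y : Finset V, X ⊆ Y ∧ k = predim n m H Y})
    ⟨_, X, subset_rfl, rfl⟩ (hH.bddBelow X)
  exact ⟨Y, h1, h2.symm⟩

theorem Nonneg.dim_mono (hH : Nonneg n m H) {X Y : Finset V} (h : X ⊆ Y) :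
    dim n m H X ≤ dim n m H Y := by
  obtain ⟨Z, h1, h2⟩ := hH.exists_dim Y
  rw [← h2]
  exact hH.dim_le (h.trans h1)

theorem Nonneg.dim_submod (hH : Nonneg n m H) (X Y : Finset V) :
    dim n m H (X ∪ Y) + dim n m H (X ∩ Y) ≤ dim n m H X + dim n m H Y := by
  obtain ⟨X', h1, h2⟩ := hH.exists_dim X
  obtain ⟨Y', h3, h4⟩ := hH.exists_dim Y
  have h5 := hH.dim_le (Finset.union_subset_union h1 h3)
  have h6 := hH.dim_le (Finset.inter_subset_inter h1 h3)
  have h7 := predim_submod (n := n) (m := m) (H := H) X' Y'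
  linarith

theorem Strong.le {Z : Finset V} (hZ : Strong n m H Z) {Y : Finset V} (h : Z ⊆ Y) :
    predim n m H Z ≤ predim n m H Y := by
  rcases h.eq_or_ssubset with rfl | h
  exacts [le_rfl, (hZ Y h).le]

theorem Strong.dim_eq (hH : Nonneg n m H) {Z : Finset V} (hZ : Strong n m H Z) :
    dim n m H Z = predim n m H Z := by
  obtain ⟨Y, h1, h2⟩ := hH.exists_dim Z
  exact le_antisymm (hH.dim_le subset_rfl) (h2 ▸ hZ.le h1)

theorem Strong.eq_of_le {Z Y : Finset V} (hZ : Strong n m H Z) (h : Z ⊆ Y)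
    (hle : predim n m H Y ≤ predim n m H Z) : Y = Z := by
  rcases h.eq_or_ssubset with rfl | h
  exacts [rfl, absurd (hZ Y h) (not_lt.2 hle)]

theorem Nonneg.relDim_bddBelow (hH : Nonneg n m H) (X : Finset V) (Z : Set V) :
    BddBelow {k | ∃ Y : Finset V, (Y : Set V) ⊆ Z ∧ k = dim n m H (X ∪ Y) - dim n m H Y} :=
  ⟨0, by
    rintro _ ⟨Y, -, rfl⟩
    exact sub_nonneg.2 (hH.dim_mono Finset.subset_union_right)⟩

theorem Nonneg.exists_relDim (hH : Nonneg n m H) (X : Finset V) (Z : Set V) :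
    ∃ Y : Finset V, (Y : Set V) ⊆ Z ∧ relDim n m H X Z = dim n m H (X ∪ Y) - dim n m H Y :=
  Int.csInf_mem (s := {k | ∃ Y : Finset V, (Y : Set V) ⊆ Z ∧
    k = dim n m H (X ∪ Y) - dim n m H Y}) ⟨_, ∅, by simp, rfl⟩ (hH.relDim_bddBelow X Z)

theorem Nonneg.relDim_coe (hH : Nonneg n m H) (X Z : Finset V) :
    relDim n m H X Z = dim n m H (X ∪ Z) - dim n m H Z := by
  apply le_antisymm
  · exact csInf_le (hH.relDim_bddBelow X Z) ⟨Z, subset_rfl, rfl⟩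
  · obtain ⟨Y, h1, h2⟩ := hH.exists_relDim X Z
    have hY : Y ⊆ Z := Finset.coe_subset.1 h1
    have h3 := hH.dim_submod (X ∪ Y) Z
    rw [Finset.union_assoc, Finset.union_eq_right.2 hY] at h3
    have h4 : dim n m H Y ≤ dim n m H ((X ∪ Y) ∩ Z) :=
      hH.dim_mono (Finset.subset_inter Finset.subset_union_right hY)
    linarith

theorem Nonneg.mem_dcl_coe (hH : Nonneg n m H) {a : V} {Z : Finset V} :
    a ∈ dcl n m H Z ↔ dim n m H (insert a Z) = dim n m H Z := by
  change relDim n m H {a} Z = 0 ↔ _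
  rw [hH.relDim_coe, ← Finset.insert_eq, sub_eq_zero]

/-- A finite superset of no larger predimension consists of points of relative dimension zero;
conversely such a point lies in a superset realising the unchanged dimension. -/
theorem Nonneg.dclosed_iff (hH : Nonneg n m H) {Z : Finset V} :
    DClosed n m H Z ↔ Strong n m H Z := by
  constructor
  · intro h
    have key : ∀ Y, Z ⊆ Y → predim n m H Y ≤ dim n m H Z → Y ⊆ Z := by
      intro Y hY hle a ha
      rw [← Finset.mem_coe, ← h, hH.mem_dcl_coe]
      exact le_antisymm ((hH.dim_le (Finset.insert_subset ha hY)).trans hle)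
        (hH.dim_mono (Finset.subset_insert _ _))
    obtain ⟨Y, h1, h2⟩ := hH.exists_dim Z
    obtain rfl : Y = Z := (key Y h1 h2.le).antisymm h1
    intro Y' hY'
    rw [h2]
    by_contra hlt
    exact hY'.2 (key Y' hY'.1 (not_lt.1 hlt))
  · intro h
    ext a
    rw [hH.mem_dcl_coe, Finset.mem_coe]
    constructor
    · intro ha
      obtain ⟨Y, h1, h2⟩ := hH.exists_dim (insert a Z)
      rw [ha, h.dim_eq hH] at h2
      have := h.eq_of_le ((Finset.subset_insert _ _).trans h1) h2.le
      exact this ▸ h1 (Finset.mem_insert_self _ _)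
    · exact fun ha => by rw [Finset.insert_eq_of_mem ha]

/-- If `Y` is not inside `S`, then `Y ∪ S` has larger predimension than `S`, so by submodularity `Y
∩ S` has smaller predimension than `Y`. Only subsets of `S` need testing. -/
theorem Strong.of_subset {Z S : Finset V} (hS : Strong n m H S)
    (h : ∀ Y, Y ⊆ S → Z ⊂ Y → predim n m H Z < predim n m H Y) (hZS : Z ⊆ S) :
    Strong n m H Z := by
  intro Y hY
  by_cases hYS : Y ⊆ S
  · exact h Y hYS hY
  have h1 : predim n m H S < predim n m H (Y ∪ S) :=
    hS _ ⟨Finset.subset_union_right, fun h => hYS (Finset.subset_union_left.trans h)⟩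
  have h2 := predim_submod (n := n) (m := m) (H := H) Y S
  have h3 : predim n m H Z ≤ predim n m H (Y ∩ S) := by
    rcases (Finset.subset_inter hY.1 hZS).eq_or_ssubset with e | e
    · rw [e]
    · exact (h _ Finset.inter_subset_right e).le
  linarith

end Predimension

end UHypergraph

/-! ### Amalgamation and extension for finite sets in arbitrary universes. -/

namespace UHypergraph

section Extension

open Classical

variable {r n m : ℕ} {f : ℝ≥0 → ℝ≥0} {V W T : Type*} {H : UHypergraph r V} {K : UHypergraph r W}

/-- The structure induced along an injective map. -/
def pullback (K : UHypergraph r W) (g : T → W) (hg : Function.Injective g) :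
    UHypergraph r T where
  edges := {e | e.image g ∈ K.edges}
  card_eq e he := by rw [← K.card_eq _ he, Finset.card_image_of_injective e hg]

theorem locEmb_pullback (K : UHypergraph r W) {g : T → W} (hg : Function.Injective g)
    (X : Finset T) : LocEmb (K.pullback g hg) K g X :=
  ⟨hg.injOn, fun _ _ => Iff.rfl⟩

/-- The amalgamation and extension hypotheses speak of structures on types in the lowest universe;
finite sets are transported to `Fin N` to use them. -/
theorem exists_fin_param (U : Finset W) :
    ∃ (N : ℕ) (g : Fin N → W), Function.Injective g ∧ Finset.univ.image g = U := by
  refine ⟨U.card, fun i => U.equivFin.symm i, fun i j h => ?_, ?_⟩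
  · exact U.equivFin.symm.injective (Subtype.ext h)
  · ext w
    simp only [Finset.mem_image, Finset.mem_univ, true_and]
    constructor
    · rintro ⟨i, rfl⟩
      exact (U.equivFin.symm i).2
    · exact fun hw => ⟨U.equivFin ⟨w, hw⟩, by simp⟩

/-- `Z` has smaller predimension than its proper supersets in `U`. -/
def StrongIn (n m : ℕ) (K : UHypergraph r W) (Z U : Finset W) : Prop :=
  ∀ Y, Y ⊆ U → Z ⊂ Y → predim n m K Z < predim n m K Y

/-- The predimensions of the subsets of `U` are bounded from below as in the class `C_f`. -/
def FBound (n m : ℕ) (f : ℝ≥0 → ℝ≥0) (K : UHypergraph r W) (U : Finset W) : Prop :=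
  ∀ Y, Y ⊆ U → (f (Y.card : ℝ≥0) : ℝ) ≤ (predim n m K Y : ℝ)

theorem inCf_of_fBound [Finite T] {L : UHypergraph r T} {g : T → W} (hg : Function.Injective g)
    (hp : ∀ X, predim n m L X = predim n m K (X.image g)) {U : Finset W} (hU : ∀ t, g t ∈ U)
    (hb : FBound n m f K U) : InCf n m f L := by
  have key : ∀ X : Finset T, (f (X.card : ℝ≥0) : ℝ) ≤ (predim n m L X : ℝ) := by
    intro X
    have := hb (X.image g) (by
      intro w hw
      obtain ⟨t, -, rfl⟩ := Finset.mem_image.1 hw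
      exact hU t)
    rwa [Finset.card_image_of_injective X hg, ← hp] at this
  refine ⟨⟨inferInstance, fun X => ?_⟩, key⟩
  exact_mod_cast (f (X.card : ℝ≥0)).2.trans (key X)

theorem dclosed_of_strongIn [Finite T] {L : UHypergraph r T} {g : T → W}
    (hg : Function.Injective g) (hp : ∀ X, predim n m L X = predim n m K (X.image g))
    (hL : Nonneg n m L) {U Z' : Finset W} (hU : ∀ t, g t ∈ U) {Z : Set T}
    (hZ : ∀ t, t ∈ Z ↔ g t ∈ Z') (hZ' : ∀ w ∈ Z', ∃ t, g t = w) (h : StrongIn n m K Z' U) :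
    DClosed n m L Z := by
  have : Fintype T := Fintype.ofFinite T
  have e : Z'= Z.toFinset.image g := by
    ext w
    simp only [Finset.mem_image, Set.mem_toFinset]
    constructor
    · intro hw
      obtain ⟨t, rfl⟩ := hZ' w hw
      exact ⟨t, (hZ t).2 hw, rfl⟩
    · rintro ⟨t, ht, rfl⟩
      exact (hZ t).1 ht
  rw [← Set.coe_toFinset Z, hL.dclosed_iff]
  intro Y hY
  rw [hp, hp, ← e]
  refine h _ ?_ ?_
  · intro w hw
    obtain ⟨t, -, rfl⟩ := Finset.mem_image.1 hw
    exact hU t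
  · rw [e]
    exact (Finset.image_ssubset_image hg).2 hY

/-- Free amalgamation, for finite substructures of structures in any universe. -/
theorem HasFreeAmalgamation.fBound (hf : HasFreeAmalgamation r n m f) {A₁ A₂ : Finset W}
    (hfree : ∀ e ∈ K.edges, e ⊆ A₁ ∪ A₂ → e ⊆ A₁ ∨ e ⊆ A₂)
    (h₁ : FBound n m f K A₁) (h₂ : FBound n m f K A₂) (s₁ : StrongIn n m K (A₁ ∩ A₂) A₁)
    (s₂ : StrongIn n m K (A₁ ∩ A₂) A₂) : FBound n m f K (A₁ ∪ A₂) := by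
  obtain ⟨N, g, hg, hU⟩ := exists_fin_param (A₁ ∪ A₂)
  have mem : ∀ t, g t ∈ A₁ ∪ A₂ := fun t => hU ▸ Finset.mem_image_of_mem g (Finset.mem_univ t)
  have surj : ∀ w ∈ A₁ ∪ A₂, ∃ t, g t = w := fun w hw => by
    rw [← hU] at hw
    obtain ⟨t, -, ht⟩ := Finset.mem_image.1 hw
    exact ⟨t, ht⟩
  let L := K.pullback g hg
  have hp : ∀ X, predim n m L X = predim n m K (X.image g) := fun X =>
    (locEmb_pullback K hg X).predim_image.symm
  have side : ∀ A : Finset W, A ⊆ A₁ ∪ A₂ → FBound n m f K A → StrongIn n m K (A₁ ∩ A₂) A →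
      A₁ ∩ A₂ ⊆ A → InCf n m f (L.induce {t | g t ∈ A}) ∧
        DClosed n m (L.induce {t | g t ∈ A})
          (Subtype.val ⁻¹' ({t | g t ∈ A₁} ∩ {t | g t ∈ A₂})) := by
    intro A hA hb hs hi
    have inj : Function.Injective (fun t : {t | g t ∈ A} => g t.1) :=
      hg.comp Subtype.val_injective
    have hp' : ∀ X, predim n m (L.induce {t | g t ∈ A}) X =
        predim n m K (X.image fun t : {t | g t ∈ A} => g t.1) := fun X => by
      rw [predim_induce, hp]
      congr 1
      ext w
      simp
    have hin := inCf_of_fBound inj hp' (fun t => t.2) hb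
    refine ⟨hin, dclosed_of_strongIn inj hp' hin.1.2 (fun t => t.2) (Z' := A₁ ∩ A₂) ?_ ?_ hs⟩
    · intro t
      simp
    · intro w hw
      obtain ⟨t, rfl⟩ := surj w (hA (hi hw))
      exact ⟨⟨t, hi hw⟩, rfl⟩
  obtain ⟨i₁, d₁⟩ := side A₁ Finset.subset_union_left h₁ s₁ Finset.inter_subset_left
  obtain ⟨i₂, d₂⟩ := side A₂ Finset.subset_union_right h₂ s₂ Finset.inter_subset_right
  have am := hf (Fin N) L {t | g t ∈ A₁} {t | g t ∈ A₂} ⟨?_, ?_⟩ i₁ i₂ d₁ d₂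
  · intro Y hY
    have hYg : (Finset.univ.filter (g · ∈ Y)).image g = Y := image_filter_mem (hU ▸ hY)
    have := am.1.2 (Finset.univ.filter (g · ∈ Y))
    rwa [hp, ← Finset.card_image_of_injective _ hg, hYg] at this
  · ext t
    simpa using mem t
  · intro e he
    have h' : e.image g ⊆ A₁ ∪ A₂ := by
      intro w hw
      obtain ⟨t, -, rfl⟩ := Finset.mem_image.1 hw
      exact mem t
    refine (hfree _ he h').imp (fun h t ht => ?_) fun h t ht => ?_
    · exact h (Finset.mem_image_of_mem g ht)
    · exact h (Finset.mem_image_of_mem g ht)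

namespace IsGeneric

theorem fBound (hgen : IsGeneric n m f H) (X : Finset V) :
    (f (X.card : ℝ≥0) : ℝ) ≤ (predim n m H X : ℝ) := by
  have h := (hgen.age X X.finite_toSet).2 Finset.univ
  have e : (Finset.univ : Finset (X : Set V)).image Subtype.val = X := by
    ext x
    simp
  rwa [predim_induce, ← Finset.card_image_of_injective _ Subtype.val_injective, e] at h

theorem nonneg (hgen : IsGeneric n m f H) : Nonneg n m H := fun X => by
  exact_mod_cast (f (X.card : ℝ≥0)).2.trans (hgen.fBound X)

/-- The extension property, for finite substructures of structures in any universe. -/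
theorem exists_locEmb [Nonempty V] (hgen : IsGeneric n m f H) {X : Finset V}
    (hX : Strong n m H X) {U : Finset W} (hU : FBound n m f K U) {ι : V → W}
    (hι : LocEmb H K ι X) (hιU : X.image ι ⊆ U) (hs : StrongIn n m K (X.image ι) U) :
    ∃ φ : W → V, LocEmb K H φ U ∧ Strong n m H (U.image φ) ∧ ∀ x ∈ X, φ (ι x) = x := by
  obtain ⟨N, g, hg, rfl⟩ := exists_fin_param U
  let L := K.pullback g hg
  have hp : ∀ X, predim n m L X = predim n m K (X.image g) := fun X =>
    (locEmb_pullback K hg X).predim_image.symm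
  have mem : ∀ t, g t ∈ Finset.univ.image g :=
    fun t => Finset.mem_image_of_mem g (Finset.mem_univ t)
  have hL : InCf n m f L := inCf_of_fBound hg hp mem hU
  have ex : ∀ x : (X : Set V), ∃ t, g t = ι x := fun x => by
    obtain ⟨t, -, ht⟩ := Finset.mem_image.1 (hιU (Finset.mem_image_of_mem ι x.2))
    exact ⟨t, ht⟩
  choose j hj using ex
  let ι' : (X : Set V) ↪ Fin N := ⟨j, fun x y h => Subtype.ext (hι.inj x.2 y.2 (by
    rw [← hj, ← hj, h]))⟩
  have hemb : (H.induce (X : Set V)).IsEmb L ι' := by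
    intro e
    change e.map (Function.Embedding.subtype (· ∈ (X : Set V))) ∈ H.edges ↔
      (e.map ι').image g ∈ K.edges
    rw [hι.iff]
    · rw [Finset.map_eq_image, Finset.map_eq_image, Finset.image_image, Finset.image_image]
      have : g ∘ ι' = ι ∘ (Function.Embedding.subtype (· ∈ (X : Set V))) :=
        funext fun x => hj x
      rw [this]
    · intro x hx
      obtain ⟨y, -, rfl⟩ := Finset.mem_map.1 hx
      exact y.2
  have hcl : DClosed n m L (Set.range ι') := by
    refine dclosed_of_strongIn hg hp hL.1.2 mem (Z' := X.image ι) (fun t => ?_) ?_ hs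
    · constructor
      · rintro ⟨x, rfl⟩
        exact Finset.mem_image.2 ⟨x, x.2, (hj x).symm⟩
      · intro h
        obtain ⟨x, hx, hxt⟩ := Finset.mem_image.1 h
        exact ⟨⟨x, hx⟩, hg ((hj _).trans hxt)⟩
    · intro w hw
      obtain ⟨x, hx, rfl⟩ := Finset.mem_image.1 hw
      exact ⟨j ⟨x, hx⟩, hj _⟩
  obtain ⟨φ', h1, h2, h3⟩ := hgen.extension X X.finite_toSet (hgen.nonneg.dclosed_iff.2 hX)
    (Fin N) L hL ι' hemb hcl
  let φ : W → V := Function.extend g φ' fun _ => Classical.arbitrary V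
  have hφ : ∀ t, φ (g t) = φ' t := fun t => hg.extend_apply _ _ _
  have himg : ∀ e : Finset (Fin N), (e.image g).image φ = e.map φ' := fun e => by
    rw [Finset.image_image, Finset.map_eq_image]
    exact Finset.image_congr fun t _ => hφ t
  refine ⟨φ, ⟨?_, ?_⟩, ?_, ?_⟩
  · intro w hw w' hw' hww
    obtain ⟨t, -, rfl⟩ := Finset.mem_image.1 (Finset.mem_coe.1 hw)
    obtain ⟨t', -, rfl⟩ := Finset.mem_image.1 (Finset.mem_coe.1 hw')
    rw [hφ, hφ] at hww
    rw [φ'.injective hww]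
  · intro e he
    have e' := image_filter_mem he
    rw [← e', himg, ← h1]
    rfl
  · rw [himg, ← hgen.nonneg.dclosed_iff]
    convert h2
    ext x
    simp
  · intro x hx
    rw [← hj ⟨x, hx⟩, hφ]
    exact h3 ⟨x, hx⟩

end IsGeneric

end Extension

end UHypergraph

/-! ### Closures and homogeneity of the generic structure. -/

namespace UHypergraph

section Homogeneity

open Classical

variable {r n m : ℕ} {f : ℝ≥0 → ℝ≥0} {V : Type*} {H : UHypergraph r V}

/-- The set `Y ∩ S` contains `X`, so its predimension is at least that of `Y`; submodularity then
bounds that of `Y ∪ S` by that of `S`, and strength gives `Y ∪ S = S`. -/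
theorem Strong.subset_of_predim_le (hH : Nonneg n m H) {X Y S : Finset V} (hS : Strong n m H S)
    (hXS : X ⊆ S) (hXY : X ⊆ Y) (hY : predim n m H Y ≤ dim n m H X) : Y ⊆ S := by
  have h1 := predim_submod (n := n) (m := m) (H := H) Y S
  have h2 := hH.dim_le (Finset.subset_inter hXY hXS)
  have h3 := hS.eq_of_le (Y := Y ∪ S) Finset.subset_union_right (by linarith)
  exact Finset.union_eq_right.1 h3

namespace IsGeneric

theorem exists_strong_superset (hgen : IsGeneric n m f H) (X : Finset V) :
    ∃ S, X ⊆ S ∧ Strong n m H S := by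
  obtain ⟨S, hmono, hS, hU⟩ := hgen.chain
  have : ∀ x, ∃ i, x ∈ S i := fun x => Set.mem_iUnion.1 (hU ▸ Set.mem_univ x)
  choose i hi using this
  refine ⟨(hS (X.sup i)).1.toFinset, fun x hx => ?_, ?_⟩
  · rw [Set.Finite.mem_toFinset]
    exact hmono (Finset.le_sup hx) (hi x)
  · rw [← hgen.nonneg.dclosed_iff, Set.Finite.coe_toFinset]
    exact (hS _).2

/-- All sets realising the dimension of `X` lie in one finite strong set, so one of maximal size
exists, and maximality makes it strong. -/
theorem exists_closure (hgen : IsGeneric n m f H) (X : Finset V) :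
    ∃ Y, X ⊆ Y ∧ Strong n m H Y ∧ predim n m H Y = dim n m H X := by
  obtain ⟨S, hXS, hS⟩ := hgen.exists_strong_superset X
  obtain ⟨Y₀, h1, h2⟩ := hgen.nonneg.exists_dim X
  have sub : ∀ Y, X ⊆ Y → predim n m H Y = dim n m H X → Y ⊆ S := fun Y hY e =>
    hS.subset_of_predim_le hgen.nonneg hXS hY e.le
  obtain ⟨Y, hY, hmax⟩ := Finset.exists_max_image
    (S.powerset.filter fun Y => X ⊆ Y ∧ predim n m H Y = dim n m H X) Finset.card
    ⟨Y₀, by simp [h1, h2, sub Y₀ h1 h2]⟩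
  simp only [Finset.mem_filter, Finset.mem_powerset] at hY hmax
  refine ⟨Y, hY.2.1, fun Y' hY' => ?_, hY.2.2⟩
  by_contra hlt
  have hX' := hY.2.1.trans hY'.1
  have e : predim n m H Y' = dim n m H X :=
    le_antisymm (hY.2.2 ▸ not_lt.1 hlt) (hgen.nonneg.dim_le hX')
  exact absurd (hmax Y' ⟨sub Y' hX' e, hX', e⟩) (not_le.2 (Finset.card_lt_card hY'))

/-- The closure of a finite set. -/
noncomputable def clos (hgen : IsGeneric n m f H) (X : Finset V) : Finset V :=
  (hgen.exists_closure X).choose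

variable (hgen : IsGeneric n m f H)

theorem subset_clos (X : Finset V) : X ⊆ hgen.clos X := (hgen.exists_closure X).choose_spec.1

theorem strong_clos (X : Finset V) : Strong n m H (hgen.clos X) :=
  (hgen.exists_closure X).choose_spec.2.1

theorem predim_clos (X : Finset V) : predim n m H (hgen.clos X) = dim n m H X :=
  (hgen.exists_closure X).choose_spec.2.2

theorem clos_subset {X S : Finset V} (hS : Strong n m H S) (h : X ⊆ S) : hgen.clos X ⊆ S :=
  hS.subset_of_predim_le hgen.nonneg h (hgen.subset_clos X) (hgen.predim_clos X).le

theorem clos_eq {S : Finset V} (hS : Strong n m H S) : hgen.clos S = S :=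
  (hgen.clos_subset hS subset_rfl).antisymm (hgen.subset_clos S)

theorem strong_of_clos_eq {S : Finset V} (hS : hgen.clos S = S) : Strong n m H S :=
  hS ▸ hgen.strong_clos S

theorem clos_mono {X Y : Finset V} (h : X ⊆ Y) : hgen.clos X ⊆ hgen.clos Y :=
  hgen.clos_subset (hgen.strong_clos Y) (h.trans (hgen.subset_clos Y))

theorem dim_clos (X : Finset V) : dim n m H (hgen.clos X) = dim n m H X := by
  rw [(hgen.strong_clos X).dim_eq hgen.nonneg, hgen.predim_clos]

theorem mem_clos_iff {x : V} {X : Finset V} :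
    x ∈ hgen.clos X ↔ dim n m H (insert x X) = dim n m H X := by
  constructor
  · intro h
    refine le_antisymm ?_ (hgen.nonneg.dim_mono (Finset.subset_insert _ _))
    rw [← hgen.dim_clos X]
    exact hgen.nonneg.dim_mono (Finset.insert_subset h (hgen.subset_clos X))
  · intro h
    obtain ⟨Y, h1, h2⟩ := hgen.nonneg.exists_dim (insert x X)
    rw [h] at h2
    have := (hgen.strong_clos X).subset_of_predim_le hgen.nonneg (hgen.subset_clos X)
      ((Finset.subset_insert _ _).trans h1) h2.le
    exact this (h1 (Finset.mem_insert_self _ _))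

theorem coe_clos (X : Finset V) : (hgen.clos X : Set V) = dcl n m H X := by
  ext x
  rw [Finset.mem_coe, hgen.mem_clos_iff, hgen.nonneg.mem_dcl_coe]

end IsGeneric

theorem locEmb_smul (σ : H.Aut) (X : Finset V) : LocEmb H H (σ • ·) X := by
  refine ⟨(MulAction.injective σ).injOn, fun e _ => ?_⟩
  have := σ.2 e
  rw [this, Finset.map_eq_image]
  rfl

theorem smul_mem_edges_iff (σ : H.Aut) (e : Finset V) : σ • e ∈ H.edges ↔ e ∈ H.edges :=
  ((locEmb_smul σ e).iff e subset_rfl).symm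

theorem predim_smul (σ : H.Aut) (X : Finset V) : predim n m H (σ • X) = predim n m H X :=
  (locEmb_smul σ X).predim_image

theorem Strong.smul {X : Finset V} (hX : Strong n m H X) (σ : H.Aut) : Strong n m H (σ • X) := by
  intro Y hY
  rw [predim_smul, ← predim_smul σ⁻¹ Y]
  refine hX _ ?_
  rw [← inv_smul_smul σ X]
  exact ⟨Finset.smul_finset_subset_smul_finset hY.1,
    fun h => hY.2 (Finset.smul_finset_subset_smul_finset_iff.1 h)⟩

theorem exists_aut_limit (u : ℕ → V → V) (F : ℕ → Finset V) (hF : Monotone F)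
    (hu : ∀ k, ∀ x ∈ F k, u (k + 1) x = u k x) (hemb : ∀ k, LocEmb H H (u k) (F k))
    (hcov : ∀ x, ∃ k, x ∈ F k) (hsurj : ∀ y, ∃ k, ∃ x ∈ F k, u k x = y) :
    ∃ σ : H.Aut, ∀ k, ∀ x ∈ F k, σ • x = u k x := by
  have agree : ∀ k l, k ≤ l → ∀ x ∈ F k, u l x = u k x := by
    intro k l hkl
    induction l, hkl using Nat.le_induction with
    | base => exact fun _ _ => rfl
    | succ l hkl ih => exact fun x hx => by rw [hu l x (hF hkl hx), ih x hx]
  choose κ hκ using hcov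
  let v : V → V := fun x => u (κ x) x
  have hv : ∀ k, ∀ x ∈ F k, v x = u k x := by
    intro k x hx
    rcases le_total k (κ x) with h | h
    · exact agree k _ h x hx
    · exact (agree _ k h x (hκ x)).symm
  have fin : ∀ e : Finset V, ∃ k, e ⊆ F k := fun e =>
    ⟨e.sup κ, fun x hx => hF (Finset.le_sup hx) (hκ x)⟩
  have inj : Function.Injective v := by
    intro x y hxy
    obtain ⟨k, hk⟩ := fin {x, y}
    have hx : x ∈ F k := hk (by simp)
    have hy : y ∈ F k := hk (by simp)
    rw [hv k x hx, hv k y hy] at hxy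
    exact (hemb k).inj hx hy hxy
  have surj : Function.Surjective v := by
    intro y
    obtain ⟨k, x, hx, rfl⟩ := hsurj y
    exact ⟨x, hv k x hx⟩
  refine ⟨⟨Equiv.ofBijective v ⟨inj, surj⟩, fun e => ?_⟩, hv⟩
  obtain ⟨k, hk⟩ := fin e
  have hc : e.image (Equiv.ofBijective v ⟨inj, surj⟩).toEmbedding = e.image (u k) :=
    Finset.image_congr fun x hx => hv k x (hk hx)
  rw [(hemb k).iff e hk, Finset.map_eq_image, hc]

theorem LocEmb.inv {p q : V → V} {X : Finset V} (h : LocEmb H H p X)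
    (hq : ∀ x ∈ X, q (p x) = x) : LocEmb H H q (X.image p) := by
  refine ⟨?_, fun e he => ?_⟩
  · intro y hy y' hy' hyy
    obtain ⟨x, hx, rfl⟩ := Finset.mem_image.1 (Finset.mem_coe.1 hy)
    obtain ⟨x', hx', rfl⟩ := Finset.mem_image.1 (Finset.mem_coe.1 hy')
    rw [hq x hx, hq x' hx'] at hyy
    rw [hyy]
  · rw [← image_filter_mem he, ← h.iff _ (Finset.filter_subset _ _), Finset.image_image,
      Finset.image_congr (g := id), Finset.image_id]
    exact fun x hx => hq x (Finset.filter_subset _ _ hx)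

theorem image_image_inv {W : Type*} {p : V → W} {q : W → V} {X : Finset V}
    (hq : ∀ x ∈ X, q (p x) = x) :
    (X.image p).image q = X := by
  rw [Finset.image_image, Finset.image_congr (g := id), Finset.image_id]
  exact fun x hx => hq x hx

namespace IsGeneric

/-- One step of the back-and-forth argument. -/
theorem exists_extend (hgen : IsGeneric n m f H) {p : V → V} {X : Finset V}
    (hp : LocEmb H H p X) (hX' : Strong n m H (X.image p)) (hX : Strong n m H X) (y : V) :
    ∃ (p' : V → V) (X' : Finset V), X ⊆ X' ∧ y ∈ X' ∧ (∀ x ∈ X, p' x = p x) ∧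
      LocEmb H H p' X' ∧ Strong n m H X' ∧ Strong n m H (X'.image p') := by
  have : Nonempty V := ⟨y⟩
  set q := Function.invFunOn p X with hq
  have hqp : ∀ x ∈ X, q (p x) = x := fun x hx => hp.inj.leftInvOn_invFunOn hx
  have hXX : X ⊆ hgen.clos (insert y X) := (Finset.subset_insert _ _).trans (hgen.subset_clos _)
  -- The structure itself serves as the extension: the strong set `X.image p` is embedded in the
  -- closure of `insert y X` by the inverse of `p`, and the resulting map over it extends `p`.
  obtain ⟨φ, h1, h2, h3⟩ := hgen.exists_locEmb hX' (U := hgen.clos (insert y X)) (K := H)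
    (fun Y _ => hgen.fBound Y) (hp.inv hqp) (by rwa [image_image_inv hqp])
    (by rw [image_image_inv hqp]; exact fun Y _ hY => hX Y hY)
  refine ⟨φ, _, hXX, hgen.subset_clos _ (Finset.mem_insert_self _ _), fun x hx => ?_, h1,
    hgen.strong_clos _, h2⟩
  have := h3 (p x) (Finset.mem_image_of_mem p hx)
  rwa [hqp x hx] at this

/-- The range is extended by applying the domain step to the inverse partial map and inverting
again. -/
theorem exists_extend_range (hgen : IsGeneric n m f H) {p : V → V} {X : Finset V}
    (hp : LocEmb H H p X) (hX' : Strong n m H (X.image p)) (hX : Strong n m H X) (y : V) :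
    ∃ (p' : V → V) (X' : Finset V), X ⊆ X' ∧ y ∈ X'.image p' ∧ (∀ x ∈ X, p' x = p x) ∧
      LocEmb H H p' X' ∧ Strong n m H X' ∧ Strong n m H (X'.image p') := by
  have : Nonempty V := ⟨y⟩
  have hqp : ∀ x ∈ X, Function.invFunOn p X (p x) = x := fun x hx => hp.inj.leftInvOn_invFunOn hx
  obtain ⟨q', Y, h1, h2, h3, h4, h5, h6⟩ := hgen.exists_extend (hp.inv hqp)
    (by rwa [image_image_inv hqp]) hX' y
  have hpq : ∀ x ∈ Y, Function.invFunOn q' Y (q' x) = x :=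
    fun x hx => h4.inj.leftInvOn_invFunOn hx
  have key : ∀ x ∈ X, q' (p x) = x := fun x hx => by
    rw [h3 _ (Finset.mem_image_of_mem p hx), hqp x hx]
  refine ⟨Function.invFunOn q' Y, Y.image q', fun x hx => ?_, ?_, fun x hx => ?_, h4.inv hpq, h6,
    ?_⟩
  · exact Finset.mem_image.2 ⟨p x, h1 (Finset.mem_image_of_mem p hx), key x hx⟩
  · rwa [image_image_inv hpq]
  · have := hpq (p x) (h1 (Finset.mem_image_of_mem p hx))
    rwa [key x hx] at this
  · rwa [image_image_inv hpq]

/-- Isomorphisms between finite strong substructures extend to automorphisms. -/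
theorem exists_aut (hgen : IsGeneric n m f H) {p : V → V} {X : Finset V}
    (hp : LocEmb H H p X) (hX : Strong n m H X) (hX' : Strong n m H (X.image p)) :
    ∃ σ : H.Aut, ∀ x ∈ X, σ • x = p x := by
  rcases isEmpty_or_nonempty V with hV | hV
  · exact ⟨1, fun x => hV.elim x⟩
  have := hgen.countable
  obtain ⟨y, hy⟩ := exists_surjective_nat V
  let St := {s : (V → V) × Finset V // LocEmb H H s.1 s.2 ∧ Strong n m H s.2 ∧
    Strong n m H (s.2.image s.1)}
  have step : ∀ (s : St) (y : V), ∃ s' : St, s.1.2 ⊆ s'.1.2 ∧ (∀ x ∈ s.1.2, s'.1.1 x = s.1.1 x) ∧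
      y ∈ s'.1.2 ∧ y ∈ s'.1.2.image s'.1.1 := by
    rintro ⟨⟨p, X⟩, hp, hX, hX'⟩ y
    obtain ⟨p₁, X₁, a1, a2, a3, a4, a5, a6⟩ := hgen.exists_extend hp hX' hX y
    obtain ⟨p₂, X₂, b1, b2, b3, b4, b5, b6⟩ := hgen.exists_extend_range a4 a6 a5 y
    exact ⟨⟨⟨p₂, X₂⟩, b4, b5, b6⟩, a1.trans b1, fun x hx => (b3 x (a1 hx)).trans (a3 x hx),
      b1 a2, b2⟩
  choose next n1 n2 n3 n4 using step
  let st : ℕ → St := fun j => Nat.rec ⟨(p, X), hp, hX, hX'⟩ (fun i s => next s (y i)) j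
  obtain ⟨σ, hσ⟩ := exists_aut_limit (H := H) (fun j => (st j).1.1) (fun j => (st j).1.2)
    (monotone_nat_of_le_succ fun j => n1 _ _) (fun j => n2 _ _) (fun j => (st j).2.1)
    (fun x => by
      obtain ⟨j, rfl⟩ := hy x
      exact ⟨j + 1, n3 _ _⟩)
    (fun x => by
      obtain ⟨j, rfl⟩ := hy x
      obtain ⟨z, hz, e⟩ := Finset.mem_image.1 (n4 (st j) (y j))
      exact ⟨j + 1, z, hz, e⟩)
  exact ⟨σ, hσ 0⟩

theorem smul_clos (hgen : IsGeneric n m f H) (σ : H.Aut) (X : Finset V) :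
    σ • hgen.clos X = hgen.clos (σ • X) := by
  have key : ∀ (σ : H.Aut) X, hgen.clos (σ • X) ⊆ σ • hgen.clos X := fun σ X =>
    hgen.clos_subset ((hgen.strong_clos X).smul σ)
      (Finset.smul_finset_subset_smul_finset (hgen.subset_clos X))
  refine subset_antisymm ?_ (key σ X)
  have := Finset.smul_finset_subset_smul_finset (a := σ) (key σ⁻¹ (σ • X))
  rwa [inv_smul_smul, smul_inv_smul] at this

theorem dim_smul (hgen : IsGeneric n m f H) (σ : H.Aut) (X : Finset V) :
    dim n m H (σ • X) = dim n m H X := by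
  rw [← hgen.predim_clos, ← hgen.smul_clos, predim_smul, hgen.predim_clos]

end IsGeneric

end Homogeneity

end UHypergraph

/-! ### Free amalgams inside the generic structure. -/

namespace UHypergraph

section Free

open Classical

variable {r n m : ℕ} {f : ℝ≥0 → ℝ≥0} {V W T : Type*} {H : UHypergraph r V}
  {K : UHypergraph r W} {L : UHypergraph r T}

theorem LocEmb.comp {φ : T → W} {ψ : W → V} {X : Finset T} (hψ : LocEmb K H ψ (X.image φ))
    (hφ : LocEmb L K φ X) : LocEmb L H (ψ ∘ φ) X := by
  refine ⟨fun x hx y hy hxy => hφ.inj hx hy (hψ.inj ?_ ?_ hxy), fun e he => ?_⟩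
  · exact Finset.mem_coe.2 (Finset.mem_image_of_mem φ hx)
  · exact Finset.mem_coe.2 (Finset.mem_image_of_mem φ hy)
  · rw [hφ.iff e he, hψ.iff _ (Finset.image_subset_image he), Finset.image_image]

theorem LocEmb.ssubset_image {φ : W → V} {U Y Z : Finset W} (hφ : LocEmb K H φ U) (hY : Y ⊆ U)
    (h : Z ⊂ Y) : Z.image φ ⊂ Y.image φ := by
  refine ⟨Finset.image_subset_image h.1, fun h' => h.2 fun y hy => ?_⟩
  obtain ⟨z, hz, e⟩ := Finset.mem_image.1 (h' (Finset.mem_image_of_mem φ hy))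
  rwa [← hφ.inj (hY (h.1 hz)) (hY hy) e]

theorem LocEmb.strong_image {φ : W → V} {U Z : Finset W} (hφ : LocEmb K H φ U)
    (hU : Strong n m H (U.image φ)) (hZU : Z ⊆ U) (hZ : StrongIn n m K Z U) :
    Strong n m H (Z.image φ) := by
  refine hU.of_subset (fun Y hY hZY => ?_) (Finset.image_subset_image hZU)
  have e := image_filter_mem hY
  rw [← e, (hφ.mono (Finset.filter_subset _ _)).predim_image, (hφ.mono hZU).predim_image]
  refine hZ _ (Finset.filter_subset _ _) ⟨fun z hz => ?_, fun h => hZY.2 ?_⟩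
  · exact Finset.mem_filter.2 ⟨hZU hz, hZY.1 (Finset.mem_image_of_mem φ hz)⟩
  · rw [← e]
    exact Finset.image_subset_image h

/-- The set `P ∪ Q` is strong, and is the free amalgam of `P` and `Q` over `B`. -/
structure FreeOver (n m : ℕ) (H : UHypergraph r V) (P Q B : Finset V) : Prop where
  inter : P ∩ Q = B
  strong : Strong n m H (P ∪ Q)
  free : ∀ e ∈ H.edges, e ⊆ P ∪ Q → e ⊆ P ∨ e ⊆ Q

namespace FreeOver

variable {P Q B : Finset V}

theorem symm (h : FreeOver n m H P Q B) : FreeOver n m H Q P B :=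
  ⟨by rw [Finset.inter_comm, h.inter], by rw [Finset.union_comm]; exact h.strong,
    fun e he hs => (h.free e he (by rwa [Finset.union_comm])).symm⟩

theorem subset_left (h : FreeOver n m H P Q B) : B ⊆ P := h.inter ▸ Finset.inter_subset_left

theorem subset_right (h : FreeOver n m H P Q B) : B ⊆ Q := h.inter ▸ Finset.inter_subset_right

theorem predim_add (h : FreeOver n m H P Q B) :
    predim n m H (P ∪ Q) + predim n m H B = predim n m H P + predim n m H Q := by
  rw [← h.inter]
  exact predim_free h.free

/-- The predimension of a subset of a free amalgam. -/
theorem predim_inter_add (h : FreeOver n m H P Q B) {Y : Finset V} (hY : Y ⊆ P ∪ Q) :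
    predim n m H Y + predim n m H (Y ∩ B) = predim n m H (Y ∩ P) + predim n m H (Y ∩ Q) := by
  have e1 : Y = Y ∩ P ∪ Y ∩ Q := by
    rw [← Finset.inter_union_distrib_left, Finset.inter_eq_left.2 hY]
  have e2 : Y ∩ B = Y ∩ P ∩ (Y ∩ Q) := by
    rw [← h.inter]
    ext x
    simp only [Finset.mem_inter]
    tauto
  rw [e2]
  nth_rewrite 1 [e1]
  refine predim_free fun e he hs => ?_
  rw [← e1] at hs
  exact (h.free e he (hs.trans hY)).imp (fun h => Finset.subset_inter hs h)
    fun h => Finset.subset_inter hs h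

theorem smul (h : FreeOver n m H P Q B) (σ : H.Aut) :
    FreeOver n m H (σ • P) (σ • Q) (σ • B) := by
  refine ⟨by rw [← Finset.smul_finset_inter, h.inter], ?_, fun e he hs => ?_⟩
  · rw [← Finset.smul_finset_union]
    exact h.strong.smul σ
  · have := h.free (σ⁻¹ • e) ((smul_mem_edges_iff _ _).2 he) (by
      rwa [← Finset.smul_finset_subset_smul_finset_iff (a := σ), smul_inv_smul,
        Finset.smul_finset_union])
    rwa [← Finset.smul_finset_subset_smul_finset_iff (a := σ), smul_inv_smul,
      ← Finset.smul_finset_subset_smul_finset_iff (a := σ) (t := Q), smul_inv_smul] at this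

/-- For `Y` between `P ∪ Q'` and `P ∪ Q`, additivity reduces the comparison with `P ∪ Q'` to that of
`Y ∩ Q` with the strong set `Q'`. -/
theorem mono_right (h : FreeOver n m H P Q B) {Q' : Finset V} (hQ' : Strong n m H Q')
    (hB : B ⊆ Q') (hQ : Q' ⊆ Q) : FreeOver n m H P Q' B := by
  have free : ∀ e ∈ H.edges, e ⊆ P ∪ Q' → e ⊆ P ∨ e ⊆ Q' := by
    intro e he hs
    refine (h.free e he (hs.trans (Finset.union_subset_union_right hQ))).imp_right
      fun heQ x hx => ?_
    rcases Finset.mem_union.1 (hs hx) with hP | hQ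
    · exact hB (h.inter ▸ Finset.mem_inter.2 ⟨hP, heQ hx⟩)
    · exact hQ
  have inter : P ∩ Q' = B := by
    refine subset_antisymm ?_ (Finset.subset_inter h.subset_left hB)
    rw [← h.inter]
    exact Finset.inter_subset_inter_left hQ
  refine ⟨inter, h.strong.of_subset (fun Y hY hlt => ?_) (Finset.union_subset_union_right hQ),
    free⟩
  have e1 := predim_free (n := n) (m := m) free
  have e2 := h.predim_inter_add hY
  have hPY : P ⊆ Y := Finset.subset_union_left.trans hlt.1
  have hQY : Q' ⊆ Y := Finset.subset_union_right.trans hlt.1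
  rw [Finset.inter_eq_right.2 hPY, Finset.inter_eq_right.2 (h.subset_left.trans hPY)] at e2
  rw [inter] at e1
  have : predim n m H Q' < predim n m H (Y ∩ Q) := by
    refine hQ' _ ⟨Finset.subset_inter hQY hQ, fun h' => hlt.2 fun y hy => ?_⟩
    rcases Finset.mem_union.1 (hY hy) with hP | hQ
    · exact Finset.mem_union_left _ hP
    · exact Finset.mem_union_right _ (h' (Finset.mem_inter.2 ⟨hy, hQ⟩))
  linarith

theorem trans (h : FreeOver n m H P Q B) {Q₁ : Finset V} (h' : FreeOver n m H (P ∪ Q) Q₁ Q) :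
    FreeOver n m H P Q₁ B := by
  have e : P ∪ Q ∪ Q₁ = P ∪ Q₁ := by
    rw [Finset.union_assoc, Finset.union_eq_right.2 h'.subset_right]
  refine ⟨subset_antisymm ?_ ?_, e ▸ h'.strong, fun x hx hs => ?_⟩
  · rw [← h.inter, ← h'.inter]
    intro x hx
    simp only [Finset.mem_inter, Finset.mem_union] at hx ⊢
    tauto
  · exact Finset.subset_inter h.subset_left (h.subset_right.trans h'.subset_right)
  · rcases h'.free x hx (e ▸ hs) with h1 | h1
    · exact (h.free x hx h1).imp_right fun h2 => h2.trans h'.subset_right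
    · exact Or.inr h1

/-- Independence in the sense of the dimension from a common set, relative to which two sets are
freely amalgamated, implies that these two sets are freely amalgamated. -/
theorem of_dim (hH : Nonneg n m H) {A E D : Finset V} (h : FreeOver n m H P Q B)
    (hA : Strong n m H A) (hE : Strong n m H E) (hD : Strong n m H D) (hB : Strong n m H B)
    (hDA : D ⊆ A) (hDE : D ⊆ E) (hDB : D ⊆ B) (hAP : A ⊆ P) (hEQ : E ⊆ Q)
    (dA : dim n m H (A ∪ B) + predim n m H D = predim n m H A + predim n m H B)
    (dE : dim n m H (E ∪ B) + predim n m H D = predim n m H E + predim n m H B) :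
    FreeOver n m H A E D := by
  -- The dimension equation and submodularity give `A ∩ B` predimension at most that of `D`, and `D`
  -- is strong.
  have inter : ∀ A, D ⊆ A →
      dim n m H (A ∪ B) + predim n m H D = predim n m H A + predim n m H B → A ∩ B = D := by
    intro A hDA dA
    have h1 := hH.dim_le (X := A ∪ B) subset_rfl
    have h2 := predim_submod (n := n) (m := m) (H := H) A B
    exact hD.eq_of_le (Finset.subset_inter hDA hDB) (by linarith)
  have iA := inter A hDA dA
  have iE := inter E hDE dE
  have AE : A ∩ E = D := by
    refine subset_antisymm (fun x hx => ?_) (Finset.subset_inter hDA hDE)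
    obtain ⟨h1, h2⟩ := Finset.mem_inter.1 hx
    have : x ∈ B := h.inter ▸ Finset.mem_inter.2 ⟨hAP h1, hEQ h2⟩
    exact iA ▸ Finset.mem_inter.2 ⟨h1, this⟩
  have free : ∀ e ∈ H.edges, e ⊆ A ∪ E → e ⊆ A ∨ e ⊆ E := by
    intro e he hs
    refine (h.free e he (hs.trans (Finset.union_subset_union hAP hEQ))).imp
      (fun hP x hx => ?_) fun hQ x hx => ?_
    · rcases Finset.mem_union.1 (hs hx) with h1 | h1
      · exact h1
      · exact hDA (iE ▸ Finset.mem_inter.2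
          ⟨h1, h.inter ▸ Finset.mem_inter.2 ⟨hP hx, hEQ h1⟩⟩)
    · rcases Finset.mem_union.1 (hs hx) with h1 | h1
      · exact hDE (iA ▸ Finset.mem_inter.2
          ⟨h1, h.inter ▸ Finset.mem_inter.2 ⟨hAP h1, hQ hx⟩⟩)
      · exact h1
  refine ⟨AE, h.strong.of_subset (fun Y hY hlt => ?_) (Finset.union_subset_union hAP hEQ), free⟩
  have e1 := predim_free (n := n) (m := m) free
  rw [AE] at e1
  have e2 := h.predim_inter_add hY
  have hAY : A ⊆ Y := Finset.subset_union_left.trans hlt.1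
  have hEY : E ⊆ Y := Finset.subset_union_right.trans hlt.1
  -- Here `Z ⊆ B` realises the dimension of `Y ∩ B`. Submodularity of `dim` transfers the dimension
  -- equation from `B` to `Z`, and that of `predim` compares `Y ∩ P` with `Z`.
  have bound : ∀ A P, Strong n m H A → D ⊆ A → A ⊆ Y → A ⊆ P → B ⊆ P →
      dim n m H (A ∪ B) + predim n m H D = predim n m H A + predim n m H B →
      predim n m H A + predim n m H (Y ∩ B) ≤ predim n m H (Y ∩ P) + predim n m H D := by
    intro A P hA hDA hAY hAP hBP dA
    obtain ⟨Z, hZ1, hZ2⟩ := hH.exists_dim (Y ∩ B)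
    have hZB : Z ⊆ B := hB.subset_of_predim_le hH Finset.inter_subset_right hZ1 hZ2.le
    have s1 := predim_submod (n := n) (m := m) (H := H) (Y ∩ P) Z
    have i1 : Y ∩ P ∩ Z = Y ∩ B := by
      refine subset_antisymm (fun x hx => ?_) fun x hx => ?_
      · simp only [Finset.mem_inter] at hx ⊢
        exact ⟨hx.1.1, hZB hx.2⟩
      · have hx' := Finset.mem_inter.1 hx
        exact Finset.mem_inter.2 ⟨Finset.mem_inter.2 ⟨hx'.1, hBP hx'.2⟩, hZ1 hx⟩
    rw [i1] at s1
    have s2 := hH.dim_submod (A ∪ Z) B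
    have u1 : A ∪ Z ∪ B = A ∪ B := by rw [Finset.union_assoc, Finset.union_eq_right.2 hZB]
    have s3 : dim n m H Z ≤ dim n m H ((A ∪ Z) ∩ B) :=
      hH.dim_mono (Finset.subset_inter Finset.subset_union_right hZB)
    have s4 : dim n m H (A ∪ Z) ≤ predim n m H (Y ∩ P ∪ Z) :=
      hH.dim_le (Finset.union_subset_union_left (Finset.subset_inter hAY hAP))
    have s5 : predim n m H Z ≤ dim n m H Z := by
      rw [hZ2]
      exact hH.dim_mono hZ1
    rw [u1, hB.dim_eq hH] at s2
    linarith
  have b1 := bound A P hA hDA hAY hAP h.subset_left dA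
  have b2 := bound E Q hE hDE hEY hEQ h.subset_right dE
  have hDYB : D ⊆ Y ∩ B := Finset.subset_inter (hDA.trans hAY) hDB
  -- Adding both bounds shows that `Y` exceeds `A ∪ E` in predimension by at least the excess of `Y
  -- ∩ B` over `D`. This is positive unless `Y ∩ B = D`; then the strength of `A` and `E` gives
  -- strictness.
  rcases hDYB.eq_or_ssubset with e | e
  · rw [← e] at e2
    have c1 : predim n m H A ≤ predim n m H (Y ∩ P) := hA.le (Finset.subset_inter hAY hAP)
    have c2 : predim n m H E ≤ predim n m H (Y ∩ Q) := hE.le (Finset.subset_inter hEY hEQ)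
    by_contra hcon
    have f1 := hA.eq_of_le (Finset.subset_inter hAY hAP) (by linarith)
    have f2 := hE.eq_of_le (Finset.subset_inter hEY hEQ) (by linarith)
    refine hlt.2 fun y hy => ?_
    rcases Finset.mem_union.1 (hY hy) with h1 | h1
    · exact Finset.mem_union_left _ (f1 ▸ Finset.mem_inter.2 ⟨hy, h1⟩)
    · exact Finset.mem_union_right _ (f2 ▸ Finset.mem_inter.2 ⟨hy, h1⟩)
  · have := hD _ e
    linarith

/-- Automorphisms that agree on `B` can be glued on freely amalgamated sets. -/
theorem exists_glue (hgen : IsGeneric n m f H) (h : FreeOver n m H P Q B) {α β : H.Aut}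
    (h' : FreeOver n m H (α • P) (β • Q) (α • B)) (hαβ : ∀ x ∈ B, α • x = β • x) :
    ∃ γ : H.Aut, (∀ x ∈ P, γ • x = α • x) ∧ ∀ x ∈ Q, γ • x = β • x := by
  let p : V → V := fun x => if x ∈ P then α • x else β • x
  have pP : ∀ x ∈ P, p x = α • x := fun x hx => if_pos hx
  have pQ : ∀ x ∈ Q, p x = β • x := fun x hx => by
    by_cases hP : x ∈ P
    · rw [pP x hP, hαβ x (h.inter ▸ Finset.mem_inter.2 ⟨hP, hx⟩)]
    · exact if_neg hP
  have eB : α • B = β • B := Finset.smul_eq_of_agree hαβ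
  have cross : ∀ x ∈ P, ∀ y ∈ Q, α • x = β • y → x = y := by
    intro x hx y hy e
    have : α • x ∈ α • B := h'.inter ▸ Finset.mem_inter.2
      ⟨Finset.smul_mem_smul_finset hx, e ▸ Finset.smul_mem_smul_finset hy⟩
    rw [hαβ x ((Finset.smul_mem_smul_finset_iff _).1 this)] at e
    exact MulAction.injective β e
  have toP : ∀ x ∈ P ∪ Q, p x ∈ α • P → x ∈ P := by
    intro x hx hp
    rcases Finset.mem_union.1 hx with h1 | h1
    · exact h1
    · rw [pQ x h1] at hp
      have : β • x ∈ β • B :=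
        eB ▸ h'.inter ▸ Finset.mem_inter.2 ⟨hp, Finset.smul_mem_smul_finset h1⟩
      exact h.subset_left ((Finset.smul_mem_smul_finset_iff _).1 this)
  have toQ : ∀ x ∈ P ∪ Q, p x ∈ β • Q → x ∈ Q := by
    intro x hx hp
    rcases Finset.mem_union.1 hx with h1 | h1
    · rw [pP x h1] at hp
      have : α • x ∈ α • B := h'.inter ▸ Finset.mem_inter.2 ⟨Finset.smul_mem_smul_finset h1, hp⟩
      exact h.subset_right ((Finset.smul_mem_smul_finset_iff _).1 this)
    · exact h1
  have imP : ∀ e ⊆ P, e.image p = α • e := fun e he => Finset.image_congr fun x hx => pP x (he hx)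
  have imQ : ∀ e ⊆ Q, e.image p = β • e := fun e he => Finset.image_congr fun x hx => pQ x (he hx)
  have im : (P ∪ Q).image p = α • P ∪ β • Q := by
    rw [Finset.image_union, imP P subset_rfl, imQ Q subset_rfl]
  -- Edges are reflected as well as preserved because no edge crosses in the source or in the
  -- target.
  have hemb : LocEmb H H p (P ∪ Q) := by
    refine ⟨fun x hx y hy hxy => ?_, fun e he => ⟨fun hee => ?_, fun hee => ?_⟩⟩
    · rcases Finset.mem_union.1 (Finset.mem_coe.1 hx) with h1 | h1 <;>
      rcases Finset.mem_union.1 (Finset.mem_coe.1 hy) with h2 | h2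
      · rw [pP x h1, pP y h2] at hxy
        exact MulAction.injective α hxy
      · rw [pP x h1, pQ y h2] at hxy
        exact cross x h1 y h2 hxy
      · rw [pQ x h1, pP y h2] at hxy
        exact (cross y h2 x h1 hxy.symm).symm
      · rw [pQ x h1, pQ y h2] at hxy
        exact MulAction.injective β hxy
    · rcases h.free e hee he with h1 | h1
      · rwa [imP e h1, smul_mem_edges_iff]
      · rwa [imQ e h1, smul_mem_edges_iff]
    · rcases h'.free _ hee (im ▸ Finset.image_subset_image he) with h1 | h1
      · have : e ⊆ P := fun x hx => toP x (he hx) (h1 (Finset.mem_image_of_mem p hx))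
        rwa [imP e this, smul_mem_edges_iff] at hee
      · have : e ⊆ Q := fun x hx => toQ x (he hx) (h1 (Finset.mem_image_of_mem p hx))
        rwa [imQ e this, smul_mem_edges_iff] at hee
  obtain ⟨γ, hγ⟩ := hgen.exists_aut hemb h.strong (im ▸ h'.strong)
  exact ⟨γ, fun x hx => by rw [hγ x (Finset.mem_union_left _ hx), pP x hx],
    fun x hx => by rw [hγ x (Finset.mem_union_right _ hx), pQ x hx]⟩

end FreeOver

/-- Over `A₂`, a set in the free amalgam gains the same predimension as its trace on `A₁` gains over
`A₁ ∩ A₂`. -/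
theorem StrongIn.union_right {A₁ A₂ : Finset W}
    (free : ∀ e ∈ K.edges, e ⊆ A₁ ∪ A₂ → e ⊆ A₁ ∨ e ⊆ A₂)
    (s₁ : StrongIn n m K (A₁ ∩ A₂) A₁) : StrongIn n m K A₂ (A₁ ∪ A₂) := by
  intro Y hY hlt
  have e1 : Y = Y ∩ A₁ ∪ A₂ := by
    refine subset_antisymm (fun y hy => ?_)
      (Finset.union_subset Finset.inter_subset_left hlt.1)
    rcases Finset.mem_union.1 (hY hy) with h | h
    · exact Finset.mem_union_left _ (Finset.mem_inter.2 ⟨hy, h⟩)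
    · exact Finset.mem_union_right _ h
  have e2 : Y ∩ A₁ ∩ A₂ = A₁ ∩ A₂ := by
    ext y
    simp only [Finset.mem_inter]
    exact ⟨fun h => ⟨h.1.2, h.2⟩, fun h => ⟨⟨hlt.1 h.2, h.1⟩, h.2⟩⟩
  have e3 := predim_free (n := n) (m := m) (H := K) (X := Y ∩ A₁) (Y := A₂) (fun e he hs => by
    rw [← e1] at hs
    exact (free e he (hs.trans hY)).imp_left fun h => Finset.subset_inter hs h)
  rw [← e1, e2] at e3
  have := s₁ (Y ∩ A₁) Finset.inter_subset_right
    ⟨e2 ▸ Finset.inter_subset_left, fun h => hlt.2 fun y hy => by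
      rw [e1] at hy
      rcases Finset.mem_union.1 hy with h1 | h1
      · exact (Finset.mem_inter.1 (h h1)).2
      · exact h1⟩
  linarith

/-- Sections `i` and `j` of `p` that coincide exactly over `B` give an external free amalgam of `A`
and `C`. The extension property places it in the generic structure over `C`, and homogeneity turns
the new copy of `A` into a translate of `A`. -/
theorem IsGeneric.exists_freeOver_of_copies [Nonempty V] (hgen : IsGeneric n m f H)
    (hf : HasFreeAmalgamation r n m f) {A B C : Finset V} (hA : Strong n m H A)
    (hB : Strong n m H B) (hC : Strong n m H C) (hBA : B ⊆ A) (hBC : B ⊆ C) {p : W → V}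
    {i j : V → W} (pi : ∀ x, p (i x) = x) (pj : ∀ x, p (j x) = x)
    (ij : ∀ x y, i x = j y → x ∈ B) (jB : ∀ x ∈ B, j x = i x) :
    ∃ σ : H.Aut, (∀ x ∈ B, σ • x = x) ∧ FreeOver n m H (σ • A) C B := by
  set A₁ : Finset (W) := A.image i with hA₁
  set A₂ : Finset (W) := C.image j with hA₂
  have injOn : ∀ (s : V → W) (X : Finset V), (∀ x, p (s x) = x) →
      Set.InjOn p (X.image s : Finset (W)) := by
    intro s X hs y hy y' hy' e
    obtain ⟨x, -, rfl⟩ := Finset.mem_image.1 (Finset.mem_coe.1 hy)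
    obtain ⟨x', -, rfl⟩ := Finset.mem_image.1 (Finset.mem_coe.1 hy')
    rw [hs, hs] at e
    rw [e]
  have inj₁ : Set.InjOn p A₁ := injOn _ A pi
  have inj₂ : Set.InjOn p A₂ := injOn _ C pj
  let F : UHypergraph r (W) :=
    { edges := {e | (e ⊆ A₁ ∨ e ⊆ A₂) ∧ e.image p ∈ H.edges}
      card_eq := by
        rintro e ⟨he, hee⟩
        rw [← H.card_eq _ hee]
        rcases he with he | he
        · exact (Finset.card_image_of_injOn (inj₁.mono he)).symm
        · exact (Finset.card_image_of_injOn (inj₂.mono he)).symm }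
  have emb₁ : LocEmb F H p A₁ := ⟨inj₁, fun e he => ⟨fun h => h.2, fun h => ⟨Or.inl he, h⟩⟩⟩
  have emb₂ : LocEmb F H p A₂ := ⟨inj₂, fun e he => ⟨fun h => h.2, fun h => ⟨Or.inr he, h⟩⟩⟩
  have inv : ∀ (s : V → W) (X : Finset V), (∀ x, p (s x) = x) →
      LocEmb F H p (X.image s) → LocEmb H F s X := by
    intro s X hs he
    refine ⟨fun x _ y _ e => by rw [← hs x, e, hs], fun e hX => ?_⟩
    rw [he.iff _ (Finset.image_subset_image hX), image_image_inv fun x _ => hs x]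
  have embi : LocEmb H F i A := inv _ A pi emb₁
  have embj : LocEmb H F j C := inv _ C pj emb₂
  have inter : A₁ ∩ A₂ = B.image i := by
    ext y
    simp only [hA₁, hA₂, Finset.mem_inter, Finset.mem_image]
    constructor
    · rintro ⟨⟨x, hx, rfl⟩, ⟨z, hz, e⟩⟩
      exact ⟨x, ij x z e.symm, rfl⟩
    · rintro ⟨x, hx, rfl⟩
      exact ⟨⟨x, hBA hx, rfl⟩, ⟨x, hBC hx, jB x hx⟩⟩
  have interp : (A₁ ∩ A₂).image p = B := by
    rw [inter, image_image_inv fun x _ => pi x]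
  have bd : ∀ A', LocEmb F H p A' → FBound n m f F A' := by
    intro A' hA' Y hY
    have := hgen.fBound (Y.image p)
    rwa [(hA'.mono hY).predim_image, Finset.card_image_of_injOn (hA'.mono hY).inj] at this
  have st : ∀ A', LocEmb F H p A' → A₁ ∩ A₂ ⊆ A' → StrongIn n m F (A₁ ∩ A₂) A' := by
    intro A' hA' hi Y hY hlt
    rw [← (hA'.mono hY).predim_image, ← (hA'.mono hi).predim_image, interp]
    exact hB _ (interp ▸ hA'.ssubset_image hY hlt)
  have free : ∀ e ∈ F.edges, e ⊆ A₁ ∪ A₂ → e ⊆ A₁ ∨ e ⊆ A₂ := fun e he _ => he.1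
  have s₁ := st A₁ emb₁ Finset.inter_subset_left
  have s₂ := st A₂ emb₂ Finset.inter_subset_right
  have t₂ : StrongIn n m F A₂ (A₁ ∪ A₂) := StrongIn.union_right free s₁
  have t₁ : StrongIn n m F A₁ (A₁ ∪ A₂) := by
    have := StrongIn.union_right (K := F) (A₁ := A₂) (A₂ := A₁) (fun e he _ => he.1.symm)
      (by rwa [Finset.inter_comm])
    rwa [Finset.union_comm] at this
  obtain ⟨φ, h1, h2, h3⟩ := hgen.exists_locEmb hC (hf.fBound free (bd _ emb₁) (bd _ emb₂) s₁ s₂)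
    embj Finset.subset_union_right t₂
  have u₁ : A₁ ⊆ A₁ ∪ A₂ := Finset.subset_union_left
  have u₂ : A₂ ⊆ A₁ ∪ A₂ := Finset.subset_union_right
  have imC : A₂.image φ = C := by
    rw [hA₂, image_image_inv h3]
  obtain ⟨σ, hσ⟩ := hgen.exists_aut (p := φ ∘ i) ((h1.mono u₁).comp embi) hA (by
    rw [← Finset.image_image]
    exact h1.strong_image h2 u₁ t₁)
  have imA : σ • A = A₁.image φ := by
    rw [hA₁, Finset.image_image]
    exact Finset.image_congr fun x hx => hσ x hx
  have fixB : ∀ x ∈ B, φ (i x) = x := fun x hx => by rw [← jB x hx, h3 x (hBC hx)]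
  refine ⟨σ, fun x hx => by rw [hσ x (hBA hx)]; exact fixB x hx, ?_, ?_, ?_⟩
  · rw [imA, ← imC, ← Finset.image_inter_of_injOn, inter, image_image_inv fixB]
    rw [← Finset.coe_union]
    exact h1.inj
  · rw [imA, ← imC, ← Finset.image_union]
    exact h2
  · intro e he hs
    rw [imA, ← imC] at hs ⊢
    rw [← Finset.image_union] at hs
    have e' := image_filter_mem hs
    rw [← e', ← h1.iff _ (Finset.filter_subset _ _)] at he
    rw [← e']
    exact he.1.imp (fun h => Finset.image_subset_image h) fun h => Finset.image_subset_image h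

/-- Any two strong extensions of a strong set can be freely amalgamated, after moving one of them
by an automorphism. -/
theorem IsGeneric.exists_freeOver (hgen : IsGeneric n m f H) (hf : HasFreeAmalgamation r n m f)
    {A B C : Finset V} (hA : Strong n m H A) (hB : Strong n m H B) (hC : Strong n m H C)
    (hBA : B ⊆ A) (hBC : B ⊆ C) :
    ∃ σ : H.Aut, (∀ x ∈ B, σ • x = x) ∧ FreeOver n m H (σ • A) C B := by
  rcases isEmpty_or_nonempty V with hV | hV
  · have e : ∀ X Y : Finset V, X = Y := fun X Y => Finset.ext fun x => hV.elim x
    exact ⟨1, fun x => hV.elim x, e _ _, e A ((1 : H.Aut) • A ∪ C) ▸ hA,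
      fun _ _ _ => Or.inl fun x => hV.elim x⟩
  -- Two disjoint copies of `V`, the second section being redirected to the first copy on `B`.
  refine hgen.exists_freeOver_of_copies hf hA hB hC hBA hBC (W := V ⊕ V) (p := Sum.elim id id)
    (i := Sum.inl) (j := fun x => if x ∈ B then Sum.inl x else Sum.inr x) (fun x => rfl)
    (fun x => ?_) (fun x y h => ?_) fun x hx => if_pos hx
  · by_cases hx : x ∈ B <;> simp [hx]
  · by_cases hy : y ∈ B
    · simp only [hy, if_true, Sum.inl.injEq] at h
      exact h ▸ hy
    · simp [hy] at h

end Free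

end UHypergraph

/-! ### The independence geometry of the generic structure. -/

namespace UHypergraph

section Geometry

open Classical

variable {r n m : ℕ} {f : ℝ≥0 → ℝ≥0} {V : Type*} {H : UHypergraph r V}

namespace IsGeneric

variable (hgen : IsGeneric n m f H)

theorem clos_subset_clos {X Y : Finset V} (h : X ⊆ hgen.clos Y) : hgen.clos X ⊆ hgen.clos Y :=
  hgen.clos_subset (hgen.strong_clos Y) h

theorem clos_union_congr (X : Finset V) {Y Y' : Finset V} (h : hgen.clos Y = hgen.clos Y') :
    hgen.clos (X ∪ Y) = hgen.clos (X ∪ Y') := by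
  have key : ∀ {Y Y'}, hgen.clos Y = hgen.clos Y' → hgen.clos (X ∪ Y) ⊆ hgen.clos (X ∪ Y') := by
    intro Y Y' h
    refine hgen.clos_subset_clos (Finset.union_subset
      (Finset.subset_union_left.trans (hgen.subset_clos _)) ?_)
    exact (h ▸ hgen.subset_clos Y).trans (hgen.clos_mono Finset.subset_union_right)
  exact (key h).antisymm (key h.symm)

/-- Independence: the closures over `B` are freely amalgamated over the closure of `B`. -/
def FreeInd (A B C : Finset V) : Prop :=
  FreeOver n m H (hgen.clos (A ∪ B)) (hgen.clos (C ∪ B)) (hgen.clos B)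

theorem clos_union_eq {X Y B : Finset V}
    (h : FreeOver n m H (hgen.clos X) (hgen.clos Y) B) :
    hgen.clos (X ∪ Y) = hgen.clos X ∪ hgen.clos Y :=
  (hgen.clos_subset h.strong (Finset.union_subset_union (hgen.subset_clos X)
    (hgen.subset_clos Y))).antisymm
    (Finset.union_subset (hgen.clos_mono Finset.subset_union_left)
      (hgen.clos_mono Finset.subset_union_right))

theorem FreeInd.mono {A B C A' C' : Finset V} (h : hgen.FreeInd A B C)
    (hA : A' ⊆ hgen.clos (A ∪ B)) (hC : C' ⊆ hgen.clos (C ∪ B)) : hgen.FreeInd A' B C' := by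
  have sub : ∀ {A A' : Finset V}, A' ⊆ hgen.clos (A ∪ B) →
      hgen.clos (A' ∪ B) ⊆ hgen.clos (A ∪ B) := fun h =>
    hgen.clos_subset_clos (Finset.union_subset h
      (Finset.subset_union_right.trans (hgen.subset_clos _)))
  have h1 := FreeOver.mono_right h (hgen.strong_clos (C' ∪ B))
    (hgen.clos_mono Finset.subset_union_right) (sub hC)
  exact (h1.symm.mono_right (hgen.strong_clos (A' ∪ B))
    (hgen.clos_mono Finset.subset_union_right) (sub hA)).symm

theorem FreeInd.trans {A B C B₁ D : Finset V} (h : hgen.FreeInd A B C)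
    (h' : hgen.FreeInd A B₁ D) (e : hgen.clos B₁ = hgen.clos (B ∪ C)) :
    hgen.FreeInd A B (C ∪ D) := by
  unfold FreeInd at *
  refine FreeOver.trans h ?_
  have e1 : hgen.clos (A ∪ B₁) = hgen.clos (A ∪ B) ∪ hgen.clos (C ∪ B) := by
    rw [hgen.clos_union_congr A e, ← hgen.clos_union_eq h]
    congr 1
    ext x
    simp only [Finset.mem_union]
    tauto
  have e2 : hgen.clos (D ∪ B₁) = hgen.clos (C ∪ D ∪ B) := by
    rw [hgen.clos_union_congr D e]
    congr 1
    ac_rfl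
  rwa [e1, e2, e, Finset.union_comm B C] at h'

theorem FreeInd.dim_add {A B C : Finset V} (h : hgen.FreeInd A B C) :
    dim n m H (A ∪ B ∪ C) + dim n m H B = dim n m H (A ∪ B) + dim n m H (B ∪ C) := by
  have h1 := FreeOver.predim_add h
  rw [← hgen.clos_union_eq h] at h1
  simp only [hgen.predim_clos] at h1
  rw [Finset.union_comm B C, ← h1]
  congr 2
  ext x
  simp only [Finset.mem_union]
  tauto

theorem dim_clos_union (X Y : Finset V) :
    dim n m H (hgen.clos X ∪ hgen.clos Y) = dim n m H (X ∪ Y) := by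
  refine le_antisymm ?_ (hgen.nonneg.dim_mono
    (Finset.union_subset_union (hgen.subset_clos X) (hgen.subset_clos Y)))
  rw [← hgen.dim_clos (X ∪ Y)]
  exact hgen.nonneg.dim_mono (Finset.union_subset (hgen.clos_mono Finset.subset_union_left)
    (hgen.clos_mono Finset.subset_union_right))

theorem FreeInd.of_dim {A B C D : Finset V}
    (h1 : dim n m H (A ∪ B ∪ C) + dim n m H B = dim n m H (A ∪ B) + dim n m H (B ∪ C))
    (h2 : dim n m H (D ∪ B ∪ C) + dim n m H B = dim n m H (D ∪ B) + dim n m H (B ∪ C))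
    (h : hgen.FreeInd A (B ∪ C) D) : hgen.FreeInd A B D := by
  have key : ∀ A : Finset V,
      dim n m H (A ∪ B ∪ C) + dim n m H B = dim n m H (A ∪ B) + dim n m H (B ∪ C) →
      dim n m H (hgen.clos (A ∪ B) ∪ hgen.clos (B ∪ C)) + predim n m H (hgen.clos B) =
        predim n m H (hgen.clos (A ∪ B)) + predim n m H (hgen.clos (B ∪ C)) := by
    intro A hA
    rw [hgen.dim_clos_union, hgen.predim_clos, hgen.predim_clos, hgen.predim_clos, ← hA]
    congr 2
    ext x
    simp only [Finset.mem_union]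
    tauto
  have sub : ∀ A : Finset V, hgen.clos (A ∪ B) ⊆ hgen.clos (A ∪ (B ∪ C)) := fun A =>
    hgen.clos_mono (Finset.union_subset_union_right Finset.subset_union_left)
  exact FreeOver.of_dim hgen.nonneg h (hgen.strong_clos _) (hgen.strong_clos _)
    (hgen.strong_clos _) (hgen.strong_clos _) (hgen.clos_mono Finset.subset_union_right)
    (hgen.clos_mono Finset.subset_union_right) (hgen.clos_mono Finset.subset_union_left)
    (sub A) (sub D) (key A h1) (key D h2)

/-- The geometry of the generic structure. -/
noncomputable def geometry (hf : HasFreeAmalgamation r n m f) (h0 : Strong n m H ∅) :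
    IndepGeometry H.Aut V where
  cl := hgen.clos
  d := dim n m H
  Ind := hgen.FreeInd
  subset_cl := hgen.subset_clos
  cl_subset_cl := hgen.clos_subset_clos
  cl_empty := hgen.clos_eq h0
  smul_cl := hgen.smul_clos
  d_mono := hgen.nonneg.dim_mono
  d_submod := hgen.nonneg.dim_submod
  d_cl := hgen.dim_clos
  d_smul := hgen.dim_smul
  mem_cl_of_d_le h := hgen.mem_clos_iff.2
    (le_antisymm h (hgen.nonneg.dim_mono (Finset.subset_insert _ _)))
  ind_smul σ A B C h := by
    have := FreeOver.smul h σ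
    rwa [hgen.smul_clos, hgen.smul_clos, hgen.smul_clos, Finset.smul_finset_union,
      Finset.smul_finset_union] at this
  ind_symm h := FreeOver.symm h
  ind_mono h := FreeInd.mono hgen h
  ind_trans h := FreeInd.trans hgen h
  ind_exists A B C := by
    obtain ⟨σ, h1, h2⟩ := hgen.exists_freeOver hf (hgen.strong_clos (A ∪ B)) (hgen.strong_clos B)
      (hgen.strong_clos (C ∪ B)) (hgen.clos_mono Finset.subset_union_right)
      (hgen.clos_mono Finset.subset_union_right)
    refine ⟨σ, h1, ?_⟩
    rwa [hgen.smul_clos, Finset.smul_finset_union,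
      Finset.smul_eq_of_fixes fun x hx => h1 x (hgen.subset_clos B hx)] at h2
  ind_stationary {A B C} α β h h' hαβ := by
    refine FreeOver.exists_glue hgen h ?_ hαβ
    rw [hgen.smul_clos, hgen.smul_clos, hgen.smul_clos, Finset.smul_finset_union,
      Finset.smul_finset_union,
      ← Finset.smul_eq_of_agree fun x hx => hαβ x (hgen.subset_clos B hx)]
    exact h'
  ind_d h := FreeInd.dim_add hgen h
  ind_of_d h1 h2 h := FreeInd.of_dim hgen h1 h2 h
  exists_limit u F hF hu hcov hsurj := by
    refine exists_aut_limit (fun k x => u k • x) F hF hu (fun k => locEmb_smul _ _) hcov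
      fun y => ?_
    obtain ⟨k, hk⟩ := hsurj y
    exact ⟨k, Finset.mem_smul_finset.1 hk⟩

/-- Relative dimension over an infinite set is attained at a finite subset `Y`; the part of `Y`
outside the closed set lies in the orbit and is the required finite spanning set. -/
theorem geometry_mono {hf : HasFreeAmalgamation r n m f} {h0 : Strong n m H ∅}
    (hmono : Monodimensional n m H) : (hgen.geometry hf h0).Mono := by
  intro A b hA hb
  change hgen.clos A = A at hA
  have fam : ∀ C : Finset V, hgen.clos C = C → (C : Set V) ∈ closedFam n m H := fun C hC =>
    ⟨C, by rw [← hgen.coe_clos, hC]⟩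
  have hb' : IsBasic n m H b A := by
    refine ⟨hb.1, ?_⟩
    rintro _ ⟨X, rfl⟩ hAC hlt
    rw [← hgen.coe_clos] at hAC hlt ⊢
    rw [hgen.nonneg.relDim_coe, hgen.nonneg.relDim_coe] at hlt
    exact hb.2 (hgen.clos X) (hgen.clos_eq (hgen.strong_clos X)) (Finset.coe_subset.1 hAC) hlt
  obtain ⟨_, ⟨X, rfl⟩, hAB, huniv⟩ := hmono A (fam A hA) b hb'
  rw [← hgen.coe_clos] at hAB huniv
  refine ⟨hgen.clos X, hgen.clos_eq (hgen.strong_clos X), Finset.coe_subset.1 hAB, fun x => ?_⟩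
  have hx : x ∈ dcl n m H (hgen.clos X ∪ H.orb b A) := huniv ▸ Set.mem_univ x
  obtain ⟨Y, hY, e⟩ := hgen.nonneg.exists_relDim {x} (hgen.clos X ∪ H.orb b A)
  have hx' : relDim n m H {x} (hgen.clos X ∪ H.orb b A) = 0 := hx
  rw [hx', ← Finset.insert_eq] at e
  have hxY : x ∈ hgen.clos Y := hgen.mem_clos_iff.2 (by linarith)
  refine ⟨Y.filter (· ∉ hgen.clos X), fun y hy => ?_, hgen.clos_mono (fun y hy => ?_) hxY⟩
  · obtain ⟨h1, h2⟩ := Finset.mem_filter.1 hy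
    rcases hY (Finset.mem_coe.2 h1) with h3 | ⟨σ, hσ, h3, h4⟩
    · exact absurd h3 h2
    · exact ⟨⟨σ, hσ⟩, h3, h4⟩
  · by_cases h : y ∈ hgen.clos X
    · exact Finset.mem_union_left _ h
    · exact Finset.mem_union_right _ (Finset.mem_filter.2 ⟨hy, h⟩)

end IsGeneric

end Geometry

end UHypergraph

/-! ### Free edges and bounded automorphisms. -/

namespace UHypergraph

section Bounded

open Classical

variable {r n m : ℕ} {f : ℝ≥0 → ℝ≥0} {V : Type*} {H : UHypergraph r V}

theorem le_predim_of_card_eq {X : Finset V} (h : X.card = r) :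
    (n : ℤ) * r - m ≤ predim n m H X := by
  have h1 : (X.powerset.filter (· ∈ H.edges)).card ≤ 1 := by
    refine (Finset.card_le_card fun e he => ?_).trans (Finset.card_singleton X).le
    obtain ⟨h1, h2⟩ := Finset.mem_filter.1 he
    exact Finset.mem_singleton.2 (Finset.eq_of_subset_of_card_le (Finset.mem_powerset.1 h1)
      (by rw [h, H.card_eq e h2]))
  unfold predim
  rw [h]
  have h2 : (((X.powerset.filter (· ∈ H.edges)).card : ℕ) : ℤ) ≤ 1 := by exact_mod_cast h1
  nlinarith [mul_le_mul_of_nonneg_left h2 (Int.natCast_nonneg m)]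

namespace IsGeneric

theorem strong_empty (hgen : IsGeneric n m f H) (hr : 2 ≤ r)
    (hn : 1 ≤ n) (hf : StrictMono f) (hf1 : f 1 = n) :
    Strong n m H (∅ : Finset V) := by
  intro Y hY
  have hc : 1 ≤ Y.card := Finset.card_pos.2 (Finset.empty_ssubset.1 hY)
  have h1 := hgen.fBound Y
  have h2 : f 1 ≤ f (Y.card : ℝ≥0) := hf.monotone (by exact_mod_cast hc)
  have h3 : (n : ℝ) ≤ predim n m H Y := by
    refine le_trans ?_ h1
    rw [hf1] at h2
    exact_mod_cast h2
  have h4 : (n : ℤ) ≤ predim n m H Y := by exact_mod_cast h3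
  have h5 : predim n m H (∅ : Finset V) = 0 := by 
    rw [predim_eq_of_no_edge (by simp; omega)]
    simp
  omega

/-- The normalisation `f 1 = n` enters here: larger sets have predimension at least `f` of their
size, which exceeds `f 1`. -/
theorem strong_singleton (hgen : IsGeneric n m f H)
    (hr : 2 ≤ r) (hf : StrictMono f) (hf1 : f 1 = n) (x : V) :
    Strong n m H {x} := by
  intro Y hY
  have hc : 1 < Y.card := by simpa using Finset.card_lt_card hY
  have h1 := hgen.fBound Y
  have h2 : f 1 < f (Y.card : ℝ≥0) := hf (by exact_mod_cast hc)
  have h3 : (n : ℝ) < predim n m H Y := by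
    refine lt_of_lt_of_le ?_ h1
    rw [hf1] at h2
    exact_mod_cast h2
  have h4 : predim n m H {x} = n := by
    rw [predim_eq_of_no_edge (by rw [Finset.card_singleton]; omega)]
    simp
  rw [h4]
  exact_mod_cast h3

theorem locEmb_singleton (hr : 2 ≤ r) (x y : V) : LocEmb H H (fun _ => y) {x} := by
  refine ⟨by simp, fun e he => ⟨fun h => ?_, fun h => ?_⟩⟩
  · have := (Finset.card_le_card he).trans (Finset.card_singleton x).le
    rw [H.card_eq e h] at this
    omega
  · have := Finset.card_image_le (s := e) (f := fun _ => y)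
    have h2 := (Finset.card_le_card he).trans (Finset.card_singleton x).le
    rw [H.card_eq _ h] at this
    omega

/-- A free edge can be attached at every point of a strong set. -/
theorem exists_free_edge (hgen : IsGeneric n m f H)
    (hr : 2 ≤ r) (hf : IsGood r n m f) (hf1 : f 1 = n)
    (hedge : H.edges.Nonempty) {y : V} {Q : Finset V} (hQ : Strong n m H Q) (hy : y ∈ Q) :
    ∃ E ∈ H.edges, FreeOver n m H E Q {y} := by
  have : Nonempty V := ⟨y⟩
  have st := hgen.strong_singleton hr hf.strictMono hf1
  obtain ⟨e₀, he₀⟩ := hedge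
  have hcard := H.card_eq e₀ he₀
  obtain ⟨y₀, hy₀⟩ : e₀.Nonempty := Finset.card_pos.1 (by omega)
  have im : ({y} : Finset V).image (fun _ => y₀) = {y₀} := by simp
  obtain ⟨φ, h1, h2, h3⟩ := hgen.exists_locEmb (st y) (K := H) (U := e₀)
    (fun Y _ => hgen.fBound Y) (locEmb_singleton hr y y₀)
    (by simpa [im] using hy₀) (by rw [im]; exact fun Y _ hY => st y₀ Y hY)
  have hyE : y ∈ e₀.image φ :=
    Finset.mem_image.2 ⟨y₀, hy₀, h3 y (Finset.mem_singleton_self y)⟩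
  obtain ⟨σ, -, h5⟩ := hgen.exists_freeOver hf.amalgamation h2 (st y) hQ
    -- An existing edge has been copied so as to pass through `y`, singletons being strong and
    -- isomorphic; now it is freed from `Q` over `y`.
    (Finset.singleton_subset_iff.2 hyE) (Finset.singleton_subset_iff.2 hy)
  exact ⟨σ • e₀.image φ, (smul_mem_edges_iff _ _).2 ((h1.iff e₀ subset_rfl).1 he₀), h5⟩

variable {E Q B : Finset V} {y z : V}

theorem predim_free_edge_of_notMem (hE : E.card = r) (h : FreeOver n m H E Q {y})
    {Y : Finset V} (hY : Y ⊆ E ∪ Q) (hy : y ∉ Y) (h0 : predim n m H (∅ : Finset V) = 0) :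
    predim n m H Y = n * (Y ∩ E).card + predim n m H (Y ∩ Q) := by
  have h1 := h.predim_inter_add hY
  have hyE : y ∈ E := h.subset_left (Finset.mem_singleton_self y)
  rw [Finset.inter_singleton_of_notMem hy, h0] at h1
  have h2 : (Y ∩ E).card < r := by
    rw [← hE]
    refine Finset.card_lt_card ⟨Finset.inter_subset_right, fun h' => hy ?_⟩
    exact (Finset.mem_inter.1 (h' hyE)).1
  rw [predim_eq_of_no_edge h2] at h1
  linarith

/-- If `Y` misses part of `E`, its trace on `E` carries no edge and has at least the two points `y`,
`z`; otherwise the trace is `E`, and `hc` applies. Either way it exceeds the predimension `n` of `y`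
by at least one. -/
theorem predim_free_edge_of_mem (hgen : IsGeneric n m f H)
    (hn : 1 ≤ n) (hc : (n : ℤ) + 1 ≤ n * r - m) (hr : 2 ≤ r)
    (hE : E.card = r) (h : FreeOver n m H E Q {y}) (hBQ : B ⊆ Q)
    (hz : z ∈ E) (hzy : z ≠ y) {Y : Finset V} (hY : Y ⊆ E ∪ Q) (hBY : insert z B ⊆ Y)
    (hy : y ∈ Y) : dim n m H (insert y B) + 1 ≤ predim n m H Y := by
  have h1 := h.predim_inter_add hY
  have hyE : y ∈ E := h.subset_left (Finset.mem_singleton_self y)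
  have hyQ : y ∈ Q := h.subset_right (Finset.mem_singleton_self y)
  rw [Finset.inter_singleton_of_mem hy,
    predim_eq_of_no_edge (X := {y}) (by rw [Finset.card_singleton]; omega)] at h1
  have h2 : dim n m H (insert y B) ≤ predim n m H (Y ∩ Q) := by
    refine hgen.nonneg.dim_le (Finset.insert_subset (Finset.mem_inter.2 ⟨hy, hyQ⟩) ?_)
    exact Finset.subset_inter ((Finset.subset_insert _ _).trans hBY) hBQ
  have h3 : (n : ℤ) + 1 ≤ predim n m H (Y ∩ E) := by
    rcases (Finset.card_le_card (Finset.inter_subset_right (s₁ := Y) (s₂ := E))).lt_or_eq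
      with h4 | h4
    · rw [predim_eq_of_no_edge (by omega)]
      have h5 : 2 ≤ (Y ∩ E).card := by
        rw [← Finset.card_pair hzy]
        refine Finset.card_le_card (Finset.insert_subset ?_ (Finset.singleton_subset_iff.2 ?_))
        · exact Finset.mem_inter.2 ⟨hBY (Finset.mem_insert_self _ _), hz⟩
        · exact Finset.mem_inter.2 ⟨hy, hyE⟩
      have h6 : (2 : ℤ) ≤ (Y ∩ E).card := by exact_mod_cast h5
      have h7 : (1 : ℤ) ≤ n := by exact_mod_cast hn
      nlinarith
    · exact hc.trans (le_predim_of_card_eq (h4.trans hE))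
  simp only [Finset.card_singleton, Nat.cast_one, mul_one] at h1
  linarith

/-- The points of a free edge attached at `y` have larger dimension than `y`, unless that is
maximal. -/
theorem le_dim_free_edge (hgen : IsGeneric n m f H)
    (hn : 1 ≤ n) (hc : (n : ℤ) + 1 ≤ n * r - m) (hr : 2 ≤ r)
    (hE : E.card = r) (h : FreeOver n m H E Q {y}) (hB : Strong n m H B) (hBQ : B ⊆ Q)
    (hz : z ∈ E) (hzy : z ≠ y) (h0 : predim n m H (∅ : Finset V) = 0) :
    min (dim n m H B + n) (dim n m H (insert y B) + 1) ≤ dim n m H (insert z B) := by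
  obtain ⟨Y', h1, h2⟩ := hgen.nonneg.exists_dim (insert z B)
  have sub : insert z B ⊆ E ∪ Q := Finset.insert_subset (Finset.mem_union_left _ hz)
    (hBQ.trans Finset.subset_union_right)
  have h3 := h.strong.subset_of_predim_le hgen.nonneg sub h1 h2.le
  rw [← h2]
  by_cases hy : y ∈ Y'
  · exact (min_le_right _ _).trans
      (hgen.predim_free_edge_of_mem hn hc hr hE h hBQ hz hzy h3 h1 hy)
  · refine (min_le_left _ _).trans ?_
    rw [predim_free_edge_of_notMem hE h h3 hy h0, hB.dim_eq hgen.nonneg]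
    have h4 : predim n m H B ≤ predim n m H (Y' ∩ Q) :=
      hB.le (Finset.subset_inter ((Finset.subset_insert _ _).trans h1) hBQ)
    have h5 : 1 ≤ (Y' ∩ E).card := Finset.card_pos.2
      ⟨z, Finset.mem_inter.2 ⟨h1 (Finset.mem_insert_self _ _), hz⟩⟩
    have h6 : (1 : ℤ) ≤ (Y' ∩ E).card := by exact_mod_cast h5
    nlinarith [Int.natCast_nonneg n]

/-- A point of a free edge attached at a generic point over `B` is freely independent from `B`. -/
theorem strong_insert_free_edge (hgen : IsGeneric n m f H)
    (hn : 1 ≤ n) (hc : (n : ℤ) + 1 ≤ n * r - m) (hr : 2 ≤ r)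
    (hE : E.card = r) (h : FreeOver n m H E Q {y}) (hB : Strong n m H B) (hBQ : B ⊆ Q)
    (hz : z ∈ E) (hzy : z ≠ y) (h0 : predim n m H (∅ : Finset V) = 0)
    (hy : dim n m H B + n ≤ dim n m H (insert y B)) : Strong n m H (insert z B) := by
  have sub : insert z B ⊆ E ∪ Q := Finset.insert_subset (Finset.mem_union_left _ hz)
    (hBQ.trans Finset.subset_union_right)
  have hzQ : z ∉ Q := fun hzQ => hzy (Finset.mem_singleton.1
    (h.inter ▸ Finset.mem_inter.2 ⟨hz, hzQ⟩))
  have up : predim n m H (insert z B) ≤ predim n m H B + n := by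
    have h1 := predim_submod (n := n) (m := m) (H := H) {z} B
    rw [Finset.singleton_inter_of_notMem fun hzB => hzQ (hBQ hzB), h0, ← Finset.insert_eq,
      predim_eq_of_no_edge (X := {z}) (by rw [Finset.card_singleton]; omega)] at h1
    simp only [Finset.card_singleton, Nat.cast_one, mul_one] at h1
    linarith
  refine h.strong.of_subset (fun Y hY hlt => ?_) sub
  by_cases hyY : y ∈ Y
  · have h1 := hgen.predim_free_edge_of_mem hn hc hr hE h hBQ hz hzy hY hlt.1 hyY
    rw [hB.dim_eq hgen.nonneg] at hy
    linarith
  · have e1 := predim_free_edge_of_notMem hE h hY hyY h0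
    have hBY : B ⊆ Y ∩ Q := Finset.subset_inter ((Finset.subset_insert _ _).trans hlt.1) hBQ
    have h4 : predim n m H B ≤ predim n m H (Y ∩ Q) := hB.le hBY
    have hzYE : {z} ⊆ Y ∩ E := Finset.singleton_subset_iff.2
      (Finset.mem_inter.2 ⟨hlt.1 (Finset.mem_insert_self _ _), hz⟩)
    have h7 : (1 : ℤ) ≤ n := by exact_mod_cast hn
    by_contra hcon
    have c1 : (Y ∩ E).card ≤ 1 := by
      by_contra hgt
      have : (2 : ℤ) ≤ (Y ∩ E).card := by exact_mod_cast not_le.1 hgt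
      nlinarith
    have c2 : {z} = Y ∩ E := Finset.eq_of_subset_of_card_le hzYE (by simpa using c1)
    rw [← c2] at e1
    simp only [Finset.card_singleton, Nat.cast_one, mul_one] at e1
    have c3 := hB.eq_of_le hBY (by linarith)
    refine hlt.2 fun x hx => ?_
    rcases Finset.mem_union.1 (hY hx) with h1 | h1
    · have : x ∈ ({z} : Finset V) := c2 ▸ Finset.mem_inter.2 ⟨hx, h1⟩
      rw [Finset.mem_singleton.1 this]
      exact Finset.mem_insert_self _ _
    · exact Finset.mem_insert_of_mem (c3 ▸ Finset.mem_inter.2 ⟨hx, h1⟩)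

/-- An automorphism that fixes the other points of a free edge attached at `y` fixes `y`. -/
theorem smul_eq_of_free_edge {g : H.Aut} (hr : 2 ≤ r) (hE : E ∈ H.edges)
    (h : FreeOver n m H E Q {y}) (hg : g • y ∈ Q) (hfix : ∀ z ∈ E, z ≠ y → g • z = z) :
    g • y = y := by
  have hyE : y ∈ E := h.subset_left (Finset.mem_singleton_self y)
  obtain ⟨z, hz, hzy⟩ := Finset.exists_mem_ne (s := E) (by rw [H.card_eq E hE]; omega) y
  have hzQ : z ∉ Q := fun hzQ => hzy (Finset.mem_singleton.1
    (h.inter ▸ Finset.mem_inter.2 ⟨hz, hzQ⟩))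
  have hs : g • E ⊆ E ∪ Q := by
    intro w hw
    obtain ⟨x, hx, rfl⟩ := Finset.mem_smul_finset.1 hw
    by_cases hxy : x = y
    · exact Finset.mem_union_right _ (hxy ▸ hg)
    · rw [hfix x hx hxy]
      exact Finset.mem_union_left _ hx
  rcases h.free _ ((smul_mem_edges_iff g E).2 hE) hs with h1 | h1
  · have : g • y ∈ E ∩ Q := Finset.mem_inter.2 ⟨h1 (Finset.smul_mem_smul_finset hyE), hg⟩
    rw [h.inter] at this
    exact Finset.mem_singleton.1 this
  · have := h1 (Finset.smul_mem_smul_finset (a := g) hz)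
    rw [hfix z hz hzy] at this
    exact absurd this hzQ

/-- Bounded automorphisms are trivial. -/
theorem eq_one_of_bounded (hgen : IsGeneric n m f H)
    (hr : 2 ≤ r) (hn : 1 ≤ n) (hc : (n : ℤ) + 1 ≤ n * r - m)
    (hf : IsGood r n m f) (hf1 : f 1 = n) (hedge : H.edges.Nonempty) {g : H.Aut}
    (hB : Strong n m H B) (hg : ∀ x, g • x ∈ hgen.clos (insert x B)) : g = 1 := by
  have h0 : predim n m H (∅ : Finset V) = 0 := by
    rw [predim_eq_of_no_edge (by simp; omega)]
    simp
  have attach : ∀ y, ∃ Q E, B ⊆ Q ∧ g⁻¹ • B ⊆ Q ∧ g • y ∈ Q ∧ E ∈ H.edges ∧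
      FreeOver n m H E Q {y} := by
    intro y
    have sub := hgen.subset_clos (B ∪ g⁻¹ • B ∪ {y, g • y})
    obtain ⟨E, hE, hfree⟩ := hgen.exists_free_edge hr hf hf1 hedge
      (hgen.strong_clos (B ∪ g⁻¹ • B ∪ {y, g • y})) (y := y) (sub (by simp))
    exact ⟨_, E, (Finset.subset_union_left.trans Finset.subset_union_left).trans sub,
      (Finset.subset_union_right.trans Finset.subset_union_left).trans sub, sub (by simp), hE,
      hfree⟩
  -- Induction on a bound `j` for how far the dimension of `y` over `B` falls short of the maximum
  -- `n`. For `j = 0` the other vertices `z` of a free edge at `y` have `insert z B` closed, and the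
  -- choice of `Q` excludes `g • z ∈ B`; so they are fixed. In the successor step their shortfall is
  -- at most `j`.
  have key : ∀ (j : ℕ) (y : V), y ∉ B → dim n m H B + n ≤ dim n m H (insert y B) + j →
      g • y = y := by
    intro j
    induction j with
    | zero =>
      intro y _ hy
      obtain ⟨Q, E, hBQ, hgBQ, hgy, hE, hfree⟩ := attach y
      refine smul_eq_of_free_edge hr hE hfree hgy fun z hz hzy => ?_
      have hzQ : z ∉ Q := fun hzQ => hzy (Finset.mem_singleton.1
        (hfree.inter ▸ Finset.mem_inter.2 ⟨hz, hzQ⟩))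
      have hst := hgen.strong_insert_free_edge hn hc hr (H.card_eq E hE) hfree hB hBQ hz hzy h0
        (by simpa using hy)
      have hgz := hg z
      rw [hgen.clos_eq hst] at hgz
      rcases Finset.mem_insert.1 hgz with h1 | h1
      · exact h1
      · exact absurd (hgBQ (Finset.mem_inv_smul_finset_iff.2 h1)) hzQ
    | succ j ih =>
      intro y _ hy
      obtain ⟨Q, E, hBQ, hgBQ, hgy, hE, hfree⟩ := attach y
      refine smul_eq_of_free_edge hr hE hfree hgy fun z hz hzy => ih z (fun hzB => ?_) ?_
      · exact hzy (Finset.mem_singleton.1 (hfree.inter ▸ Finset.mem_inter.2 ⟨hz, hBQ hzB⟩))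
      · have := hgen.le_dim_free_edge hn hc hr (H.card_eq E hE) hfree hB hBQ hz hzy h0
        push_cast at hy
        rcases min_le_iff.1 this with h1 | h1 <;> linarith
  have out : ∀ y, y ∉ B → g • y = y := fun y hy => key n y hy (by
    have := hgen.nonneg.dim_mono (Finset.subset_insert y B)
    linarith)
  refine FaithfulSMul.eq_of_smul_eq_smul (α := V) fun y => ?_
  rw [one_smul]
  -- Points of `B` are treated alike, because the other vertices of the attached edge lie outside
  -- `B` and are already fixed.
  obtain ⟨Q, E, hBQ, -, hgy, hE, hfree⟩ := attach y
  refine smul_eq_of_free_edge hr hE hfree hgy fun z hz hzy => out z fun hzB => ?_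
  exact hzy (Finset.mem_singleton.1 (hfree.inter ▸ Finset.mem_inter.2 ⟨hz, hBQ hzB⟩))

/-- Singletons are strong and pairwise isomorphic, so homogeneity moves one vertex of an edge to
another. -/
theorem nontrivial_aut (hgen : IsGeneric n m f H)
    (hr : 2 ≤ r) (hf : IsGood r n m f) (hf1 : f 1 = n)
    (hedge : H.edges.Nonempty) : Nontrivial H.Aut := by
  obtain ⟨e, he⟩ := hedge
  obtain ⟨x, hx, y, hy, hxy⟩ := Finset.one_lt_card.1 (by rw [H.card_eq e he]; omega : 1 < e.card)
  have st := hgen.strong_singleton hr hf.strictMono hf1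
  obtain ⟨σ, hσ⟩ := hgen.exists_aut (locEmb_singleton hr x y) (st x) (by simpa using st y)
  refine ⟨σ, 1, fun h => hxy ?_⟩
  have := hσ x (Finset.mem_singleton_self x)
  rwa [h, one_smul] at this

end IsGeneric

end Bounded

end UHypergraph

/-! ### The product theorem and simplicity. -/

theorem theorem5p11 {r n m : ℕ} (hr : 2 ≤ r) (hn : 1 ≤ n) (hm : 1 ≤ m) (hnm : n.Coprime m)
    (h2 : r = 2 → m < n) (h3 : 3 ≤ r → m ≤ n)
    (f : ℝ≥0 → ℝ≥0) (hf : UHypergraph.IsGood r n m f) (hf0 : f 0 = 0) (hf1 : f 1 = n)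
    {M : Type*} (H : UHypergraph r M) (hgen : UHypergraph.IsGeneric n m f H)
    (hedge : H.edges.Nonempty) (hmono : UHypergraph.Monodimensional n m H) :
    (∀ g : H.Aut, g ≠ 1 → ∀ h : H.Aut, ∃ l : List H.Aut,
      l.length = 192 ∧ (∀ x ∈ l, IsConj g x ∨ IsConj g⁻¹ x) ∧ l.prod = h) ∧
    IsSimpleGroup H.Aut := by
  classical
  -- This is where the case distinction on `r` is used: for `r = 2` it is `m < n`, and for `r ≥ 3`
  -- it follows from `n * r - m ≥ 3 * n - n`.
  have hc : (n : ℤ) + 1 ≤ n * r - m := by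
    rcases hr.eq_or_lt with rfl | hr3
    · have := h2 rfl
      push_cast
      omega
    · have h4 := h3 hr3
      have h5 : (3 : ℤ) ≤ r := by exact_mod_cast hr3
      have h6 : (m : ℤ) ≤ n := by exact_mod_cast h4
      have h7 : (1 : ℤ) ≤ n := by exact_mod_cast hn
      nlinarith
  have := hgen.countable
  have hprod : ∀ g : H.Aut, g ≠ 1 → ∀ h : H.Aut, IsConjProd g 192 h := by
    intro g hg h
    refine (hgen.geometry_mono (hf := hf.amalgamation)
      (h0 := hgen.strong_empty hr hn hf.strictMono hf1) hmono).isConjProd ?_ hg h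
    exact fun g B hB hgB => hgen.eq_one_of_bounded hr hn hc hf hf1 hedge
      (hgen.strong_of_clos_eq hB) hgB
  refine ⟨hprod, ?_⟩
  have := hgen.nontrivial_aut hr hf hf1 hedge
  refine ⟨fun N hN => ?_⟩
  rw [or_iff_not_imp_left, Subgroup.eq_bot_iff_forall]
  intro hne
  push Not at hne
  obtain ⟨g, hgN, hg⟩ := hne
  refine (Subgroup.eq_top_iff' N).2 fun h => ?_
  obtain ⟨l, -, hl, rfl⟩ := hprod g hg h
  refine N.list_prod_mem fun x hx => ?_
  rcases hl x hx with hc | hc <;> obtain ⟨c, rfl⟩ := isConj_iff.1 hc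
  · exact hN.conj_mem g hgN c
  · exact hN.conj_mem _ (N.inv_mem hgN) c
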